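/- Let $G=(V,E)$ be a chordal graph on $n\ge 1$ nodes with chromatic number $\chi(G)$, let $\frac{2}{\chi(G)}<\epsilon\le 1$ be real, and set $k=2/\epsilon$. A *clique forest* of $G$ is a forest $\mathcal T$ whose vertices are the maximal cliques of $G$, whose edges join intersecting cliques, and in which, for every node $v$, the cliques containing $v$ induce a tree. A path in a forest is *binary* if all its vertices have degree at most $2$ in the forest; a binary path is *pendant* if one of its end vertices has degree $1$ or it is an isolated vertex, and *internal* if all its vertices have degree $2$. The *diameter* of a path of cliques is the largest distance in $G$ between two nodes of the union of its cliques. Colors are positive integers, and a coloring *with at most $b$ colors* takes values in $\{1,\dots,\lfloor b\rfloor\}$. Then $G$ has a clique forest, and for every clique forest $\mathcal T$ of $G$ consider the following (nondeterministic) algorithm. 1. *Pruning.* Put $\mathcal T_1=\mathcal T$, $U_1=V$. For $i=1,\dots,\lceil\log_2 n\rceil$, let $\mathcal L_i$ be the set of all maximal binary paths of $\mathcal T_i$ that are pendant or that are internal of diameter at least $3k$; let $V_i$ be the set of all $v\in U_i$ for which the vertices of $\mathcal T_i$ containing $v$ form a subpath of some path in $\mathcal L_i$; let $U_{i+1}=U_i\setminus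 V_i$, and obtain $\mathcal T_{i+1}$ from $\mathcal T_i$ by removing all paths in $\mathcal L_i$. 2. *Coloring.* For each $i$, color $G[V_i]$ legally with at most $(1+\frac1k)\chi(G[V_i])+1$ colors, in any way. 3. *Color correction.* For $i=\lceil\log_2 n\rceil-1,\dots,1$ and, in any order, for each $\mathcal P\in\mathcal L_i$: let $W$ be the set of $w\in U_i$ for which the vertices of $\mathcal T_i$ containing $w$ form a subpath of $\mathcal P$, and let $W'\subseteq\bigcup_{l>i}V_l$ be the set of nodes that have a neighbor in $W$. Change, in any way, the colors of nodes of $W$ at distance at most $k+3$ in $G$ from some node of $W'$, so that $G[W\cup W']$ becomes legally colored with at most $(1+\frac1k)\chi(G)+1$ colors. The layers $V_1,\dots,V_{\lceil\log_2 n\rceil}$ partition $V$; every step of the algorithm can be carried out, whatever choices were made before; and every coloring it outputs is a legal coloring of $G$ with at most $$\Bigl(1+\frac1k\Bigr)\chi(G)+1\;\le\;(1+\epsilon)\,\chi(G)$$ colors. -/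

import Mathlib

namespace ChordalColoring

/-- A graph is chordal if every cycle of length at least four has a chord: an edge of the graph
joining two nodes of the cycle that are not consecutive on it. -/
def IsChordal {V : Type*} (G : SimpleGraph V) : Prop :=
  ∀ (v : V) (p : G.Walk v v), p.IsCycle → 4 ≤ p.length →
    ∃ u ∈ p.support, ∃ w ∈ p.support, G.Adj u w ∧ s(u, w) ∉ p.edges

/-- The maximal cliques of `G`. -/
abbrev MaxClique {V : Type*} (G : SimpleGraph V) : Type _ :=
  {C : Set V // Maximal (fun S : Set V => G.IsClique S) C}

/-- A clique forest of `G`: a forest on the maximal cliques of `G`, all of whose edges join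
intersecting cliques (edges of the clique intersection graph), such that the maximal cliques
containing any given node induce a tree. -/
structure IsCliqueForest {V : Type*} (G : SimpleGraph V) (T : SimpleGraph (MaxClique G)) :
    Prop where
  acyclic : T.IsAcyclic
  inter_nonempty : ∀ C D : MaxClique G, T.Adj C D → (C.1 ∩ D.1).Nonempty
  isTree_node : ∀ v : V, (T.induce {C : MaxClique G | v ∈ C.1}).IsTree

/-- The (real-valued, but integral) chromatic number of a graph that has a finite colouring. -/
noncomputable def chi {V : Type*} (G : SimpleGraph V) : ℝ := (G.chromaticNumber.toNat : ℝ)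

/-- `c` is a legal colouring of `G[S]` with colours from `{1, 2, …, ⌊b⌋}`. -/
def LegalOn {V : Type*} (G : SimpleGraph V) (S : Set V) (b : ℝ) (c : V → ℕ) : Prop :=
  (∀ v ∈ S, 1 ≤ c v ∧ (c v : ℝ) ≤ b) ∧ ∀ u ∈ S, ∀ v ∈ S, G.Adj u v → c u ≠ c v

section Paths

variable {N : Type*}

/-- `S` is the vertex set of a (nonempty) path of `T`. -/
def IsPathSet (T : SimpleGraph N) (S : Set N) : Prop :=
  ∃ (a b : N) (p : T.Walk a b), p.IsPath ∧ {C | C ∈ p.support} = S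

/-- Degree of `C` in the subgraph `T[X]`. -/
noncomputable def degIn (T : SimpleGraph N) (X : Set N) (C : N) : ℕ :=
  {D | D ∈ X ∧ T.Adj C D}.ncard

/-- `P` is (the vertex set of) a binary path of `T[X]`: all its vertices have degree at most 2. -/
def IsBinaryPath (T : SimpleGraph N) (X P : Set N) : Prop :=
  IsPathSet T P ∧ P ⊆ X ∧ ∀ C ∈ P, degIn T X C ≤ 2

/-- `P` is a pendant path of `T[X]`: a binary path with an end vertex of degree 1, or an isolated
vertex. -/
def IsPendantPath (T : SimpleGraph N) (X P : Set N) : Prop :=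
  IsBinaryPath T X P ∧
    ∃ (a b : N) (p : T.Walk a b), p.IsPath ∧ {C | C ∈ p.support} = P ∧
      (degIn T X a = 1 ∨ degIn T X b = 1 ∨ (P = {a} ∧ degIn T X a = 0))

/-- `P` is an internal path of `T[X]`: a path all of whose vertices have degree exactly 2. -/
def IsInternalPath (T : SimpleGraph N) (X P : Set N) : Prop :=
  IsBinaryPath T X P ∧ ∀ C ∈ P, degIn T X C = 2

end Paths

section Algorithm

variable {V : Type*} {G : SimpleGraph V}

/-- The diameter of a path `P` of cliques: the maximum distance in `G` between nodes of the union
of its cliques. -/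
noncomputable def pathDiam (P : Set (MaxClique G)) : ℕ :=
  sSup {d : ℕ | ∃ C ∈ P, ∃ D ∈ P, ∃ u ∈ C.1, ∃ v ∈ D.1, d = G.dist u v}

/-- The paths removed from the forest `T[X]` in one pruning iteration: all maximal binary paths
that are pendant, and all those that are internal and have diameter at least `3 k`. -/
def prunedPaths (T : SimpleGraph (MaxClique G)) (k : ℝ) (X : Set (MaxClique G)) :
    Set (Set (MaxClique G)) :=
  {P | Maximal (IsBinaryPath T X) P ∧
    (IsPendantPath T X P ∨ (IsInternalPath T X P ∧ 3 * k ≤ (pathDiam P : ℝ)))}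

/-- The nodes `v ∈ U` whose subtree in `T[X]` (the one on the cliques of `X` containing `v`) is a
subpath of `P`. -/
def nodesInside (T : SimpleGraph (MaxClique G)) (X : Set (MaxClique G)) (U : Set V)
    (P : Set (MaxClique G)) : Set V :=
  {v | v ∈ U ∧ IsPathSet T {C | C ∈ X ∧ v ∈ C.1} ∧ {C | C ∈ X ∧ v ∈ C.1} ⊆ P}

/-- State of the pruning phase: the vertex set of the current forest (an induced subgraph of the
clique forest) and the set of nodes that have not been removed yet. -/
structure PruneState (G : SimpleGraph V) where
  cliques : Set (MaxClique G)
  nodes : Set V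

/-- The state after `i` pruning iterations. -/
def pruneState (T : SimpleGraph (MaxClique G)) (k : ℝ) : ℕ → PruneState G
  | 0 => ⟨Set.univ, Set.univ⟩
  | i + 1 =>
    let st := pruneState T k i
    ⟨st.cliques \ ⋃ P ∈ prunedPaths T k st.cliques, P,
      st.nodes \ ⋃ P ∈ prunedPaths T k st.cliques, nodesInside T st.cliques st.nodes P⟩

/-- The set of paths removed in iteration `i` (iterations are counted from `0`). -/
def layerPaths (T : SimpleGraph (MaxClique G)) (k : ℝ) (i : ℕ) : Set (Set (MaxClique G)) :=
  prunedPaths T k (pruneState T k i).cliques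

/-- The nodes whose subtree in the forest of iteration `i` is a subpath of `P`. -/
def pathNodes (T : SimpleGraph (MaxClique G)) (k : ℝ) (i : ℕ) (P : Set (MaxClique G)) : Set V :=
  nodesInside T (pruneState T k i).cliques (pruneState T k i).nodes P

/-- The layer of nodes removed in iteration `i`. -/
def layer (T : SimpleGraph (MaxClique G)) (k : ℝ) (i : ℕ) : Set V :=
  ⋃ P ∈ layerPaths T k i, pathNodes T k i P

/-- The number `⌈log₂ n⌉` of iterations. -/
def numIter (V : Type*) [Fintype V] : ℕ := Nat.clog 2 (Fintype.card V)

/-- A possible result of the colouring phase: each layer `V_i` is legally coloured with at most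
`(1 + 1/k) χ(G[V_i]) + 1` colours, independently of the other layers. -/
def IsColoringPhase [Fintype V] (T : SimpleGraph (MaxClique G)) (k : ℝ) (c : V → ℕ) : Prop :=
  ∀ i < numIter V,
    LegalOn G (layer T k i) ((1 + 1 / k) * chi (G.induce (layer T k i)) + 1) c

/-- The nodes of the layers after `i` that have a neighbour among the nodes inside `P`. -/
def boundary [Fintype V] (T : SimpleGraph (MaxClique G)) (k : ℝ) (i : ℕ)
    (P : Set (MaxClique G)) : Set V :=
  {u | (∃ l, i < l ∧ l < numIter V ∧ u ∈ layer T k l) ∧ ∃ w ∈ pathNodes T k i P, G.Adj u w}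

/-- The possible recolourings `c ↦ c'` for a path `P` of iteration `i`: with `W` the nodes inside
`P` and `W'` its boundary, only nodes of `W` at distance at most `k + 3` from some node of `W'`
may change their colour, and afterwards `G[W ∪ W']` is legally coloured with colours from
`{1, …, ⌊(1 + 1/k) χ(G) + 1⌋}`. -/
def CorrectionStep [Fintype V] (T : SimpleGraph (MaxClique G)) (k : ℝ)
    (s : ℕ × Set (MaxClique G)) (c c' : V → ℕ) : Prop :=
  (∀ v, c' v ≠ c v → v ∈ pathNodes T k s.1 s.2 ∧
    ∃ u ∈ boundary T k s.1 s.2, G.Reachable v u ∧ (G.dist v u : ℝ) ≤ k + 3) ∧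
  LegalOn G (pathNodes T k s.1 s.2 ∪ boundary T k s.1 s.2) ((1 + 1 / k) * chi G + 1) c'

/-- An order in which the colour correction phase may treat the paths: the iterations
`⌈log₂ n⌉ - 1, …, 1` (counted from `1`) downwards, and within an iteration each of its paths
exactly once, in any order. -/
def IsSchedule [Fintype V] (T : SimpleGraph (MaxClique G)) (k : ℝ)
    (l : List (ℕ × Set (MaxClique G))) : Prop :=
  l.Nodup ∧ (∀ s, s ∈ l ↔ s.1 + 1 < numIter V ∧ s.2 ∈ layerPaths T k s.1) ∧
    l.Pairwise (fun s t => t.1 ≤ s.1)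

/-- Treating the paths in the list `l` one after the other may turn colouring `c` into `c'`. -/
def CorrectionRun [Fintype V] (T : SimpleGraph (MaxClique G)) (k : ℝ) :
    List (ℕ × Set (MaxClique G)) → (V → ℕ) → (V → ℕ) → Prop
  | [], c, c' => c' = c
  | s :: l, c, c' => ∃ d, CorrectionStep T k s c d ∧ CorrectionRun T k l d c'

end Algorithm

end ChordalColoring

open ChordalColoring

/-!
Two facts carry the proof.

**Pruning.** Write `T[X]` for the current forest and `U` for the remaining nodes. Removing a path of
`T[X]` with two different neighbours could destroy the representation of `G[U]` by `T[X]` only if a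
node, or two adjacent nodes, occurred in all of its cliques. Such a path has diameter at most three,
but it is internal, so it was removed because its diameter is at least `3 k ≥ 6`. Hence the
properties `IsPruned` are invariant (`IsPruned.step`). Let `β` be the number of cliques of degree at
least three in `T[X]`. A clique that becomes a leaf in a pruning iteration had degree at least three
before, and a forest has at least two more leaves than branching vertices, so `β` at least halves
(`two_mul_ncard_branching_le`). A chordal graph on `n` nodes has at most `n + 1` maximal cliques, so
`β = 0` before the last iteration, which then removes everything: what is left are paths, all
pendant. This gives the partition into layers (`existsUnique_layer`).

**Correction.** Let `W` be the nodes inside a removed path and `W'` their neighbours in later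
layers. The cliques of the path represent `G[W ∪ W']` as an interval graph, each node of `W'` lies
in an end clique, and if both end cliques are needed, then they are far apart
(`IsPruned.exists_ends`). The colours near one end have to be changed so that they agree with given
colours on the end clique. Fix a colouring `ψ` of `G` with `χ(G)` colours. On a clique, every
colouring is an injective assignment of colours to classes of `ψ`. Let the nodes at distance `j`
from the end clique use the `j`-th element of a sequence of such assignments. The result is legal if
no colour passes directly from one class to another between consecutive assignments. Such a
sequence, connecting any two given assignments in `t + 2` rounds, exists when there are at least
`χ(G) / t` spare colours (`exists_recoloring_sequence`). With `t = ⌈k⌉`, the `⌊χ(G) / k⌋ + 1` spare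
colours available are enough, and only nodes at distance at most `t + 2 ≤ k + 3` change.

For the sequence, consider the permutation of the colours that takes the first assignment to the
second one. Its cycles without a spare colour are the obstacle; the first round merges all cycles
into one. This round is allowed to pass colours from one class to another, but only in one direction
of the order in which the intervals of the end clique end, where it causes no conflict
(`exists_perm_single_orbit`). The spare colours now cut the cycle into chains, along each of which
the classes can take their final colours one after the other. The second round moves some classes to
spare colours, so that no class has to wait longer than `t` rounds (`exists_balanced_schedule`).

As the layers are treated in descending order, a correction step finds `W` and `W'` legally
coloured and repairs all conflicts between them, while it changes nothing in other paths
(`CorrectedOn.step`, `CorrectedOn.exists_correctionStep`).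
-/

namespace ChordalColoring

/-! ### Merging the cycles of a permutation -/

section Permutations

open Equiv

lemma mem_of_sameCycle {N : Type*} [Finite N] {f : Perm N} {S : Set N}
    (hS : ∀ x ∈ S, f x ∈ S) {x y : N} (hx : x ∈ S) (h : f.SameCycle x y) : y ∈ S := by
  obtain ⟨n, rfl⟩ := h.exists_nat_pow_eq
  clear h
  induction n with
  | zero => simpa using hx
  | succ n ih => rw [pow_succ', Perm.mul_apply]; exact hS _ ih

/-- Composing with a transposition of two points in different cycles merges these cycles. -/
lemma sameCycle_mul_swap {N : Type*} [Finite N] [DecidableEq N] {f : Perm N} {h z w : N}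
    (hz : ¬ f.SameCycle h z) (hw : f.SameCycle h w) :
    (f * swap z w).SameCycle h z ∧ ∀ x, f.SameCycle h x → (f * swap z w).SameCycle h x := by
  set f' := f * swap z w with hf'
  have hfz : f' z = f w := by simp [hf']
  have hfw : f' w = f z := by simp [hf']
  have hne : ∀ x, x ≠ z → x ≠ w → f' x = f x := by
    intro x h1 h2; simp [hf', swap_apply_of_ne_of_ne h1 h2]
  have hinv : ∀ x, f'.SameCycle h x → f'.SameCycle h (f' x) := fun x hx =>
    Perm.sameCycle_apply_right.2 hx
  have hw' : f'.SameCycle h w := by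
    by_contra hcon
    have : w ∈ {x | f'.SameCycle h x ∧ f.SameCycle h x} := by
      refine mem_of_sameCycle (f := f) ?_ ⟨Perm.SameCycle.refl _ _, Perm.SameCycle.refl _ _⟩ hw
      rintro x ⟨h1, h2⟩
      refine ⟨?_, Perm.sameCycle_apply_right.2 h2⟩
      rw [← hne x]
      · exact hinv x h1
      · rintro rfl; exact hz h2
      · rintro rfl; exact hcon h1
    exact hcon this.1
  have hz' : f'.SameCycle h z := by
    by_contra hcon
    have : z ∈ {x | f'.SameCycle h x ∧ f.SameCycle z x} := by
      refine mem_of_sameCycle (f := f) (x := f z) ?_ ⟨?_, ?_⟩ ?_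
      · rintro x ⟨h1, h2⟩
        refine ⟨?_, Perm.sameCycle_apply_right.2 h2⟩
        rw [← hne x]
        · exact hinv x h1
        · rintro rfl; exact hcon h1
        · rintro rfl; exact hz (hw.trans h2.symm)
      · rw [← hfw]; exact hinv _ hw'
      · exact Perm.sameCycle_apply_right.2 (Perm.SameCycle.refl _ _)
      · exact Perm.sameCycle_apply_left.2 (Perm.SameCycle.refl _ _)
    exact hcon this.1
  refine ⟨hz', fun x hx => ?_⟩
  refine mem_of_sameCycle (f := f) (S := {x | f'.SameCycle h x}) ?_ (Perm.SameCycle.refl _ _) hx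
  intro x hx
  by_cases h1 : x = z
  · subst h1; rw [← hfw]; exact hinv _ hw'
  by_cases h2 : x = w
  · subst h2; rw [← hfz]; exact hinv _ hz'
  rw [← hne x h1 h2]; exact hinv _ hx

/-- A permutation can be turned into a single cycle by composing it with a permutation `μ` that
does not increase a given key, except at one point `h` of smallest key. -/
lemma exists_perm_single_orbit {N β : Type*} [Finite N] [LinearOrder β] (ν : Perm N) (R : N → β)
    (h : N) (hmin : ∀ n, R h ≤ R n) :
    ∃ μ : Perm N, (∀ n, n ≠ h → R (μ n) ≤ R n) ∧ ∀ n, (ν * μ).SameCycle h n := by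
  classical
  let Valid : Perm N → Prop := fun μ =>
    (∀ n, n ≠ h → R (μ n) ≤ R n) ∧ ∀ z, ¬ (ν * μ).SameCycle h z → μ z = z
  have : Nonempty {μ // Valid μ} := ⟨⟨1, by simp [Valid]⟩⟩
  obtain ⟨⟨μ, hμ1, hμ2⟩, hmax⟩ := Finite.exists_max
    (fun μ : {μ // Valid μ} => {x | (ν * μ.1).SameCycle h x}.ncard)
  refine ⟨μ, hμ1, ?_⟩
  by_contra! hz
  obtain ⟨z, hz⟩ := hz
  set f := ν * μ with hf
  have hpres : ∀ x, f.SameCycle h x → f.SameCycle h (μ x) := by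
    intro x hx
    by_contra hcon
    have := μ.injective (hμ2 _ hcon)
    rw [this] at hcon
    exact hcon hx
  -- a point `w` of the orbit of `h` at which the key drops from above to below the key of `z`
  obtain ⟨w, hw, hw1, hw2⟩ : ∃ w, f.SameCycle h w ∧ (w = h ∨ R z ≤ R w) ∧ R (μ w) ≤ R z := by
    by_contra! hcon
    let Y : Set N := {w | f.SameCycle h w ∧ (w = h ∨ R z ≤ R w)}
    have hY : Set.MapsTo μ Y Y := fun w hw =>
      ⟨hpres w hw.1, Or.inr (hcon w hw.1 hw.2).le⟩
    obtain ⟨⟨w, hw⟩, hwh⟩ := Finite.surjective_of_injective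
      (hY.restrict_inj.2 μ.injective.injOn) ⟨h, Perm.SameCycle.refl _ _, Or.inl rfl⟩
    replace hwh : μ w = h := congrArg Subtype.val hwh
    have := hcon w hw.1 hw.2
    rw [hwh] at this
    exact absurd (hmin z) (not_le.2 this)
  obtain ⟨hm1, hm2⟩ := sameCycle_mul_swap hz hw
  have hval : Valid (μ * swap z w) := by
    have e : ν * (μ * swap z w) = f * swap z w := by rw [hf, mul_assoc]
    constructor
    · intro n hn
      by_cases h1 : n = z
      · subst h1; simpa using hw2
      by_cases h2 : n = w
      · subst h2
        rcases hw1 with h3 | h3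
        · exact absurd h3 hn
        · simpa [hμ2 z hz] using h3
      simpa [swap_apply_of_ne_of_ne h1 h2] using hμ1 n hn
    · intro y hy
      rw [e] at hy
      have h1 : y ≠ z := by rintro rfl; exact hy hm1
      have h2 : y ≠ w := by rintro rfl; exact hy (hm2 _ hw)
      rw [Perm.mul_apply, swap_apply_of_ne_of_ne h1 h2]
      exact hμ2 y fun hc => hy (hm2 _ hc)
  have hlt : {x | f.SameCycle h x}.ncard <
      {x | (ν * (μ * swap z w)).SameCycle h x}.ncard := by
    rw [← mul_assoc]
    refine Set.ncard_lt_ncard ⟨fun x hx => hm2 x hx, fun hc => hz (hc hm1)⟩ (Set.toFinite _)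
  exact absurd (hmax ⟨_, hval⟩) (not_le.2 hlt)

end Permutations

/-! ### Balancing chains -/

section Balancing

/-- Balancing of chains. A family of disjoint chains of elements is given, chain `ℓ i` waiting for
slot `i`; an element can only be treated after its predecessor in the chain, unless the predecessor
is moved away to a slot `i'`, in which case the head of `ℓ i'` has to wait for it instead.
If the average length is at most `t`, then after moving suitable elements (those with
`m x = some i'`), all elements can be treated within time `t`, element `x` at time `g x`. -/
lemma exists_balanced_schedule {α : Type*} [DecidableEq α] (t : ℕ) (ht : 1 ≤ t) :
    ∀ (I : Finset α) (ℓ : α → List α), (∀ i ∈ I, (ℓ i).Nodup) →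
    (∀ i ∈ I, ∀ j ∈ I, i ≠ j → (ℓ i).Disjoint (ℓ j)) →
    ∑ i ∈ I, (ℓ i).length ≤ I.card * t →
    ∃ (m : α → Option α) (g : α → ℕ),
      (∀ i ∈ I, (ℓ i).IsChain (fun y x => m y = none → g y < g x)) ∧
      (∀ x h, m x = some h → h ∈ I ∧ ∀ a ∈ (ℓ h).head?, g x < g a) ∧
      (∀ x h, m x = some h → ∃ i ∈ I, ∃ l₁ l₂, ℓ i = l₁ ++ x :: l₂ ∧ t ≤ l₂.length) ∧
      (∀ x y h, m x = some h → m y = some h → x = y) ∧ ∀ x, 1 ≤ g x ∧ g x ≤ t := by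
  intro I
  induction hn : I.card using Nat.strong_induction_on generalizing I with
  | _ n ih =>
  subst hn
  intro ℓ hnd hdis hsum
  by_cases hlong : ∀ i ∈ I, (ℓ i).length ≤ t
  · -- no chain is too long: treat each chain in its order
    let g : α → ℕ := fun x =>
      if h : ∃ i ∈ I, x ∈ ℓ i then (ℓ h.choose).idxOf x + 1 else 1
    have hg : ∀ i ∈ I, ∀ x ∈ ℓ i, g x = (ℓ i).idxOf x + 1 := by
      intro i hi x hx
      have h : ∃ i ∈ I, x ∈ ℓ i := ⟨i, hi, hx⟩
      have : h.choose = i := by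
        by_contra hc
        exact hdis _ h.choose_spec.1 _ hi hc h.choose_spec.2 hx
      simp only [g, dif_pos h, this]
    refine ⟨fun _ => none, g, ?_, by simp, by simp, by simp, ?_⟩
    · intro i hi
      rw [List.isChain_iff_getElem]
      intro j hj _
      rw [hg i hi _ (List.getElem_mem _), hg i hi _ (List.getElem_mem _),
        (hnd i hi).idxOf_getElem, (hnd i hi).idxOf_getElem]
      omega
    · intro x
      by_cases h : ∃ i ∈ I, x ∈ ℓ i
      · obtain ⟨i, hi, hx⟩ := h
        rw [hg i hi x hx]
        have := List.idxOf_lt_length_of_mem hx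
        have := hlong i hi
        omega
      · simp only [g, dif_neg h]; omega
  push Not at hlong
  obtain ⟨a, ha, hat⟩ := hlong
  obtain ⟨b, hb, hbt⟩ : ∃ b ∈ I, (ℓ b).length < t := by
    by_contra! hc
    have := Finset.sum_lt_sum hc ⟨a, ha, hat⟩
    simp at this
    omega
  have hab : a ≠ b := by rintro rfl; omega
  -- Split the long chain as `ℓ a = top ++ x :: bot`, where `bot` has length `t`, and move `x` to
  -- be dropped when `top ++ x :: ℓ b` becomes the chain of slot `a`.
  obtain ⟨top, x, bot, hl, hbot⟩ : ∃ top x bot, ℓ a = top ++ x :: bot ∧ bot.length = t := by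
    refine ⟨(ℓ a).take ((ℓ a).length - t - 1), (ℓ a)[(ℓ a).length - t - 1]'(by omega),
      (ℓ a).drop ((ℓ a).length - t), ?_, by simp; omega⟩
    conv_lhs => rw [← List.take_append_drop ((ℓ a).length - t - 1) (ℓ a)]
    rw [List.drop_eq_getElem_cons (by omega)]
    congr 3
    omega
  have hnda := hnd a ha
  rw [hl] at hnda
  have hdab := hdis a ha b hb hab
  let ℓ' : α → List α := Function.update ℓ a (top ++ x :: ℓ b)
  have hℓa : ℓ' a = top ++ x :: ℓ b := by simp [ℓ']
  have hℓ : ∀ i, i ≠ a → ℓ' i = ℓ i := fun i hi => by simp [ℓ', hi]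
  have hmemb : ∀ i ∈ I, ∀ y ∈ bot, y ∈ ℓ i → i = a := by
    intro i hi y hy hyi
    by_contra hc
    exact hdis i hi a ha hc hyi (by rw [hl]; simp [hy])
  have hsub : ∀ y, y ∈ ℓ' a → y ∈ ℓ a ∨ y ∈ ℓ b := by
    intro y hy
    rw [hℓa] at hy; rw [hl]
    simp at hy ⊢; tauto
  have hnotbot : ∀ i ∈ I.erase b, ∀ y ∈ ℓ' i, y ∉ bot := by
    intro i hi y hy hyb
    by_cases hia : i = a
    · subst hia
      rw [hℓa] at hy
      simp only [List.mem_append, List.mem_cons] at hy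
      rw [List.nodup_append] at hnda
      rcases hy with hy | hy | hy
      · exact hnda.2.2 _ hy _ (by simp [hyb]) rfl
      · subst hy; simp [hyb] at hnda
      · exact hab (hmemb b hb y hyb hy).symm
    · rw [hℓ i hia] at hy
      exact hia (hmemb i (Finset.mem_of_mem_erase hi) y hyb hy)
  have side1 : ∀ i ∈ I.erase b, (ℓ' i).Nodup := by
    intro i hi
    by_cases hia : i = a
    · subst hia
      rw [hℓa]
      have h1 := hnda
      rw [List.nodup_append] at h1 ⊢
      refine ⟨h1.1, ?_, ?_⟩
      · refine List.nodup_cons.2 ⟨fun hc => hdab (by rw [hl]; simp) hc, hnd b hb⟩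
      · intro y hy z hz
        rcases List.mem_cons.1 hz with rfl | hz
        · exact h1.2.2 y hy _ (by simp)
        · rintro rfl; exact hdab (by rw [hl]; simp [hy]) hz
    · rw [hℓ i hia]; exact hnd i (Finset.mem_of_mem_erase hi)
  have side2 : ∀ i ∈ I.erase b, ∀ j ∈ I.erase b, i ≠ j → (ℓ' i).Disjoint (ℓ' j) := by
    have key : ∀ j ∈ I.erase b, j ≠ a → (ℓ' a).Disjoint (ℓ' j) := by
      intro j hj hja y hy hyj
      rw [hℓ j hja] at hyj
      rcases hsub y hy with h | h
      · exact hdis a ha j (Finset.mem_of_mem_erase hj) hja.symm h hyj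
      · exact hdis b hb j (Finset.mem_of_mem_erase hj) (Finset.ne_of_mem_erase hj).symm h hyj
    intro i hi j hj hij
    by_cases hia : i = a
    · subst hia; exact key j hj hij.symm
    by_cases hja : j = a
    · subst hja; exact (key i hi hij).symm
    rw [hℓ i hia, hℓ j hja]
    exact hdis i (Finset.mem_of_mem_erase hi) j (Finset.mem_of_mem_erase hj) hij
  have side3 : ∑ i ∈ I.erase b, (ℓ' i).length ≤ (I.erase b).card * t := by
    have haI : a ∈ I.erase b := Finset.mem_erase.2 ⟨hab, ha⟩
    have e1 : ∑ i ∈ I, (ℓ i).length =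
        (ℓ b).length + ((ℓ a).length + ∑ i ∈ (I.erase b).erase a, (ℓ i).length) := by
      rw [Finset.add_sum_erase _ (fun i => (ℓ i).length) haI,
        Finset.add_sum_erase _ (fun i => (ℓ i).length) hb]
    have e2 : ∑ i ∈ I.erase b, (ℓ' i).length =
        (ℓ' a).length + ∑ i ∈ (I.erase b).erase a, (ℓ i).length := by
      rw [← Finset.add_sum_erase _ (fun i => (ℓ' i).length) haI]
      congr 1
      exact Finset.sum_congr rfl fun i hi => by rw [hℓ i (Finset.ne_of_mem_erase hi)]
    have e3 : (ℓ' a).length + t = (ℓ a).length + (ℓ b).length := by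
      rw [hℓa, hl]; simp; omega
    have e4 : I.card = (I.erase b).card + 1 := (Finset.card_erase_add_one hb).symm
    rw [e4, add_mul, one_mul] at hsum
    omega
  obtain ⟨m, g, hm1, hm2, hm3, hm4, hm5⟩ := ih (I.erase b).card
    (Finset.card_erase_lt_of_mem hb) (I.erase b) rfl ℓ' side1 side2 side3
  have haI : a ∈ I.erase b := Finset.mem_erase.2 ⟨hab, ha⟩
  have hxbot : x ∉ bot := hnotbot a haI x (by rw [hℓa]; simp)
  -- `x` has not been moved: fewer than `t` elements follow it in its new chain
  have hmx : m x = none := by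
    by_contra hc
    obtain ⟨h, hh⟩ := Option.ne_none_iff_exists'.1 hc
    obtain ⟨i, hi, l₁, l₂, he, hlen⟩ := hm3 x h hh
    have hia : i = a := by
      by_contra hia
      rw [hℓ i hia] at he
      exact hdis i (Finset.mem_of_mem_erase hi) a ha hia
        (show x ∈ ℓ i by rw [he]; simp) (by rw [hl]; simp)
    subst hia
    rw [hℓa] at he
    have hxtop : x ∉ top := fun hc => by
      rw [List.nodup_append] at hnda
      exact hnda.2.2 _ hc _ (by simp) rfl
    have hxb : x ∉ ℓ b := fun hc => hdab (by rw [hl]; simp) hc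
    rw [List.append_eq_append_iff] at he
    rcases he with ⟨c, h1, h2⟩ | ⟨c, h1, h2⟩
    · cases c with
      | nil => simp at h2; rw [h2] at hbt; omega
      | cons d c => simp at h2; exact hxb (by rw [h2.2]; simp)
    · cases c with
      | nil => simp at h2; rw [h2] at hlen; omega
      | cons d c => simp at h2; exact hxtop (by rw [h1, h2.1]; simp)
  have hmem : ∀ y h, m y = some h → ∃ i ∈ I.erase b, y ∈ ℓ' i := fun y h hy => by
    obtain ⟨i, hi, l₁, l₂, he, -⟩ := hm3 y h hy
    exact ⟨i, hi, by rw [he]; simp⟩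
  have hmbot : ∀ y h, m y = some h → y ∉ bot := fun y h hy => by
    obtain ⟨i, hi, he⟩ := hmem y h hy
    exact hnotbot i hi y he
  let m' : α → Option α := Function.update m x (some b)
  let g' : α → ℕ := fun y => if y ∈ bot then bot.idxOf y + 1 else g y
  have hg1 : ∀ y, y ∉ bot → g' y = g y := fun y hy => by simp [g', hy]
  have hg2 : ∀ y, y ∈ bot → g' y = bot.idxOf y + 1 := fun y hy => by simp [g', hy]
  have hmx' : m' x = some b := by simp [m']
  have hm' : ∀ y, y ≠ x → m' y = m y := fun y hy => by simp [m', hy]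
  have hbnd : bot.Nodup := by
    rw [List.nodup_append, List.nodup_cons] at hnda; exact hnda.2.1.2
  have hchain : ∀ l : List α, (∀ y ∈ l, y ∉ bot) →
      l.IsChain (fun y x => m y = none → g y < g x) →
      l.IsChain (fun y x => m' y = none → g' y < g' x) := by
    intro l hlb hc
    refine hc.imp_of_mem_imp ?_
    intro y z hy hz h1 h2
    rw [hg1 y (hlb y hy), hg1 z (hlb z hz)]
    apply h1
    by_cases hyx : y = x
    · rw [hyx, hmx'] at h2; cases h2
    · rwa [hm' y hyx] at h2
  have hca := hm1 a haI
  rw [hℓa] at hca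
  refine ⟨m', g', ?_, ?_, ?_, ?_, ?_⟩
  · intro i hi
    by_cases hib : i = b
    · subst hib
      refine hchain _ (fun y hy hyb => hab (hmemb _ hb y hyb hy).symm) ?_
      rw [List.isChain_split] at hca
      exact hca.2.tail
    by_cases hia : i = a
    · subst hia
      rw [hl, List.isChain_split]
      constructor
      · refine hchain _ ?_ (List.isChain_split.1 hca).1
        intro y hy
        refine hnotbot i haI y ?_
        rw [hℓa]; simp at hy ⊢; tauto
      · have hbc : bot.IsChain (fun y x => m' y = none → g' y < g' x) := by
          rw [List.isChain_iff_getElem]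
          intro j hj _
          rw [hg2 _ (List.getElem_mem _), hg2 _ (List.getElem_mem _),
            hbnd.idxOf_getElem, hbnd.idxOf_getElem]
          omega
        cases bot with
        | nil => simp
        | cons d bot =>
          rw [List.isChain_cons_cons]
          exact ⟨fun h => (by rw [hmx'] at h; cases h), hbc⟩
    · have hi' : i ∈ I.erase b := Finset.mem_erase.2 ⟨hib, hi⟩
      have := hchain _ (hnotbot i hi') (hm1 i hi')
      rwa [hℓ i hia] at this
  · intro y h hy
    by_cases hyx : y = x
    · subst hyx
      rw [hmx'] at hy
      obtain rfl : b = h := by simpa using hy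
      refine ⟨hb, fun c hc => ?_⟩
      have hcb : c ∈ ℓ b := List.mem_of_mem_head? hc
      rw [hg1 _ hxbot, hg1 c (fun h => hab (hmemb _ hb c h hcb).symm)]
      rw [List.isChain_split] at hca
      rw [List.isChain_cons] at hca
      exact hca.2.1 c hc hmx
    · rw [hm' y hyx] at hy
      obtain ⟨h1, h2⟩ := hm2 y h hy
      refine ⟨Finset.mem_of_mem_erase h1, fun c hc => ?_⟩
      rw [hg1 y (hmbot y h hy)]
      by_cases hha : h = a
      · subst hha
        have hc' : c ∈ (ℓ' h).head? := by
          rw [hl] at hc; rw [hℓa]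
          cases top <;> simpa using hc
        rw [hg1 c (hnotbot h haI c (List.mem_of_mem_head? hc'))]
        exact h2 c hc'
      · have hc' : c ∈ (ℓ' h).head? := by rwa [hℓ h hha]
        rw [hg1 c (hnotbot h h1 c (List.mem_of_mem_head? hc'))]
        exact h2 c hc'
  · intro y h hy
    by_cases hyx : y = x
    · subst hyx
      exact ⟨a, ha, top, bot, hl, hbot.ge⟩
    · rw [hm' y hyx] at hy
      obtain ⟨i, hi, l₁, l₂, he, hlen⟩ := hm3 y h hy
      by_cases hia : i = a
      · subst hia
        rw [hℓa] at he
        refine ⟨i, ha, ?_⟩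
        rw [List.append_eq_append_iff] at he
        rcases he with ⟨c, h1, h2⟩ | ⟨c, h1, h2⟩
        · exfalso
          have := congrArg List.length h2
          simp at this
          omega
        · cases c with
          | nil => simp at h2; exact absurd h2.1 hyx
          | cons d c =>
            simp at h2
            obtain ⟨rfl, h2⟩ := h2
            exact ⟨l₁, c ++ x :: bot, by rw [hl, h1]; simp, by simp; omega⟩
      · rw [hℓ i hia] at he
        exact ⟨i, Finset.mem_of_mem_erase hi, l₁, l₂, he, hlen⟩
  · intro y z h hy hz
    have hb' : ∀ y, m y ≠ some b := fun y hy => absurd rfl (Finset.ne_of_mem_erase (hm2 y b hy).1)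
    by_cases hyx : y = x <;> by_cases hzx : z = x
    · rw [hyx, hzx]
    · subst hyx
      rw [hmx'] at hy; rw [hm' z hzx, ← hy] at hz
      exact absurd hz (hb' z)
    · subst hzx
      rw [hmx'] at hz; rw [hm' y hyx, ← hz] at hy
      exact absurd hy (hb' y)
    · rw [hm' y hyx] at hy; rw [hm' z hzx] at hz
      exact hm4 y z h hy hz
  · intro y
    by_cases hy : y ∈ bot
    · rw [hg2 y hy]
      have := List.idxOf_lt_length_of_mem hy
      omega
    · rw [hg1 y hy]; exact hm5 y

end Balancing

/-! ### Sequences of colourings of the classes -/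

section Sequence

open Equiv

/-- If every cycle of a permutation `f` meets `H`, the points outside `H` are arranged in chains
`ℓ η`, each listing the successive images of a point `η ∈ H` until the cycle returns to `H`. The
last clause says that every point outside `H` is followed in its chain by its image, if the latter
is outside `H`. -/
lemma exists_chains {N : Type*} [Finite N] (f : Perm N) (H : Finset N)
    (hH : ∀ n, ∃ h ∈ H, f.SameCycle h n) :
    ∃ ℓ : N → List N, (∀ η ∈ H, (ℓ η).Nodup) ∧
      (∀ i ∈ H, ∀ j ∈ H, i ≠ j → (ℓ i).Disjoint (ℓ j)) ∧
      (∀ η ∈ H, ∀ x ∈ ℓ η, x ∉ H) ∧ (∀ η ∈ H, f η ∉ H → f η ∈ (ℓ η).head?) ∧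
      ∀ r : N → N → Prop, (∀ η ∈ H, (ℓ η).IsChain r) → ∀ y, y ∉ H → f y ∉ H → r y (f y) := by
  classical
  have hex : ∀ η : N, ∃ k, η ∈ H → (f ^ (k + 1)) η ∈ H ∧ ∀ j < k, (f ^ (j + 1)) η ∉ H := by
    intro η
    by_cases hη : η ∈ H
    · have h0 : ∃ k, (f ^ (k + 1)) η ∈ H := by
        refine ⟨orderOf f - 1, ?_⟩
        rw [Nat.sub_add_cancel (orderOf_pos f), pow_orderOf_eq_one]
        simpa using hη
      exact ⟨Nat.find h0, fun _ => ⟨Nat.find_spec h0, fun j hj => Nat.find_min h0 hj⟩⟩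
    · exact ⟨0, fun h => absurd h hη⟩
  choose k hk using hex
  have hinj' : ∀ η ∈ H, ∀ η' ∈ H, ∀ i i', i ≤ i' → i' < k η' →
      (f ^ (i + 1)) η = (f ^ (i' + 1)) η' → i = i' ∧ η = η' := by
    intro η hη η' hη' i i' hii hi' he
    obtain ⟨d, rfl⟩ := Nat.exists_eq_add_of_le hii
    rw [show i + d + 1 = (i + 1) + d by ring, pow_add f (i + 1) d, Perm.mul_apply] at he
    have he' := (f ^ (i + 1)).injective he
    cases d with
    | zero => exact ⟨rfl, by simpa using he'⟩
    | succ d =>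
      exfalso
      refine (hk η' hη').2 d (by omega) ?_
      rwa [← he']
  have hinj : ∀ η ∈ H, ∀ η' ∈ H, ∀ i i', i < k η → i' < k η' →
      (f ^ (i + 1)) η = (f ^ (i' + 1)) η' → i = i' ∧ η = η' := by
    intro η hη η' hη' i i' hi hi' he
    rcases le_total i i' with h | h
    · exact hinj' η hη η' hη' i i' h hi' he
    · obtain ⟨h1, h2⟩ := hinj' η' hη' η hη i' i h hi he.symm
      exact ⟨h1.symm, h2.symm⟩
  refine ⟨fun η => (List.range (k η)).map fun i => (f ^ (i + 1)) η, ?_, ?_, ?_, ?_, ?_⟩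
  · intro η hη
    refine List.Nodup.map_on ?_ List.nodup_range
    intro i hi i' hi' he
    exact (hinj η hη η hη i i' (List.mem_range.1 hi) (List.mem_range.1 hi') he).1
  · intro η hη η' hη' hne x hx hx'
    simp only [List.mem_map, List.mem_range] at hx hx'
    obtain ⟨i, hi, rfl⟩ := hx
    obtain ⟨i', hi', he⟩ := hx'
    exact hne (hinj η hη η' hη' i i' hi hi' he.symm).2
  · intro η hη x hx
    simp only [List.mem_map, List.mem_range] at hx
    obtain ⟨i, hi, rfl⟩ := hx
    exact (hk η hη).2 i hi
  · intro η hη hf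
    have : k η ≠ 0 := fun h0 => hf (by simpa [h0] using (hk η hη).1)
    obtain ⟨d, hd⟩ := Nat.exists_eq_succ_of_ne_zero this
    simp [hd, List.range_succ_eq_map]
  · intro r hr y hy hfy
    have hn : ∃ n, ∃ h ∈ H, (f ^ n) h = y := by
      obtain ⟨h, hh, hs⟩ := hH y
      obtain ⟨n, hn⟩ := hs.exists_nat_pow_eq
      exact ⟨n, h, hh, hn⟩
    obtain ⟨h, hh, hy'⟩ := Nat.find_spec hn
    have hmin := fun m hm => Nat.find_min hn (m := m) hm
    set n := Nat.find hn
    have h1 : n ≠ 0 := by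
      intro h0; rw [h0] at hy'; exact hy (by rw [← hy']; simpa using hh)
    obtain ⟨i, hi⟩ := Nat.exists_eq_succ_of_ne_zero h1
    have hik : i < k h := by
      by_contra hc
      refine hmin (n - (k h + 1)) (by omega) ⟨_, (hk h hh).1, ?_⟩
      rw [← Perm.mul_apply, ← pow_add, Nat.sub_add_cancel (by omega), hy']
    have hfy' : f y = (f ^ (i + 1 + 1)) h := by
      rw [pow_succ' f (i + 1), Perm.mul_apply, ← hy', hi]
    have hik' : i + 1 < k h := by
      by_contra hc
      have : i + 1 = k h := by omega
      rw [hfy', this] at hfy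
      exact hfy (hk h hh).1
    have := List.isChain_iff_getElem.1 (hr h hh) i (by simpa using hik')
    simp only [List.getElem_map, List.getElem_range] at this
    rw [hfy']
    have e : y = (f ^ (i + 1)) h := by rw [← hy', hi]
    rw [e]
    exact this

/-- Two assignments `σ₀`, `τ` of distinct colours to the elements of `X` can be transformed into
each other in `t + 2` rounds, in each of which an element may take a colour that nobody has at the
beginning of the round, if the number of spare colours is at least `|X| / t`. In the first round,
an element may also take the colour of an element whose key is not larger. -/
theorem exists_recoloring_sequence {X Ω β : Type*} [Fintype X] [Fintype Ω] [LinearOrder β]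
    (s t : ℕ) (hs : 1 ≤ s) (ht : 1 ≤ t) (hX : Fintype.card X ≤ s * t)
    (hΩ : Fintype.card X + s ≤ Fintype.card Ω) (σ₀ τ : X → Ω) (hσ₀ : σ₀.Injective)
    (hτ : τ.Injective) (R : X → β) :
    ∃ σ : ℕ → X → Ω, σ 0 = σ₀ ∧ (∀ j, t + 2 ≤ j → σ j = τ) ∧ (∀ j, (σ j).Injective) ∧
      ∀ j x y, σ j x = σ (j + 1) y → x = y ∨ j = 0 ∧ R x ≤ R y := by
  classical
  -- the colours not used by `σ₀`
  let H : Finset Ω := Finset.univ.filter fun n => ∀ x, σ₀ x ≠ n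
  have hHmem : ∀ n, n ∈ H ↔ ∀ x, σ₀ x ≠ n := fun n => by simp [H]
  have hσH : ∀ x, σ₀ x ∉ H := fun x h => (hHmem _).1 h x rfl
  have hHc : Hᶜ.card = Fintype.card X := by
    have : Hᶜ = Finset.univ.image σ₀ := by
      ext n
      rw [Finset.mem_compl, hHmem]
      simp
    rw [this, Finset.card_image_of_injective _ hσ₀, Finset.card_univ]
  have hHcard : H.card + Fintype.card X = Fintype.card Ω := by
    rw [← hHc, Finset.card_add_card_compl]
  obtain ⟨h, hh⟩ : H.Nonempty := Finset.card_pos.1 (by omega)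
  -- a permutation of the colours taking `σ₀` to `τ`
  obtain ⟨e, he⟩ : ∃ e : Perm Ω, ∀ x, e (σ₀ x) = τ x := by
    let e₀ : {n // n ∈ Set.range σ₀} ≃ {n // n ∈ Set.range τ} :=
      (Equiv.ofInjective σ₀ hσ₀).symm.trans (Equiv.ofInjective τ hτ)
    refine ⟨e₀.extendSubtype, fun x => ?_⟩
    rw [Equiv.extendSubtype_apply_of_mem e₀ _ ⟨x, rfl⟩]
    have : (Equiv.ofInjective σ₀ hσ₀).symm ⟨σ₀ x, x, rfl⟩ = x :=
      Equiv.ofInjective_symm_apply hσ₀ x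
    simp [e₀, this]
  let R' : Ω → WithBot β := fun n => if hn : ∃ x, σ₀ x = n then (R hn.choose : WithBot β) else ⊥
  have hR' : ∀ x, R' (σ₀ x) = R x := by
    intro x
    have hn : ∃ y, σ₀ y = σ₀ x := ⟨x, rfl⟩
    have : hn.choose = x := hσ₀ hn.choose_spec
    simp only [R', dif_pos hn, this]
  have hR'h : R' h = ⊥ := by
    simp only [R']
    rw [dif_neg]
    rintro ⟨x, hx⟩
    exact (hHmem h).1 hh x hx
  -- first round: merge all cycles
  obtain ⟨μ, hμ1, hμ2⟩ := exists_perm_single_orbit e⁻¹ R' h (fun n => by rw [hR'h]; exact bot_le)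
  obtain ⟨ℓ, hl1, hl2, hl3, hl4, hl5⟩ := exists_chains (e⁻¹ * μ) H fun n => ⟨h, hh, hμ2 n⟩
  -- second round: balance the chains
  have hsum : ∑ i ∈ H, (ℓ i).length ≤ H.card * t := by
    have e1 : ∑ i ∈ H, (ℓ i).length = (H.biUnion fun i => (ℓ i).toFinset).card := by
      rw [Finset.card_biUnion]
      · exact Finset.sum_congr rfl fun i hi => (List.toFinset_card_of_nodup (hl1 i hi)).symm
      · intro i hi j hj hij
        rw [Function.onFun, Finset.disjoint_left]
        intro x hx hx'
        exact hl2 i hi j hj hij (by simpa using hx) (by simpa using hx')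
    have e2 : (H.biUnion fun i => (ℓ i).toFinset) ⊆ Hᶜ := by
      intro x hx
      simp only [Finset.mem_biUnion, List.mem_toFinset] at hx
      obtain ⟨i, hi, hx⟩ := hx
      exact Finset.mem_compl.2 (hl3 i hi x hx)
    rw [e1]
    calc _ ≤ Hᶜ.card := Finset.card_le_card e2
      _ ≤ s * t := by rw [hHc]; exact hX
      _ ≤ H.card * t := Nat.mul_le_mul_right _ (by omega)
  obtain ⟨m, g, hm1, hm2, hm3, hm4, hm5⟩ := exists_balanced_schedule t ht H ℓ hl1 hl2 hsum
  let σ₁ : X → Ω := fun x => μ (σ₀ x)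
  let σ₂ : X → Ω := fun x => μ ((m (σ₀ x)).getD (σ₀ x))
  have hσ₁ : σ₁.Injective := μ.injective.comp hσ₀
  have hcase : ∀ x, (m (σ₀ x) = none ∧ σ₂ x = μ (σ₀ x)) ∨
      ∃ η ∈ H, m (σ₀ x) = some η ∧ σ₂ x = μ η := by
    intro x
    cases hmx : m (σ₀ x) with
    | none => left; simp [σ₂, hmx]
    | some η => right; exact ⟨η, (hm2 _ _ hmx).1, rfl, by simp [σ₂, hmx]⟩
  have h12 : ∀ x y, σ₁ x = σ₂ y → x = y := by
    intro x y hxy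
    rcases hcase y with ⟨-, h2⟩ | ⟨η, hη, -, h2⟩
    · rw [h2] at hxy; exact hσ₁ hxy
    · rw [h2] at hxy
      exact absurd (by rw [μ.injective hxy]; exact hη) (hσH x)
  have hσ₂ : σ₂.Injective := by
    intro x y hxy
    rcases hcase x with ⟨-, h1⟩ | ⟨η, hη, h0, h1⟩
    · exact h12 x y (by rw [← hxy, h1])
    rcases hcase y with ⟨-, h2⟩ | ⟨η', hη', h0', h2⟩
    · exact (h12 y x (by rw [hxy, h2])).symm
    · rw [h1, h2] at hxy
      obtain rfl := μ.injective hxy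
      exact hσ₀ (hm4 _ _ _ h0 h0')
  -- an element can take its final colour once the element that now has it has left
  have hwait : ∀ x y, σ₂ y = τ x → x ≠ y → g (σ₀ y) < g (σ₀ x) := by
    intro x y hxy hne
    rcases hcase y with ⟨h0, h2⟩ | ⟨η, hη, h0, h2⟩
    · have hx : (e⁻¹ * μ) (σ₀ y) = σ₀ x := by
        rw [Perm.mul_apply, ← h2, hxy, ← he x]; exact e.symm_apply_apply _
      have := hl5 _ hm1 (σ₀ y) (hσH y) (by rw [hx]; exact hσH x) h0
      rwa [hx] at this
    · have hx : (e⁻¹ * μ) η = σ₀ x := by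
        rw [Perm.mul_apply, ← h2, hxy, ← he x]; exact e.symm_apply_apply _
      have h3 := hl4 η hη (by rw [hx]; exact hσH x)
      rw [hx] at h3
      exact (hm2 _ _ h0).2 _ h3
  let ρ : ℕ → X → Ω := fun j x => if g (σ₀ x) ≤ j then τ x else σ₂ x
  have hρ : ∀ i j, i ≤ j → j ≤ i + 1 → ∀ x y, ρ i x = ρ j y → x = y := by
    intro i j hij hji x y hxy
    simp only [ρ] at hxy
    by_contra hne
    split_ifs at hxy with h1 h2 h2
    · exact hne (hτ hxy)
    · have := hwait x y hxy.symm hne; omega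
    · have := hwait y x hxy (Ne.symm hne); omega
    · exact hne (hσ₂ hxy)
  refine ⟨fun j => match j with
    | 0 => σ₀
    | 1 => σ₁
    | j + 2 => ρ j, rfl, ?_, ?_, ?_⟩
  · intro j hj
    obtain ⟨j, rfl⟩ := Nat.exists_eq_add_of_le hj
    rw [show t + 2 + j = (t + j) + 2 by ring]
    funext x
    have := (hm5 (σ₀ x)).2
    simp only [ρ]
    rw [if_pos (by omega)]
  · intro j
    match j with
    | 0 => exact hσ₀
    | 1 => exact hσ₁
    | j + 2 => exact hρ j j le_rfl (by omega)
  · intro j x y hxy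
    match j with
    | 0 =>
      by_cases hne : x = y
      · exact Or.inl hne
      refine Or.inr ⟨rfl, ?_⟩
      have h1 := hμ1 (σ₀ y) (fun hc => hσH y (by rw [hc]; exact hh))
      have h2 : σ₀ x = μ (σ₀ y) := hxy
      rw [← h2, hR', hR'] at h1
      exact WithBot.coe_le_coe.1 h1
    | 1 =>
      have h0 : ρ 0 y = σ₂ y := by
        have := (hm5 (σ₀ y)).1
        simp only [ρ]
        rw [if_neg (by omega)]
      exact Or.inl (h12 x y (by rw [← h0]; exact hxy))
    | j + 2 => exact Or.inl (hρ j (j + 1) (by omega) le_rfl x y hxy)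

end Sequence

/-! ### Recolouring interval graphs -/

section Extension

variable {V : Type*} {G : SimpleGraph V}

/-- The nodes that can be reached from `A` by a walk of length at most `j` within `S ∪ A`. -/
def reachWithin (G : SimpleGraph V) (S A : Set V) : ℕ → Set V
  | 0 => A
  | j + 1 => {v | v ∈ reachWithin G S A j ∨ v ∈ S ∧ ∃ u ∈ reachWithin G S A j, G.Adj u v}

lemma reachWithin_mono {S A : Set V} : Monotone (reachWithin G S A) :=
  monotone_nat_of_le_succ fun _ _ hv => Or.inl hv

lemma reachWithin_subset {S A : Set V} (hA : A ⊆ S) (j : ℕ) : reachWithin G S A j ⊆ S := by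
  induction j with
  | zero => exact hA
  | succ j ih => rintro v (hv | hv); exacts [ih hv, hv.1]

lemma exists_walk_of_mem_reachWithin {S A : Set V} {j : ℕ} {v : V}
    (hv : v ∈ reachWithin G S A j) : ∃ a ∈ A, ∃ p : G.Walk a v, p.length ≤ j := by
  induction j generalizing v with
  | zero => exact ⟨v, hv, .nil, le_rfl⟩
  | succ j ih =>
    rcases hv with hv | ⟨-, u, hu, huv⟩
    · obtain ⟨a, ha, p, hp⟩ := ih hv
      exact ⟨a, ha, p, by omega⟩
    · obtain ⟨a, ha, p, hp⟩ := ih hu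
      exact ⟨a, ha, p.append (.cons huv .nil), by simp; omega⟩

open Classical in
/-- The distance of `v` from `A` within `S`, truncated at `n`. -/
noncomputable def zone (G : SimpleGraph V) (S A : Set V) (n : ℕ) (v : V) : ℕ :=
  ((Finset.range n).filter fun j => v ∉ reachWithin G S A j).card

lemma zone_eq_zero {S A : Set V} {n : ℕ} {v : V} (hv : v ∈ A) : zone G S A n v = 0 := by
  classical
  rw [zone, Finset.card_eq_zero, Finset.filter_eq_empty_iff]
  exact fun j _ => not_not.2 (reachWithin_mono (Nat.zero_le j) hv)

lemma mem_of_zone_eq_zero {S A : Set V} {n : ℕ} {v : V} (h : zone G S A (n + 1) v = 0) :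
    v ∈ A := by
  classical
  rw [zone, Finset.card_eq_zero, Finset.filter_eq_empty_iff] at h
  exact not_not.1 (h (x := 0) (by simp))

lemma zone_eq_of_notMem {S A : Set V} {n : ℕ} {v : V} (hv : v ∉ reachWithin G S A n) :
    zone G S A (n + 1) v = n + 1 := by
  classical
  rw [zone, Finset.filter_true_of_mem, Finset.card_range]
  exact fun j hj h => hv (reachWithin_mono (by simp at hj; omega) h)

lemma zone_le_succ {S A : Set V} {n : ℕ} {u v : V} (hv : v ∈ S) (huv : G.Adj u v) :
    zone G S A n v ≤ zone G S A n u + 1 := by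
  classical
  have : ((Finset.range n).filter fun j => v ∉ reachWithin G S A j) ⊆
      insert 0 (((Finset.range n).filter fun j => u ∉ reachWithin G S A j).image Nat.succ) := by
    intro j hj
    rw [Finset.mem_filter, Finset.mem_range] at hj
    cases j with
    | zero => simp
    | succ j =>
      refine Finset.mem_insert_of_mem (Finset.mem_image_of_mem _ ?_)
      rw [Finset.mem_filter, Finset.mem_range]
      exact ⟨by omega, fun hu => hj.2 (Or.inr ⟨hv, u, hu, huv⟩)⟩
  calc _ ≤ _ := Finset.card_le_card this
    _ ≤ _ := Finset.card_insert_le _ _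
    _ ≤ _ := Nat.add_le_add_right Finset.card_image_le 1

/-- A partial assignment of distinct colours to classes extends to all classes. -/
lemma exists_injective_extension {X Ω : Type*} [Fintype X] [Fintype Ω] {A : Set V} (ψ : V → X)
    (κ : V → Ω) (hψ : A.InjOn ψ) (hκ : A.InjOn κ) (hc : Fintype.card X ≤ Fintype.card Ω) :
    ∃ σ : X → Ω, σ.Injective ∧ ∀ a ∈ A, σ (ψ a) = κ a := by
  classical
  by_cases hX : Nonempty Ω
  swap
  · have : IsEmpty Ω := not_nonempty_iff.1 hX
    have : IsEmpty X := by
      rw [← Fintype.card_eq_zero_iff]; simp at hc; simpa using hc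
    exact ⟨fun x => isEmptyElim x, fun x => isEmptyElim x, fun a => isEmptyElim (ψ a)⟩
  let f : X → Ω := fun x => if h : ∃ a ∈ A, ψ a = x then κ h.choose else Classical.arbitrary Ω
  have hf : ∀ a ∈ A, f (ψ a) = κ a := by
    intro a ha
    have h : ∃ a' ∈ A, ψ a' = ψ a := ⟨a, ha, rfl⟩
    have : h.choose = a := hψ h.choose_spec.1 ha h.choose_spec.2
    simp only [f, dif_pos h, this]
  let s : Finset X := Finset.univ.filter fun x => ∃ a ∈ A, ψ a = x
  have hs : ∀ x, x ∈ s ↔ ∃ a ∈ A, ψ a = x := fun x => by simp [s]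
  have hfs : Set.InjOn f s := by
    intro x hx y hy hxy
    obtain ⟨a, ha, rfl⟩ := (hs x).1 hx
    obtain ⟨a', ha', rfl⟩ := (hs y).1 hy
    rw [hf a ha, hf a' ha'] at hxy
    rw [hκ ha ha' hxy]
  obtain ⟨T, hT1, -, hT2⟩ := Finset.exists_subsuperset_card_eq (Finset.subset_univ (s.image f))
    (n := Fintype.card X) (Finset.card_image_le.trans (Finset.card_le_univ s)) (by simpa using hc)
  obtain ⟨g, hg⟩ := Finset.exists_equiv_extend_of_card_eq hT2.symm hT1 hfs
  refine ⟨fun x => g x, fun x y hxy => g.injective (Subtype.ext hxy), fun a ha => ?_⟩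
  rw [← hf a ha]
  exact hg _ ((hs _).2 ⟨a, ha, rfl⟩)

/-- Given colourings of a clique `A` and of a set `F` of nodes at distance at least `t + 2`
from `A`, the other nodes of `S` can be coloured compatibly, if the colour classes of some colouring
`ψ` number at most `s * t` and there are `s` colours more than that. The nodes at distance `j` from
`A` use the `j`-th of the colourings of the classes of `ψ` in a sequence from the one on `A` to
the one on the clique separating `F` from the rest. -/
theorem exists_legalOn_extension {n s t : ℕ} (hs : 1 ≤ s) (ht : 1 ≤ t) (hn : n ≤ s * t)
    (ψ : V → Fin n) {S A F : Set V} (hAS : A ⊆ S)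
    (hψ : ∀ u v, G.Adj u v → ψ u ≠ ψ v) (hA : ∀ u ∈ A, ∀ v ∈ A, u ≠ v → G.Adj u v)
    (R : V → ℤ)
    (hR : ∀ a ∈ A, ∀ a' ∈ A, R a ≤ R a' → ∀ v ∈ S, v ∉ A → G.Adj a v → G.Adj a' v)
    (hF : ∀ v ∈ F, v ∉ reachWithin G S A (t + 1))
    (hZ : ∀ z ∈ F, ∀ z' ∈ F, (∃ u ∈ S, u ∉ F ∧ G.Adj u z) → (∃ u ∈ S, u ∉ F ∧ G.Adj u z') →
      z ≠ z' → G.Adj z z')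
    {c : V → ℕ} (hcA : LegalOn G A ((n + s : ℕ) : ℝ) c) (hcF : LegalOn G F ((n + s : ℕ) : ℝ) c) :
    ∃ c' : V → ℕ, (∀ v ∈ A, c' v = c v) ∧ (∀ v ∈ F, c' v = c v) ∧ (∀ v ∉ S, c' v = c v) ∧
      LegalOn G S ((n + s : ℕ) : ℝ) c' := by
  classical
  have : NeZero (n + s) := ⟨by omega⟩
  let κ : V → Fin (n + s) := fun v => Fin.ofNat (n + s) (c v - 1)
  have hκ : ∀ T : Set V, LegalOn G T ((n + s : ℕ) : ℝ) c → ∀ v ∈ T, (κ v : ℕ) + 1 = c v := by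
    intro T hT v hv
    have h1 := (hT.1 v hv).1
    have h2 : c v ≤ n + s := by exact_mod_cast (hT.1 v hv).2
    simp only [κ, Fin.val_ofNat]
    rw [Nat.mod_eq_of_lt (by omega)]
    omega
  have hinj : ∀ T T' : Set V, T' ⊆ T → LegalOn G T ((n + s : ℕ) : ℝ) c →
      (∀ u ∈ T', ∀ v ∈ T', u ≠ v → G.Adj u v) → T'.InjOn ψ ∧ T'.InjOn κ := by
    refine fun T T' hTT hT hcl => ⟨fun u hu v hv he => ?_, fun u hu v hv he => ?_⟩
    · by_contra hne
      exact hψ u v (hcl u hu v hv hne) he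
    · by_contra hne
      refine hT.2 u (hTT hu) v (hTT hv) (hcl u hu v hv hne) ?_
      rw [← hκ T hT u (hTT hu), ← hκ T hT v (hTT hv), he]
  let Z : Set V := {z | z ∈ F ∧ ∃ u ∈ S, u ∉ F ∧ G.Adj u z}
  obtain ⟨σ₀, hσ₀, hσ₀A⟩ := exists_injective_extension ψ κ (hinj A A subset_rfl hcA hA).1
    (hinj A A subset_rfl hcA hA).2 (by simp)
  have hZi := hinj F Z (fun z hz => hz.1) hcF fun u hu v hv => hZ u hu.1 v hv.1 hu.2 hv.2
  obtain ⟨τ, hτ, hτZ⟩ := exists_injective_extension ψ κ hZi.1 hZi.2 (by simp)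
  let R' : Fin n → WithBot ℤ := fun x =>
    if h : ∃ a ∈ A, ψ a = x then (R h.choose : WithBot ℤ) else ⊥
  have hR' : ∀ a ∈ A, R' (ψ a) = R a := by
    intro a ha
    have h : ∃ a' ∈ A, ψ a' = ψ a := ⟨a, ha, rfl⟩
    have : h.choose = a := (hinj A A subset_rfl hcA hA).1 h.choose_spec.1 ha h.choose_spec.2
    simp only [R', dif_pos h, this]
  have hR'' : ∀ x, R' x ≠ ⊥ → ∃ a ∈ A, ψ a = x := by
    intro x hx
    by_contra h
    exact hx (by simp only [R', dif_neg h])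
  obtain ⟨σ, h0, hlast, hσinj, hσ⟩ := exists_recoloring_sequence s t hs ht (by simpa using hn)
    (by simp) σ₀ τ hσ₀ hτ R'
  let val : V → ℕ := fun v => σ (zone G S A (t + 1 + 1) v) (ψ v) + 1
  let c' : V → ℕ := fun v => if v ∈ F then c v else if v ∈ S then val v else c v
  have hAF : ∀ v ∈ A, v ∉ F := fun v hv hvF => hF v hvF (reachWithin_mono (Nat.zero_le _) hv)
  have hcF' : ∀ v ∈ F, c' v = c v := fun v hv => by simp [c', hv]
  have hcS : ∀ v ∈ S, v ∉ F → c' v = val v := fun v hv hv' => by simp [c', hv, hv']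
  have hcZ : ∀ v ∈ Z, c' v = val v := by
    intro v hv
    simp only [val]
    rw [hcF' v hv.1, zone_eq_of_notMem (hF v hv.1), hlast _ le_rfl, hτZ v hv, hκ F hcF v hv.1]
  have hval : ∀ u ∈ S, ∀ v ∈ S, G.Adj u v →
      zone G S A (t + 1 + 1) u ≤ zone G S A (t + 1 + 1) v → val u ≠ val v := by
    intro u hu v hv huv hle he
    have he' : σ (zone G S A (t + 1 + 1) u) (ψ u) = σ (zone G S A (t + 1 + 1) v) (ψ v) :=
      Fin.ext (Nat.succ_injective he)
    have h1 := zone_le_succ (A := A) (n := t + 1 + 1) hv huv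
    rcases hle.eq_or_lt with h2 | h2
    · rw [h2] at he'
      exact hψ u v huv (hσinj _ he')
    · have h3 : zone G S A (t + 1 + 1) v = zone G S A (t + 1 + 1) u + 1 := by omega
      rw [h3] at he'
      rcases hσ _ _ _ he' with h4 | ⟨h4, h5⟩
      · exact hψ u v huv h4
      · have huA := mem_of_zone_eq_zero h4
        have hvA : v ∉ A := fun hvA => by
          rw [zone_eq_zero hvA] at h3; omega
        rw [hR' u huA] at h5
        obtain ⟨a, ha, hav⟩ := hR'' (ψ v) (fun hb => by rw [hb] at h5; simp at h5)
        rw [← hav, hR' a ha] at h5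
        exact hψ a v (hR u huA a ha (WithBot.coe_le_coe.1 h5) v hv hvA huv) hav
  have hval' : ∀ u ∈ S, ∀ v ∈ S, G.Adj u v → val u ≠ val v := by
    intro u hu v hv huv
    rcases le_total (zone G S A (t + 1 + 1) u) (zone G S A (t + 1 + 1) v) with h | h
    · exact hval u hu v hv huv h
    · exact (hval v hv u hu huv.symm h).symm
  refine ⟨c', ?_, hcF', ?_, ?_, ?_⟩
  · intro v hv
    rw [hcS v (hAS hv) (hAF v hv)]
    simp only [val]
    rw [zone_eq_zero hv, h0, hσ₀A v hv, hκ A hcA v hv]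
  · intro v hv
    simp [c', hv]
  · intro v hv
    by_cases hvF : v ∈ F
    · rw [hcF' v hvF]; exact hcF.1 v hvF
    · rw [hcS v hv hvF]
      have : val v ≤ n + s := (σ (zone G S A (t + 1 + 1) v) (ψ v)).isLt
      exact ⟨by simp [val], by exact_mod_cast this⟩
  · intro u hu v hv huv
    by_cases huF : u ∈ F <;> by_cases hvF : v ∈ F
    · rw [hcF' u huF, hcF' v hvF]; exact hcF.2 u huF v hvF huv
    · rw [hcZ u ⟨huF, v, hv, hvF, huv.symm⟩, hcS v hv hvF]; exact hval' u hu v hv huv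
    · rw [hcS u hu huF, hcZ v ⟨hvF, u, hu, huF, huv⟩]; exact hval' u hu v hv huv
    · rw [hcS u hu huF, hcS v hv hvF]; exact hval' u hu v hv huv

lemma LegalOn.mono {S T : Set V} {b : ℝ} {c : V → ℕ} (h : LegalOn G T b c) (hST : S ⊆ T) :
    LegalOn G S b c :=
  ⟨fun v hv => h.1 v (hST hv), fun u hu v hv => h.2 u (hST hu) v (hST hv)⟩

lemma LegalOn.congr {S : Set V} {b : ℝ} {c c' : V → ℕ} (h : LegalOn G S b c)
    (hc : ∀ v ∈ S, c' v = c v) : LegalOn G S b c' :=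
  ⟨fun v hv => by rw [hc v hv]; exact h.1 v hv,
    fun u hu v hv huv => by rw [hc u hu, hc v hv]; exact h.2 u hu v hv huv⟩

/-- `G[S]` is an interval graph, node `v ∈ S` being represented by the interval `[l v, r v]`. -/
structure IsIntervalOn (G : SimpleGraph V) (S : Set V) (l r : V → ℤ) : Prop where
  le : ∀ v ∈ S, l v ≤ r v
  adj : ∀ u ∈ S, ∀ v ∈ S, u ≠ v → l u ≤ r v → l v ≤ r u → G.Adj u v
  inter : ∀ u ∈ S, ∀ v ∈ S, G.Adj u v → l u ≤ r v

lemma IsIntervalOn.neg {S : Set V} {l r : V → ℤ} (h : IsIntervalOn G S l r) :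
    IsIntervalOn G S (fun v => -r v) (fun v => -l v) where
  le v hv := neg_le_neg (h.le v hv)
  adj u hu v hv huv h1 h2 := h.adj u hu v hv huv (by linarith) (by linarith)
  inter u hu v hv huv := neg_le_neg (h.inter v hv u hu huv.symm)

lemma IsIntervalOn.mono {S T : Set V} {l r : V → ℤ} (h : IsIntervalOn G T l r) (hST : S ⊆ T) :
    IsIntervalOn G S l r where
  le v hv := h.le v (hST hv)
  adj u hu v hv := h.adj u (hST hu) v (hST hv)
  inter u hu v hv := h.inter u (hST hu) v (hST hv)

/-- The intervals of the nodes within distance `j` of `A` cover everything from the left end to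
the right end of any of them. -/
lemma IsIntervalOn.exists_cover {S A : Set V} {l r : V → ℤ} (h : IsIntervalOn G S l r)
    (hAS : A ⊆ S) (hA : ∀ a ∈ A, ∀ v ∈ S, l a ≤ l v) {j : ℕ} {u : V}
    (hu : u ∈ reachWithin G S A j) {v : V} (hv : v ∈ S) (hvu : l v ≤ r u) :
    ∃ w ∈ reachWithin G S A j, l w ≤ l v ∧ l v ≤ r w := by
  induction j generalizing u with
  | zero => exact ⟨u, hu, hA u hu v hv, hvu⟩
  | succ j ih =>
    by_cases hle : l u ≤ l v
    · exact ⟨u, hu, hle, hvu⟩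
    rcases hu with hu | ⟨huS, u', hu', huu⟩
    · obtain ⟨w, hw, h1⟩ := ih hu hvu
      exact ⟨w, Or.inl hw, h1⟩
    · have := h.inter u huS u' (reachWithin_subset hAS j hu') huu.symm
      obtain ⟨w, hw, h1⟩ := ih hu' (by omega)
      exact ⟨w, Or.inl hw, h1⟩

/-- In an interval graph, let the leftmost nodes `A` and the other nodes be legally coloured. Then
the colours of nodes at distance at most `t + 2` from `A` can be changed so that the whole colouring
becomes legal, without changing the colours of `A` and of the rightmost nodes `B`, if the latter
have distance at least `t + 2` from `A`. -/
theorem IsIntervalOn.exists_recoloring_left [Finite V] {n s t : ℕ} (hs : 1 ≤ s) (ht : 1 ≤ t)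
    (hn : n ≤ s * t) (ψ : V → Fin n) (hψ : ∀ u v, G.Adj u v → ψ u ≠ ψ v) {S A B : Set V}
    {l r : V → ℤ} (h : IsIntervalOn G S l r) (hAS : A ⊆ S) (hBS : B ⊆ S)
    (hA : ∀ a ∈ A, ∀ v ∈ S, l a ≤ l v) (hB : ∀ b ∈ B, ∀ v ∈ S, r v ≤ r b)
    (hAB : ∀ b ∈ B, b ∉ reachWithin G S A (t + 1))
    {c : V → ℕ} (hcA : LegalOn G A ((n + s : ℕ) : ℝ) c)
    (hcS : LegalOn G (S \ A) ((n + s : ℕ) : ℝ) c) :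
    ∃ c' : V → ℕ, LegalOn G S ((n + s : ℕ) : ℝ) c' ∧
      ∀ v, c' v ≠ c v → v ∈ S ∧ v ∉ A ∧ v ∉ B ∧ v ∈ reachWithin G S A (t + 2) := by
  rcases A.eq_empty_or_nonempty with rfl | hAne
  · exact ⟨c, by simpa using hcS, fun v hv => absurd rfl hv⟩
  have hsub : reachWithin G S A (t + 1) ⊆ S := reachWithin_subset hAS _
  have hA0 : A ⊆ reachWithin G S A (t + 1) := reachWithin_mono (Nat.zero_le (t + 1))
  obtain ⟨u₀, hu₀, hmax⟩ := (Set.toFinite (reachWithin G S A (t + 1))).exists_maximalFor r _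
    (hAne.mono hA0)
  replace hmax : ∀ v ∈ reachWithin G S A (t + 1), r v ≤ r u₀ := fun v hv => by
    by_contra hc
    exact hc (hmax hv (le_of_not_ge hc))
  have hAcl : ∀ u ∈ A, ∀ v ∈ A, u ≠ v → G.Adj u v := fun u hu v hv huv =>
    h.adj u (hAS hu) v (hAS hv) huv ((hA u hu v (hAS hv)).trans (h.le v (hAS hv)))
      ((hA v hv u (hAS hu)).trans (h.le u (hAS hu)))
  have hR : ∀ a ∈ A, ∀ a' ∈ A, r a ≤ r a' → ∀ v ∈ S, v ∉ A → G.Adj a v → G.Adj a' v := by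
    intro a ha a' ha' haa v hv hvA hav
    refine h.adj a' (hAS ha') v hv (fun hc => hvA (hc ▸ ha'))
      ((hA a' ha' v hv).trans (h.le v hv)) ?_
    exact (h.inter v hv a (hAS ha) hav.symm).trans haa
  have hnear : ∀ v ∈ S, r v ≤ r u₀ → v ∈ reachWithin G S A (t + 2) := by
    intro v hv hvu
    obtain ⟨w, hw, h1, h2⟩ := h.exists_cover hAS hA hu₀ hv ((h.le v hv).trans hvu)
    by_cases hwv : w = v
    · exact Or.inl (hwv ▸ hw)
    · exact Or.inr ⟨hv, w, hw, h.adj w (hsub hw) v hv hwv (h1.trans (h.le v hv)) h2⟩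
  -- `u₀` reaches furthest to the right among the nodes near `A`. The set `F` of the nodes that keep
  -- their colours consists of those reaching further, or of `B`, if `B` is not among them.
  obtain ⟨F, hFS, hBF, hFR, hFc, hZ⟩ : ∃ F ⊆ S, B ⊆ F ∧
      (∀ v ∈ F, v ∉ reachWithin G S A (t + 1)) ∧ (∀ v ∈ S, v ∉ F → r v ≤ r u₀) ∧
      ∀ z ∈ F, ∀ z' ∈ F, (∃ u ∈ S, u ∉ F ∧ G.Adj u z) → (∃ u ∈ S, u ∉ F ∧ G.Adj u z') →
        z ≠ z' → G.Adj z z' := by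
    by_cases hcase : ∀ b ∈ B, r u₀ < r b
    · refine ⟨{v | v ∈ S ∧ r u₀ < r v}, fun v hv => hv.1, fun b hb => ⟨hBS hb, hcase b hb⟩,
        fun v hv hv' => absurd (hmax v hv') (not_le.2 hv.2),
        fun v hv hv' => not_lt.1 fun hc => hv' ⟨hv, hc⟩, ?_⟩
      rintro z hz z' hz' ⟨u, hu, huF, huz⟩ ⟨u', hu', huF', huz'⟩ hne
      have h1 := h.inter z hz.1 u hu huz.symm
      have h2 := h.inter z' hz'.1 u' hu' huz'.symm
      have h3 : r u ≤ r u₀ := not_lt.1 fun hc => huF ⟨hu, hc⟩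
      have h4 : r u' ≤ r u₀ := not_lt.1 fun hc => huF' ⟨hu', hc⟩
      have h5 := hz.2
      have h6 := hz'.2
      exact h.adj z hz.1 z' hz'.1 hne (by omega) (by omega)
    · push Not at hcase
      obtain ⟨b, hb, hbu⟩ := hcase
      refine ⟨B, hBS, subset_rfl, hAB, fun v hv _ => (hB b hb v hv).trans hbu, ?_⟩
      intro z hz z' hz' _ _ hne
      exact h.adj z (hBS hz) z' (hBS hz') hne ((h.le z (hBS hz)).trans (hB z' hz' z (hBS hz)))
        ((h.le z' (hBS hz')).trans (hB z hz z' (hBS hz')))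
  have hFA : F ⊆ S \ A := fun v hv => ⟨hFS hv, fun hvA => hFR v hv (hA0 hvA)⟩
  obtain ⟨c', h1, h2, h3, h4⟩ := exists_legalOn_extension hs ht hn ψ hAS hψ hAcl r hR hFR hZ hcA
    (hcS.mono hFA)
  refine ⟨c', h4, fun v hv => ?_⟩
  have hvS : v ∈ S := by by_contra hc; exact hv (h3 v hc)
  exact ⟨hvS, fun hc => hv (h1 v hc), fun hc => hv (h2 v (hBF hc)),
    hnear v hvS (hFc v hvS fun hc => hv (h2 v hc))⟩

/-- In an interval graph, let the leftmost nodes `A`, the rightmost nodes `B` and the other nodes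
be legally coloured. Then the colours of nodes outside `A ∪ B` at distance at most `t + 2` from
`A ∪ B` can be changed so that the whole colouring becomes legal, if the distance between `A` and
`B` is at least `t + 2`. -/
theorem IsIntervalOn.exists_recoloring [Finite V] {n s t : ℕ} (hs : 1 ≤ s) (ht : 1 ≤ t)
    (hn : n ≤ s * t) (ψ : V → Fin n) (hψ : ∀ u v, G.Adj u v → ψ u ≠ ψ v) {S A B : Set V}
    {l r : V → ℤ} (h : IsIntervalOn G S l r) (hAS : A ⊆ S) (hBS : B ⊆ S)
    (hA : ∀ a ∈ A, ∀ v ∈ S, l a ≤ l v) (hB : ∀ b ∈ B, ∀ v ∈ S, r v ≤ r b)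
    (hAB : ∀ b ∈ B, b ∉ reachWithin G S A (t + 1))
    {c : V → ℕ} (hcA : LegalOn G A ((n + s : ℕ) : ℝ) c) (hcB : LegalOn G B ((n + s : ℕ) : ℝ) c)
    (hcS : LegalOn G (S \ (A ∪ B)) ((n + s : ℕ) : ℝ) c) :
    ∃ c' : V → ℕ, LegalOn G S ((n + s : ℕ) : ℝ) c' ∧
      ∀ v, c' v ≠ c v → v ∈ S ∧ v ∉ A ∧ v ∉ B ∧
        ∃ u ∈ A ∪ B, ∃ p : G.Walk u v, p.length ≤ t + 2 := by
  have hdis : ∀ v ∈ A, v ∉ B := fun v hv hvB =>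
    hAB v hvB (reachWithin_mono (Nat.zero_le (t + 1)) hv)
  -- first treat the right end, ignoring the nodes of `A`
  obtain ⟨d, hd1, hd2⟩ := (h.mono (Set.sdiff_subset (t := A))).neg.exists_recoloring_left hs ht hn ψ
    hψ (A := B) (B := ∅) (fun v hv => ⟨hBS hv, fun hc => hdis v hc hv⟩) (Set.empty_subset _)
    (fun b hb v hv => neg_le_neg (hB b hb v hv.1)) (by simp) (by simp) hcB
    (by rwa [Set.sdiff_sdiff])
  obtain ⟨c', hc1, hc2⟩ := h.exists_recoloring_left hs ht hn ψ hψ hAS hBS hA hB hAB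
    (c := d) (hcA.congr fun v hv => by by_contra hc; exact (hd2 v hc).1.2 hv) hd1
  refine ⟨c', hc1, fun v hv => ?_⟩
  by_cases hdv : d v = c v
  · rw [← hdv] at hv
    obtain ⟨h1, h2, h3, h4⟩ := hc2 v hv
    obtain ⟨a, ha, p, hp⟩ := exists_walk_of_mem_reachWithin h4
    exact ⟨h1, h2, h3, a, Or.inl ha, p, hp⟩
  · obtain ⟨h1, h2, -, h4⟩ := hd2 v hdv
    obtain ⟨a, ha, p, hp⟩ := exists_walk_of_mem_reachWithin h4
    exact ⟨h1.1, h1.2, h2, a, Or.inr ha, p, hp⟩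

end Extension

/-! ### Connected vertex sets -/

section ConnIn

variable {N : Type*} {T : SimpleGraph N}

/-- Any two elements of `K` are joined by a walk within `K`. The empty set has this property. -/
def ConnIn (T : SimpleGraph N) (K : Set N) : Prop :=
  ∀ C ∈ K, ∀ D ∈ K, ∃ p : T.Walk C D, ∀ E ∈ p.support, E ∈ K

lemma ConnIn.singleton (C : N) : ConnIn T {C} := by
  rintro _ rfl _ rfl
  exact ⟨.nil, by simp⟩

lemma ConnIn.mono {T' : SimpleGraph N} (hT : T ≤ T') {K : Set N} (h : ConnIn T K) :
    ConnIn T' K := by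
  intro C hC D hD
  obtain ⟨p, hp⟩ := h C hC D hD
  exact ⟨p.mapLe hT, by simpa using hp⟩

lemma ConnIn.insert {K : Set N} (h : ConnIn T K) {C D : N} (hD : D ∈ K) (hCD : T.Adj C D) :
    ConnIn T (insert C K) := by
  have key : ∀ E ∈ K, ∃ p : T.Walk C E, ∀ F ∈ p.support, F ∈ Insert.insert C K := by
    intro E hE
    obtain ⟨p, hp⟩ := h D hD E hE
    refine ⟨.cons hCD p, fun F hF => ?_⟩
    rw [SimpleGraph.Walk.support_cons, List.mem_cons] at hF
    exact hF.imp id (hp F)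
  rintro E (rfl | hE) F (rfl | hF)
  · exact ⟨.nil, by simp⟩
  · exact key F hF
  · obtain ⟨p, hp⟩ := key E hE
    exact ⟨p.reverse, by simpa using hp⟩
  · obtain ⟨p, hp⟩ := h E hE F hF
    exact ⟨p, fun G hG => Or.inr (hp G hG)⟩

lemma ConnIn.comap_equiv {N' : Type*} (e : N' ≃ N) {K : Set N} (h : ConnIn T K) :
    ConnIn (T.comap e) (e ⁻¹' K) := by
  intro C hC D hD
  obtain ⟨p, hp⟩ := h _ hC _ hD
  let f : T →g T.comap e := ⟨e.symm, fun {a b} hab => by simpa using hab⟩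
  refine ⟨(p.map f).copy (e.symm_apply_apply C) (e.symm_apply_apply D), fun E hE => ?_⟩
  rw [SimpleGraph.Walk.support_copy, SimpleGraph.Walk.support_map, List.mem_map] at hE
  obtain ⟨F, hF, rfl⟩ := hE
  simpa [f] using hp F hF

end ConnIn

/-! ### Chordal graphs have clique forests -/

section Chordal

variable {V : Type*} {G : SimpleGraph V}

/-- A shortest walk has no shortcuts. -/
lemma mem_edges_of_length_eq_dist {x y : V} (q : G.Walk x y) (hq : q.length = G.dist x y)
    {a b : V} (ha : a ∈ q.support) (hb : b ∈ q.support) (hab : G.Adj a b) :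
    s(a, b) ∈ q.edges := by
  obtain ⟨i, rfl, hi⟩ := SimpleGraph.Walk.mem_support_iff_exists_getVert.1 ha
  obtain ⟨j, rfl, hj⟩ := SimpleGraph.Walk.mem_support_iff_exists_getVert.1 hb
  have key : ∀ i j, i < j → j ≤ q.length → G.Adj (q.getVert i) (q.getVert j) →
      s(q.getVert i, q.getVert j) ∈ q.edges := by
    intro i j hij hj hadj
    have h1 := SimpleGraph.dist_le ((q.take i).append (.cons hadj (q.drop j)))
    simp only [SimpleGraph.Walk.length_append, SimpleGraph.Walk.length_cons,
      SimpleGraph.Walk.take_length, SimpleGraph.Walk.drop_length] at h1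
    have h2 : j = i + 1 := by omega
    subst h2
    have h3 : i < q.darts.length := by simpa using hj
    have h4 := List.getElem_mem h3
    rw [SimpleGraph.Walk.darts_getElem_eq_getVert] at h4
    exact List.mem_map.2 ⟨_, h4, rfl⟩
  rcases lt_trichotomy i j with h | h | h
  · exact key i j h hj hab
  · subst h; exact absurd rfl hab.ne
  · rw [Sym2.eq_swap]; exact key j i h hi hab.symm

/-- Two nodes with a common neighbour `r` that can be joined by a walk outside the neighbourhood of
`r` are adjacent, as a shortest such walk would otherwise close to a cycle without chords. -/
lemma IsChordal.adj_of_connIn (hG : IsChordal G) {K : Set V} (hK : ConnIn G K) {x y r : V}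
    (hxK : ∃ a ∈ K, G.Adj x a) (hyK : ∃ a ∈ K, G.Adj y a) (hrK : ∀ a ∈ K, ¬ G.Adj a r)
    (hr : r ∉ K) (hxr : G.Adj x r) (hyr : G.Adj y r) (hxy : x ≠ y) : G.Adj x y := by
  by_contra hnadj
  let M : Set V := insert x (insert y K)
  let H : SimpleGraph V :=
    { Adj := fun a b => G.Adj a b ∧ a ∈ M ∧ b ∈ M
      symm := ⟨fun a b h => ⟨h.1.symm, h.2.2, h.2.1⟩⟩
      loopless := ⟨fun a h => h.1.ne rfl⟩ }
  have hHG : H ≤ G := fun a b h => h.1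
  have hsupp : ∀ {a b : V} (p : H.Walk a b), a ∈ M → ∀ c ∈ p.support, c ∈ M := by
    intro a b p ha
    induction p with
    | nil => intro c hc; simp at hc; rwa [hc]
    | cons h p ih =>
      intro c hc
      rw [SimpleGraph.Walk.support_cons, List.mem_cons] at hc
      rcases hc with rfl | hc
      · exact ha
      · exact ih h.2.2 c hc
  have hreach : ∀ {a b : V} (p : G.Walk a b), (∀ c ∈ p.support, c ∈ M) → H.Reachable a b := by
    intro a b p hp
    induction p with
    | nil => exact .refl _
    | @cons u v w h p ih =>
      have hadj : H.Adj u v := ⟨h, hp _ (by simp), hp _ (by simp)⟩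
      exact hadj.reachable.trans (ih fun c hc => hp c (by simp [hc]))
  obtain ⟨a, ha, hxa⟩ := hxK
  obtain ⟨b, hb, hyb⟩ := hyK
  have hKM : ∀ c ∈ K, c ∈ M := fun c hc => Or.inr (Or.inr hc)
  have hxy' : H.Reachable x y := by
    obtain ⟨p, hp⟩ := hK a ha b hb
    have h1 : H.Adj x a := ⟨hxa, Or.inl rfl, hKM a ha⟩
    have h2 : H.Adj b y := ⟨hyb.symm, hKM b hb, Or.inr (Or.inl rfl)⟩
    exact h1.reachable.trans ((hreach p fun c hc => hKM c (hp c hc)).trans h2.reachable)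
  obtain ⟨q, hq⟩ := hxy'.exists_walk_length_eq_dist
  have hqp := q.isPath_of_length_eq_dist hq
  have hqM := hsupp q (Or.inl rfl)
  have hlen : 2 ≤ q.length := by
    by_contra hlt
    rcases (by omega : q.length = 0 ∨ q.length = 1) with h | h
    · exact hxy (SimpleGraph.Walk.eq_of_length_eq_zero h)
    · exact hnadj (SimpleGraph.Walk.adj_of_length_eq_one h).1
  have hrM : r ∉ M := by
    rintro (h | h | h)
    · exact hxr.ne h.symm
    · exact hyr.ne h.symm
    · exact hr h
  let q' := q.mapLe hHG
  have hsq : q'.support = q.support := by simp [q']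
  have heq : q'.edges = q.edges := by simp [q']
  have hrq : r ∉ q'.support := by rw [hsq]; exact fun h => hrM (hqM r h)
  have hcyc : (SimpleGraph.Walk.cons hxr.symm (q'.concat hyr)).IsCycle := by
    rw [SimpleGraph.Walk.cons_isCycle_iff, SimpleGraph.Walk.concat_isPath_iff]
    refine ⟨⟨?_, hrq⟩, ?_⟩
    · rw [SimpleGraph.Walk.isPath_def, hsq]; exact hqp.support_nodup
    · rw [SimpleGraph.Walk.edges_concat, List.concat_eq_append, List.mem_append, not_or]
      constructor
      · exact fun h => hrq (SimpleGraph.Walk.fst_mem_support_of_mem_edges _ h)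
      · simp only [List.mem_singleton, Sym2.eq_iff]
        rintro (⟨h, -⟩ | ⟨-, h⟩)
        · exact hyr.ne h.symm
        · exact hxy h
  obtain ⟨u, hu, w, hw, huw, hne⟩ := hG r _ hcyc (by
    simp only [SimpleGraph.Walk.length_cons, SimpleGraph.Walk.length_concat, q',
      SimpleGraph.Walk.length_map]
    omega)
  have hsup : ∀ c ∈ (SimpleGraph.Walk.cons hxr.symm (q'.concat hyr)).support,
      c = r ∨ c ∈ q.support := by
    intro c hc
    rw [SimpleGraph.Walk.support_cons, SimpleGraph.Walk.support_concat, List.mem_cons,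
      List.mem_append, hsq] at hc
    simp at hc
    tauto
  rw [SimpleGraph.Walk.edges_cons, SimpleGraph.Walk.edges_concat, List.concat_eq_append,
    List.mem_cons, List.mem_append, List.mem_singleton, heq] at hne
  push Not at hne
  -- the neighbours of `r` on the cycle are `x` and `y`
  have hrn : ∀ c ∈ q.support, G.Adj r c → c = x ∨ c = y := by
    intro c hc hrc
    rcases hqM c hc with h | h | h
    · exact Or.inl h
    · exact Or.inr h
    · exact absurd hrc.symm (hrK c h)
  rcases hsup u hu with rfl | hu' <;> rcases hsup w hw with rfl | hw'
  · exact huw.ne rfl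
  · rcases hrn w hw' huw with rfl | rfl
    · exact hne.1 rfl
    · exact hne.2.2 Sym2.eq_swap
  · rcases hrn u hu' huw.symm with rfl | rfl
    · exact hne.1 Sym2.eq_swap
    · exact hne.2.2 rfl
  · exact hne.2.1 (mem_edges_of_length_eq_dist q hq hu' hw' ⟨huw, hqM u hu', hqM w hw'⟩)

/-- Every nonempty set of nodes of a chordal graph contains a node whose neighbours in the set form
a clique. If the set is not a clique, let `K` be a maximal connected subset without a node adjacent
to all of the rest. The nodes neither in `K` nor adjacent to it are adjacent to all neighbours of
`K`, and these form a clique; so a simplicial node of this rest is also simplicial in the set. -/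
lemma IsChordal.exists_simplicial [Finite V] (hG : IsChordal G) :
    ∀ S : Set V, S.Nonempty → ∃ v ∈ S, G.IsClique {u | u ∈ S ∧ G.Adj v u} := by
  intro S
  induction hn : S.ncard using Nat.strong_induction_on generalizing S with
  | _ n ih =>
  subst hn
  intro hS
  by_cases hcl : G.IsClique S
  · obtain ⟨v, hv⟩ := hS
    exact ⟨v, hv, hcl.subset fun u hu => hu.1⟩
  obtain ⟨u, hu, w, hw, huw, hnadj⟩ : ∃ u ∈ S, ∃ w ∈ S, u ≠ w ∧ ¬ G.Adj u w := by
    by_contra! hc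
    exact hcl fun u hu w hw huw => hc u hu w hw huw
  obtain ⟨K, -, ⟨hKS, hKne, hKc, r₀, hr₀S, hr₀K, hr₀⟩, hKmax⟩ := Finite.exists_le_maximal
    (p := fun K : Set V => K ⊆ S ∧ K.Nonempty ∧ ConnIn G K ∧
      ∃ r ∈ S, r ∉ K ∧ ∀ a ∈ K, ¬ G.Adj a r)
    (a := {u}) ⟨by simpa using hu, by simp, ConnIn.singleton u, w, hw, by simpa using huw.symm,
      by simpa using hnadj⟩
  let R : Set V := {r | r ∈ S ∧ r ∉ K ∧ ∀ a ∈ K, ¬ G.Adj a r}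
  have hRlt : R.ncard < S.ncard := by
    refine Set.ncard_lt_ncard ⟨fun r hr => hr.1, fun hSR => ?_⟩ (Set.toFinite _)
    obtain ⟨a, ha⟩ := hKne
    exact (hSR (hKS ha)).2.1 ha
  obtain ⟨v, hvR, hv⟩ := ih _ hRlt R rfl ⟨r₀, hr₀S, hr₀K, hr₀⟩
  have hcomplete : ∀ x ∈ S, x ∉ K → (∃ a ∈ K, G.Adj x a) → ∀ r ∈ R, G.Adj x r := by
    rintro x hxS hxK ⟨a, ha, hxa⟩ r ⟨hrS, hrK, hr⟩
    by_contra hxr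
    have hxr' : r ≠ x := by rintro rfl; exact hr a ha hxa.symm
    have := hKmax (y := insert x K) ⟨Set.insert_subset hxS hKS, Set.insert_nonempty _ _,
      hKc.insert ha hxa, r, hrS, by simp [hxr', hrK], by
        rintro b (rfl | hb)
        · exact hxr
        · exact hr b hb⟩ (Set.subset_insert _ _)
    exact hxK (this (Set.mem_insert _ _))
  have hsplit : ∀ x ∈ S, G.Adj v x → x ∈ R ∨ x ∉ K ∧ ∃ a ∈ K, G.Adj x a := by
    intro x hx hvx
    have hxK : x ∉ K := fun hxK => hvR.2.2 x hxK hvx.symm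
    by_cases h : ∃ a ∈ K, G.Adj x a
    · exact Or.inr ⟨hxK, h⟩
    · push Not at h
      exact Or.inl ⟨hx, hxK, fun a ha hc => h a ha hc.symm⟩
  refine ⟨v, hvR.1, ?_⟩
  rintro x ⟨hx, hvx⟩ y ⟨hy, hvy⟩ hxy
  rcases hsplit x hx hvx with hxR | ⟨hxK, hxa⟩ <;> rcases hsplit y hy hvy with hyR | ⟨hyK, hya⟩
  · exact hv ⟨hxR, hvx⟩ ⟨hyR, hvy⟩ hxy
  · exact (hcomplete y hy hyK hya x hxR).symm
  · exact hcomplete x hx hxK hxa y hyR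
  · exact hG.adj_of_connIn hKc hxa hya hvR.2.2 hvR.2.1 hvx.symm hvy.symm hxy

/-- The maximal cliques of `G[S]`. -/
def maxCliques (G : SimpleGraph V) (S : Set V) : Set (Set V) :=
  {C | Maximal (fun A => A ⊆ S ∧ G.IsClique A) C}

/-- Adding a simplicial node `v` with neighbourhood `N` replaces the maximal clique `N`, if it is
one, by `N ∪ {v}`. -/
lemma maxCliques_insert {S : Set V} {v : V} (hv : v ∉ S)
    (hcl : G.IsClique {u | u ∈ S ∧ G.Adj v u}) :
    maxCliques G (insert v S) = insert (insert v {u | u ∈ S ∧ G.Adj v u})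
      (maxCliques G S \ {{u | u ∈ S ∧ G.Adj v u}}) := by
  set N := {u | u ∈ S ∧ G.Adj v u} with hN
  have hNS : N ⊆ S := fun u hu => hu.1
  have hle : ∀ A, A ⊆ insert v S → G.IsClique A → v ∈ A → A ⊆ insert v N := by
    intro A hAS hA hvA a ha
    by_cases hav : a = v
    · exact Or.inl hav
    · exact Or.inr ⟨(hAS ha).resolve_left hav, hA hvA ha (Ne.symm hav)⟩
  have h0 : insert v N ⊆ insert v S ∧ G.IsClique (insert v N) :=
    ⟨Set.insert_subset_insert hNS, hcl.insert fun b hb _ => hb.2⟩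
  ext C
  constructor
  · intro hC
    by_cases hvC : v ∈ C
    · left
      have h1 := hle C hC.1.1 hC.1.2 hvC
      exact h1.antisymm (hC.2 h0 h1)
    · right
      have hCS : C ⊆ S := fun a ha =>
        (hC.1.1 ha).resolve_left fun hc => hvC (hc ▸ ha)
      refine ⟨⟨⟨hCS, hC.1.2⟩, fun A hA hCA =>
        hC.2 ⟨hA.1.trans (Set.subset_insert _ _), hA.2⟩ hCA⟩, ?_⟩
      rintro rfl
      exact hvC (hC.2 h0 (Set.subset_insert _ _) (Set.mem_insert _ _))
  · rintro (rfl | ⟨hC, hCN⟩)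
    · exact ⟨h0, fun A hA hCA => hle A hA.1 hA.2 (hCA (Set.mem_insert _ _))⟩
    · refine ⟨⟨hC.1.1.trans (Set.subset_insert _ _), hC.1.2⟩, fun A hA hCA => ?_⟩
      by_cases hvA : v ∈ A
      · exfalso
        have h1 : C ⊆ N := fun a ha => (hle A hA.1 hA.2 hvA (hCA ha)).resolve_left fun hc =>
          hv (hC.1.1 (hc ▸ ha))
        exact hCN (h1.antisymm (hC.2 ⟨hNS, hcl⟩ h1))
      · exact hC.2 ⟨fun a ha => (hA.1 ha).resolve_left fun hc => hvA (hc ▸ ha), hA.2⟩ hCA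

/-- Construction of a clique forest of `G[S]`, as a graph on all sets of nodes, by successively
adding simplicial nodes. The number of maximal cliques grows by at most one in each step. -/
lemma IsChordal.exists_forest [Finite V] (hG : IsChordal G) :
    ∀ S : Set V, (∃ T : SimpleGraph (Set V), T.IsAcyclic ∧
      (∀ A B, T.Adj A B → A ∈ maxCliques G S ∧ B ∈ maxCliques G S ∧ (A ∩ B).Nonempty) ∧
      ∀ v ∈ S, ConnIn T {C | C ∈ maxCliques G S ∧ v ∈ C}) ∧
      (maxCliques G S).ncard ≤ S.ncard + 1 := by
  classical
  intro S
  induction hn : S.ncard generalizing S with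
  | zero =>
    have hS : S = ∅ := (Set.ncard_eq_zero (Set.toFinite S)).1 hn
    subst hS
    refine ⟨⟨⊥, ?_, by simp, by simp⟩, ?_⟩
    · intro v p hp
      cases p with
      | nil => exact hp.not_nil .nil
      | cons h => exact absurd h (by simp)
    · refine (Set.ncard_le_ncard (t := {∅}) ?_ (Set.toFinite _)).trans (by simp)
      intro C hC
      simpa using hC.1.1
  | succ n ih =>
  have hS : S.Nonempty := by
    rw [Set.nonempty_iff_ne_empty]; rintro rfl; simp at hn
  obtain ⟨v, hvS, hcl⟩ := hG.exists_simplicial S hS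
  obtain ⟨S', hv, rfl⟩ : ∃ S', v ∉ S' ∧ insert v S' = S :=
    ⟨S \ {v}, by simp, by simp [Set.insert_eq_of_mem hvS]⟩
  have hn' : S'.ncard = n := by
    rw [Set.ncard_insert_of_notMem hv (Set.toFinite _)] at hn; omega
  have hNeq : {u | u ∈ insert v S' ∧ G.Adj v u} = {u | u ∈ S' ∧ G.Adj v u} := by
    ext u
    constructor
    · rintro ⟨h1, h2⟩; exact ⟨h1.resolve_left h2.ne', h2⟩
    · rintro ⟨h1, h2⟩; exact ⟨Or.inr h1, h2⟩
  rw [hNeq] at hcl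
  have hMC := maxCliques_insert hv hcl
  set N := {u | u ∈ S' ∧ G.Adj v u} with hN
  obtain ⟨⟨T, hT1, hT2, hT3⟩, hcard⟩ := ih S' hn'
  have hvM : ∀ C ∈ maxCliques G S', v ∉ C := fun C hC hvC => hv (hC.1.1 hvC)
  have hC0 : insert v N ∉ maxCliques G S' := fun h => hvM _ h (Set.mem_insert _ _)
  constructor
  swap
  · rw [hMC]
    have h1 := Set.ncard_insert_le (insert v N) (maxCliques G S' \ {N})
    have h2 : (maxCliques G S' \ {N}).ncard ≤ (maxCliques G S').ncard :=
      Set.ncard_le_ncard Set.sdiff_subset (Set.toFinite _)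
    omega
  have hvconn : ∀ T' : SimpleGraph (Set V),
      ConnIn T' {C | C ∈ maxCliques G (insert v S') ∧ v ∈ C} := by
    intro T'
    have : {C | C ∈ maxCliques G (insert v S') ∧ v ∈ C} = {insert v N} := by
      ext C
      rw [hMC]
      constructor
      · rintro ⟨h1 | h1, h2⟩
        · exact h1
        · exact absurd h2 (hvM C h1.1)
      · rintro rfl
        exact ⟨Or.inl rfl, Set.mem_insert _ _⟩
    rw [this]
    exact ConnIn.singleton _
  by_cases hNM : N ∈ maxCliques G S'
  · -- rename `N` to `N ∪ {v}`
    let e : Equiv.Perm (Set V) := Equiv.swap N (insert v N)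
    have heN : e N = insert v N := Equiv.swap_apply_left _ _
    have heC : e (insert v N) = N := Equiv.swap_apply_right _ _
    have heo : ∀ C, C ≠ N → C ≠ insert v N → e C = C := fun C => Equiv.swap_apply_of_ne_of_ne
    have hmem : ∀ C, C ∈ maxCliques G (insert v S') ↔ e C ∈ maxCliques G S' := by
      intro C
      rw [hMC]
      by_cases h1 : C = N
      · subst h1
        rw [heN]
        refine ⟨fun h => ?_, fun h => absurd h hC0⟩
        rcases h with h | h
        · rwa [← h]
        · exact absurd rfl h.2
      by_cases h2 : C = insert v N
      · subst h2
        rw [heC]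
        exact ⟨fun _ => hNM, fun _ => Or.inl rfl⟩
      rw [heo C h1 h2]
      exact ⟨fun h => (h.resolve_left h2).1, fun h => Or.inr ⟨h, h1⟩⟩
    have hue : ∀ u, u ≠ v → ∀ C, u ∈ e C ↔ u ∈ C := by
      intro u hu C
      by_cases h1 : C = N
      · subst h1; rw [heN]; simp [hu]
      by_cases h2 : C = insert v N
      · subst h2; rw [heC]; simp [hu]
      rw [heo C h1 h2]
    refine ⟨T.comap e, hT1.of_comap e.toEmbedding, ?_, ?_⟩
    · intro A B hAB
      obtain ⟨h1, h2, u, hu1, hu2⟩ := hT2 _ _ hAB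
      have huv : u ≠ v := by rintro rfl; exact hvM _ h1 hu1
      exact ⟨(hmem A).2 h1, (hmem B).2 h2, u, (hue u huv A).1 hu1, (hue u huv B).1 hu2⟩
    · rintro u (rfl | hu)
      · exact hvconn _
      have huv : u ≠ v := by rintro rfl; exact hv hu
      have : {C | C ∈ maxCliques G (insert v S') ∧ u ∈ C} =
          e ⁻¹' {C | C ∈ maxCliques G S' ∧ u ∈ C} := by
        ext C
        simp only [Set.mem_ofPred_eq, Set.mem_preimage]
        rw [hmem C, hue u huv C]
      rw [this]
      exact (hT3 u hu).comap_equiv e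
  · have hMC' : maxCliques G (insert v S') = insert (insert v N) (maxCliques G S') := by
      rw [hMC, Set.sdiff_singleton_eq_self hNM]
    rcases N.eq_empty_or_nonempty with hNe | hNne
    · -- `v` is isolated
      refine ⟨T, hT1, fun A B hAB => ?_, ?_⟩
      · obtain ⟨h1, h2, h3⟩ := hT2 A B hAB
        rw [hMC']
        exact ⟨Or.inr h1, Or.inr h2, h3⟩
      · rintro u (rfl | hu)
        · exact hvconn _
        have : {C | C ∈ maxCliques G (insert v S') ∧ u ∈ C} =
            {C | C ∈ maxCliques G S' ∧ u ∈ C} := by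
          ext C
          rw [hMC']
          constructor
          · rintro ⟨rfl | h1, h2⟩
            · rw [hNe] at h2
              simp at h2
              exact absurd (h2 ▸ hu) hv
            · exact ⟨h1, h2⟩
          · rintro ⟨h1, h2⟩
            exact ⟨Or.inr h1, h2⟩
        rw [this]
        exact hT3 u hu
    · -- attach `N ∪ {v}` to a maximal clique containing `N`
      obtain ⟨K, hNK, hK⟩ := Finite.exists_le_maximal
        (p := fun A => A ⊆ S' ∧ G.IsClique A) (a := N) ⟨fun u hu => hu.1, hcl⟩
      have hKM : K ∈ maxCliques G S' := hK
      have hneK : insert v N ≠ K := fun h => hC0 (h ▸ hKM)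
      have hnr : ¬ T.Reachable (insert v N) K := by
        rintro ⟨p⟩
        cases p with
        | nil => exact hC0 hKM
        | cons h => exact hC0 (hT2 _ _ h).1
      have hadj : (T ⊔ SimpleGraph.edge (insert v N) K).Adj (insert v N) K := by
        rw [SimpleGraph.sup_adj, SimpleGraph.edge_adj]
        exact Or.inr ⟨Or.inl ⟨rfl, rfl⟩, hneK⟩
      refine ⟨T ⊔ SimpleGraph.edge (insert v N) K,
        (SimpleGraph.isAcyclic_add_edge_iff_of_not_reachable _ _ hnr).2 hT1, ?_, ?_⟩
      · have hint : (insert v N ∩ K).Nonempty := by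
          obtain ⟨u, hu⟩ := hNne
          exact ⟨u, Or.inr hu, hNK hu⟩
        intro A B hAB
        rw [hMC']
        rw [SimpleGraph.sup_adj, SimpleGraph.edge_adj] at hAB
        rcases hAB with hAB | ⟨⟨rfl, rfl⟩ | ⟨rfl, rfl⟩, -⟩
        · obtain ⟨h1, h2, h3⟩ := hT2 A B hAB
          exact ⟨Or.inr h1, Or.inr h2, h3⟩
        · exact ⟨Or.inl rfl, Or.inr hKM, hint⟩
        · exact ⟨Or.inr hKM, Or.inl rfl, by rwa [Set.inter_comm]⟩
      · rintro u (rfl | hu)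
        · exact hvconn _
        have huv : u ≠ v := by rintro rfl; exact hv hu
        have hold := (hT3 u hu).mono (le_sup_left : T ≤ T ⊔ SimpleGraph.edge (insert v N) K)
        by_cases huN : u ∈ N
        · have : {C | C ∈ maxCliques G (insert v S') ∧ u ∈ C} =
              insert (insert v N) {C | C ∈ maxCliques G S' ∧ u ∈ C} := by
            ext C
            rw [hMC']
            constructor
            · rintro ⟨rfl | h1, h2⟩
              · exact Or.inl rfl
              · exact Or.inr ⟨h1, h2⟩
            · rintro (rfl | ⟨h1, h2⟩)
              · exact ⟨Or.inl rfl, Or.inr huN⟩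
              · exact ⟨Or.inr h1, h2⟩
          rw [this]
          exact hold.insert ⟨hKM, hNK huN⟩ hadj
        · have : {C | C ∈ maxCliques G (insert v S') ∧ u ∈ C} =
              {C | C ∈ maxCliques G S' ∧ u ∈ C} := by
            ext C
            rw [hMC']
            constructor
            · rintro ⟨rfl | h1, h2⟩
              · exact absurd (h2.resolve_left huv) huN
              · exact ⟨h1, h2⟩
            · rintro ⟨h1, h2⟩
              exact ⟨Or.inr h1, h2⟩
          rw [this]
          exact hold

lemma maxCliques_univ : maxCliques G Set.univ = {C | Maximal (fun S : Set V => G.IsClique S) C} := by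
  simp [maxCliques]

/-- Every clique lies in a maximal clique. -/
lemma exists_maxClique [Finite V] {A : Set V} (hA : G.IsClique A) : ∃ C : MaxClique G, A ⊆ C.1 := by
  obtain ⟨C, h1, h2⟩ := Finite.exists_le_maximal (p := fun S : Set V => G.IsClique S) hA
  exact ⟨⟨C, h2⟩, h1⟩

theorem IsChordal.exists_isCliqueForest [Finite V] (hG : IsChordal G) :
    ∃ T : SimpleGraph (MaxClique G), IsCliqueForest G T := by
  obtain ⟨⟨T, hT1, hT2, hT3⟩, -⟩ := hG.exists_forest Set.univ
  rw [maxCliques_univ] at hT2 hT3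
  refine ⟨T.comap Subtype.val, hT1.of_comap (Function.Embedding.subtype _),
    fun C D h => (hT2 _ _ h).2.2, fun v => ⟨?_, ?_⟩⟩
  · have key : ∀ {A B : Set V} (p : T.Walk A B),
        (hp : ∀ E ∈ p.support, Maximal (fun S : Set V => G.IsClique S) E ∧ v ∈ E) →
        ((T.comap Subtype.val).induce {C : MaxClique G | v ∈ C.1}).Reachable
          ⟨⟨A, (hp A p.start_mem_support).1⟩, (hp A p.start_mem_support).2⟩
          ⟨⟨B, (hp B p.end_mem_support).1⟩, (hp B p.end_mem_support).2⟩ := by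
      intro A B p
      induction p with
      | nil => intro _; exact .refl _
      | cons h p ih =>
        intro hp
        refine SimpleGraph.Reachable.trans (SimpleGraph.Adj.reachable ?_)
          (ih fun E hE => hp E (by simp [hE]))
        exact h
    obtain ⟨C, hC⟩ := exists_maxClique (G := G) (A := {v}) (by simp)
    have : Nonempty {C : MaxClique G | v ∈ C.1} := ⟨⟨C, hC rfl⟩⟩
    refine ⟨fun C D => ?_⟩
    obtain ⟨p, hp⟩ := hT3 v trivial C.1.1 ⟨C.1.2, C.2⟩ D.1.1 ⟨D.1.2, D.2⟩
    exact key p hp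
  · exact (hT1.of_comap (Function.Embedding.subtype _)).induce _

lemma IsChordal.card_maxClique_le [Fintype V] (hG : IsChordal G) :
    Nat.card (MaxClique G) ≤ Fintype.card V + 1 := by
  have := (hG.exists_forest Set.univ).2
  rw [maxCliques_univ, Set.ncard_univ, Nat.card_eq_fintype_card] at this
  exact this

end Chordal

/-! ### Binary paths in forests -/

section Paths

open SimpleGraph

variable {N : Type*} {T : SimpleGraph N}

lemma ConnIn.mem_of_isPath {K : Set N} (hK : ConnIn T K) (hT : T.IsAcyclic) {C D : N}
    {p : T.Walk C D} (hp : p.IsPath) (hC : C ∈ K) (hD : D ∈ K) : ∀ E ∈ p.support, E ∈ K := by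
  classical
  intro E hE
  obtain ⟨q, hq⟩ := hK C hC D hD
  have := (hT.subsingleton_path C D).elim ⟨p, hp⟩ q.toPath
  have h2 : p = q.bypass := congrArg Subtype.val this
  rw [h2] at hE
  exact hq E (q.support_bypass_subset_support hE)

lemma ConnIn.inter {K L : Set N} (hK : ConnIn T K) (hL : ConnIn T L) (hT : T.IsAcyclic) :
    ConnIn T (K ∩ L) := by
  classical
  rintro C ⟨hCK, hCL⟩ D ⟨hDK, hDL⟩
  obtain ⟨q, hq⟩ := hK C hCK D hDK
  refine ⟨q.bypass, fun E hE => ⟨hq E (q.support_bypass_subset_support hE), ?_⟩⟩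
  exact hL.mem_of_isPath hT q.bypass_isPath hCL hDL E hE

lemma ConnIn.union {K L : Set N} (hK : ConnIn T K) (hL : ConnIn T L) {E : N} (hEK : E ∈ K)
    (hEL : E ∈ L) : ConnIn T (K ∪ L) := by
  have key : ∀ C ∈ K ∪ L, ∃ p : T.Walk C E, ∀ F ∈ p.support, F ∈ K ∪ L := by
    rintro C (hC | hC)
    · obtain ⟨p, hp⟩ := hK C hC E hEK
      exact ⟨p, fun F hF => Or.inl (hp F hF)⟩
    · obtain ⟨p, hp⟩ := hL C hC E hEL
      exact ⟨p, fun F hF => Or.inr (hp F hF)⟩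
  intro C hC D hD
  obtain ⟨p, hp⟩ := key C hC
  obtain ⟨q, hq⟩ := key D hD
  refine ⟨p.append q.reverse, fun F hF => ?_⟩
  rw [Walk.mem_support_append_iff] at hF
  rcases hF with hF | hF
  · exact hp F hF
  · exact hq F (by simpa using hF)

/-- A walk leaving a set `P` uses an edge leaving `P`. -/
lemma exists_adj_of_walk {C D : N} (p : T.Walk C D) {P : Set N} (hC : C ∈ P) (hD : D ∉ P) :
    ∃ E ∈ p.support, ∃ F ∈ p.support, E ∈ P ∧ F ∉ P ∧ T.Adj E F := by
  induction p with
  | nil => exact absurd hC hD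
  | @cons u v w h p ih =>
    by_cases hv : v ∈ P
    · obtain ⟨E, hE, F, hF, h1⟩ := ih hv hD
      exact ⟨E, by simp [hE], F, by simp [hF], h1⟩
    · exact ⟨u, by simp, v, by simp, hC, hv, h⟩

lemma ConnIn.exists_adj {K P : Set N} (hK : ConnIn T K) {C D : N} (hC : C ∈ K) (hCP : C ∈ P)
    (hD : D ∈ K) (hDP : D ∉ P) : ∃ E ∈ K, ∃ F ∈ K, E ∈ P ∧ F ∉ P ∧ T.Adj E F := by
  obtain ⟨p, hp⟩ := hK C hC D hD
  obtain ⟨E, hE, F, hF, h⟩ := exists_adj_of_walk p hCP hDP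
  exact ⟨E, hp E hE, F, hp F hF, h⟩

lemma IsPathSet.connIn {P : Set N} (h : IsPathSet T P) : ConnIn T P := by
  classical
  obtain ⟨a, b, p, -, rfl⟩ := h
  intro C hC D hD
  refine ⟨(p.takeUntil C hC).reverse.append (p.takeUntil D hD), fun E hE => ?_⟩
  rw [Walk.mem_support_append_iff] at hE
  rcases hE with hE | hE
  · exact p.support_takeUntil_subset_support hC (by simpa using hE)
  · exact p.support_takeUntil_subset_support hD hE

lemma IsPathSet.nonempty {P : Set N} (h : IsPathSet T P) : P.Nonempty := by
  obtain ⟨a, b, p, -, rfl⟩ := h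
  exact ⟨a, p.start_mem_support⟩

/-- A nonempty connected part of a path is a path. -/
lemma ConnIn.isPathSet {K P : Set N} (hK : ConnIn T K) (hT : T.IsAcyclic) (hP : IsPathSet T P)
    (hKP : K ⊆ P) (hne : K.Nonempty) : IsPathSet T K := by
  classical
  obtain ⟨a, b, p, hp, rfl⟩ := hP
  let I : Finset ℕ := (Finset.range (p.length + 1)).filter fun i => p.getVert i ∈ K
  have hI : ∀ i, i ∈ I ↔ i ≤ p.length ∧ p.getVert i ∈ K := fun i => by
    simp [I]
  have hIne : I.Nonempty := by
    obtain ⟨C, hC⟩ := hne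
    obtain ⟨i, rfl, hi⟩ := Walk.mem_support_iff_exists_getVert.1 (hKP hC)
    exact ⟨i, (hI i).2 ⟨hi, hC⟩⟩
  set i := I.min' hIne
  set j := I.max' hIne
  have hi := (hI _).1 (I.min'_mem hIne)
  have hj := (hI _).1 (I.max'_mem hIne)
  have hij : i ≤ j := I.min'_le _ (I.max'_mem hIne)
  let q := (p.drop i).take (j - i)
  have hqv : ∀ m, q.getVert m = p.getVert (i + min (j - i) m) := by
    intro m
    simp only [q]
    rw [Walk.take_getVert, Walk.drop_getVert]
  have hqp : q.IsPath := (hp.drop i).take (j - i)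
  have hend : (p.drop i).getVert (j - i) = p.getVert j := by
    rw [Walk.drop_getVert, Nat.add_sub_cancel' hij]
  refine ⟨_, _, q, hqp, Set.Subset.antisymm ?_ ?_⟩
  · intro C hC
    refine hK.mem_of_isPath hT hqp hi.2 ?_ C hC
    rw [hend]; exact hj.2
  · intro C hC
    obtain ⟨m, rfl, hm⟩ := Walk.mem_support_iff_exists_getVert.1 (hKP hC)
    have hmI := (hI m).2 ⟨hm, hC⟩
    have h1 : i ≤ m := I.min'_le _ hmI
    have h2 : m ≤ j := I.le_max' _ hmI
    have : q.getVert (m - i) = p.getVert m := by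
      rw [hqv]; congr 1; omega
    rw [← this]
    exact q.getVert_mem_support _

/-- A path of length at least one continues from its first vertex. -/
lemma exists_adj_start {a b : N} (p : T.Walk a b) (hab : a ≠ b) :
    ∃ c ∈ p.support, T.Adj a c := by
  cases p with
  | nil => exact absurd rfl hab
  | cons h p => exact ⟨_, by simp, h⟩

variable [Finite N]

lemma two_le_degIn {X : Set N} {C D E : N} (hD : D ∈ X) (hE : E ∈ X) (hCD : T.Adj C D)
    (hCE : T.Adj C E) (hDE : D ≠ E) : 2 ≤ degIn T X C := by
  rw [← Set.ncard_pair hDE]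
  refine Set.ncard_le_ncard ?_ (Set.toFinite _)
  rintro F (rfl | rfl)
  exacts [⟨hD, hCD⟩, ⟨hE, hCE⟩]

lemma three_le_degIn {X : Set N} {C D E F : N} (hD : D ∈ X) (hE : E ∈ X) (hF : F ∈ X)
    (hCD : T.Adj C D) (hCE : T.Adj C E) (hCF : T.Adj C F) (hDE : D ≠ E) (hDF : D ≠ F)
    (hEF : E ≠ F) : 3 ≤ degIn T X C := by
  have : ({D, E, F} : Set N).ncard = 3 := Set.ncard_eq_three.2 ⟨D, E, F, hDE, hDF, hEF, rfl⟩
  rw [← this]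
  refine Set.ncard_le_ncard ?_ (Set.toFinite _)
  rintro G (rfl | rfl | rfl)
  exacts [⟨hD, hCD⟩, ⟨hE, hCE⟩, ⟨hF, hCF⟩]

lemma one_le_degIn {X : Set N} {C D : N} (hD : D ∈ X) (hCD : T.Adj C D) : 1 ≤ degIn T X C := by
  exact (Set.ncard_pos (Set.toFinite _)).2 ⟨D, hD, hCD⟩

/-- The inner vertices of a binary path have no neighbours outside of it. -/
lemma eq_or_eq_of_adj {X P : Set N} {a b : N} {p : T.Walk a b} (hp : p.IsPath)
    (hpP : {C | C ∈ p.support} = P) (hPX : P ⊆ X) (hdeg : ∀ C ∈ P, degIn T X C ≤ 2) {C D : N}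
    (hC : C ∈ P) (hD : D ∈ X) (hDP : D ∉ P) (hCD : T.Adj C D) : C = a ∨ C = b := by
  subst hpP
  obtain ⟨i, rfl, hi⟩ := Walk.mem_support_iff_exists_getVert.1 hC
  by_contra! hcon
  have hi0 : i ≠ 0 := by rintro rfl; exact hcon.1 p.getVert_zero
  have hil : i ≠ p.length := by rintro rfl; exact hcon.2 p.getVert_length
  have h1 := p.adj_getVert_succ (i := i) (by omega)
  have h2 := p.adj_getVert_succ (i := i - 1) (by omega)
  rw [Nat.sub_add_cancel (by omega)] at h2
  have hm : ∀ j, p.getVert j ∈ {C | C ∈ p.support} := fun j => p.getVert_mem_support j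
  have hne : p.getVert (i - 1) ≠ p.getVert (i + 1) := by
    intro h
    have := hp.getVert_injOn (by simp; omega) (by simp; omega) h
    omega
  have := three_le_degIn (hPX (hm (i - 1))) (hPX (hm (i + 1))) hD h2.symm h1 hCD hne
    (fun h => hDP (h ▸ hm _)) (fun h => hDP (h ▸ hm _))
  have := hdeg _ hC
  omega

/-- A neighbour of a maximal binary path has degree at least three. -/
lemma three_le_degIn_of_adj {X P : Set N} (hP : Maximal (IsBinaryPath T X) P) {C D : N}
    (hC : C ∈ P) (hD : D ∈ X) (hDP : D ∉ P) (hCD : T.Adj C D) : 3 ≤ degIn T X D := by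
  obtain ⟨⟨⟨a, b, p, hp, hpP⟩, hPX, hdeg⟩, hmax⟩ := hP
  by_contra hlt
  have hbin : IsPathSet T (insert D P) → False := by
    intro h
    refine hDP (hmax ⟨h, Set.insert_subset hD hPX, ?_⟩ (Set.subset_insert _ _)
      (Set.mem_insert _ _))
    rintro E (rfl | hE)
    · omega
    · exact hdeg E hE
  have hDp : D ∉ p.support := fun h => hDP (hpP ▸ h)
  rcases eq_or_eq_of_adj hp hpP hPX hdeg hC hD hDP hCD with rfl | rfl
  · refine hbin ⟨D, b, .cons hCD.symm p, (Walk.cons_isPath_iff _ _).2 ⟨hp, hDp⟩, ?_⟩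
    rw [← hpP]; ext E; simp
  · refine hbin ⟨a, D, p.concat hCD, (Walk.concat_isPath_iff _).2 ⟨hp, hDp⟩, ?_⟩
    rw [← hpP]; ext E; simp [Walk.support_concat, or_comm]

/-- If a binary path has two different neighbours, its contacts with them are its ends. -/
lemma contacts_eq_ends {X P : Set N} {a b : N} {p : T.Walk a b} (hp : p.IsPath)
    (hpP : {C | C ∈ p.support} = P) (hPX : P ⊆ X) (hdeg : ∀ C ∈ P, degIn T X C ≤ 2)
    {C₁ C₂ D₁ D₂ : N} (hC₁ : C₁ ∈ P) (hC₂ : C₂ ∈ P) (hD₁ : D₁ ∈ X) (hD₂ : D₂ ∈ X) (hD₁P : D₁ ∉ P)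
    (hD₂P : D₂ ∉ P) (h₁ : T.Adj C₁ D₁) (h₂ : T.Adj C₂ D₂) (hne : D₁ ≠ D₂) :
    (C₁ = a ∧ C₂ = b) ∨ (C₁ = b ∧ C₂ = a) := by
  have key : ∀ {a b : N} (p : T.Walk a b), {C | C ∈ p.support} = P → T.Adj a D₁ → T.Adj a D₂ →
      a = b := by
    intro a b p hpP h1 h2
    by_contra hab
    obtain ⟨c, hc, hac⟩ := exists_adj_start p hab
    have hcP : c ∈ P := hpP ▸ hc
    have haP : a ∈ P := hpP ▸ p.start_mem_support
    have := three_le_degIn hD₁ hD₂ (hPX hcP) h1 h2 hac hne (fun h => hD₁P (h ▸ hcP))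
      (fun h => hD₂P (h ▸ hcP))
    have := hdeg a haP
    omega
  rcases eq_or_eq_of_adj hp hpP hPX hdeg hC₁ hD₁ hD₁P h₁ with rfl | rfl <;>
    rcases eq_or_eq_of_adj hp hpP hPX hdeg hC₂ hD₂ hD₂P h₂ with rfl | rfl
  · exact Or.inl ⟨rfl, key p hpP h₁ h₂⟩
  · exact Or.inl ⟨rfl, rfl⟩
  · exact Or.inr ⟨rfl, rfl⟩
  · refine Or.inl ⟨key p.reverse ?_ h₁ h₂, rfl⟩
    rw [← hpP]; ext; simp

/-- A pendant path has at most one neighbour. -/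
lemma not_isPendantPath {X P : Set N} {C₁ C₂ D₁ D₂ : N} (hC₁ : C₁ ∈ P) (hC₂ : C₂ ∈ P) (hD₁ : D₁ ∈ X)
    (hD₂ : D₂ ∈ X) (hD₁P : D₁ ∉ P) (hD₂P : D₂ ∉ P) (h₁ : T.Adj C₁ D₁) (h₂ : T.Adj C₂ D₂)
    (hne : D₁ ≠ D₂) : ¬ IsPendantPath T X P := by
  rintro ⟨⟨-, hPX, hdeg⟩, a, b, p, hp, hpP, hend⟩
  have key : ∀ {a b : N} (p : T.Walk a b), p.IsPath → {C | C ∈ p.support} = P →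
      2 ≤ degIn T X a := by
    intro a b p hp hpP
    have hc := contacts_eq_ends hp hpP hPX hdeg hC₁ hC₂ hD₁ hD₂ hD₁P hD₂P h₁ h₂ hne
    by_cases hab : a = b
    · subst hab
      have h1 : C₁ = a := by tauto
      have h2 : C₂ = a := by tauto
      subst h1; subst h2
      exact two_le_degIn hD₁ hD₂ h₁ h₂ hne
    · obtain ⟨c, hcp, hac⟩ := exists_adj_start p hab
      have hcP : c ∈ P := hpP ▸ hcp
      rcases hc with ⟨rfl, -⟩ | ⟨-, rfl⟩
      · exact two_le_degIn hD₁ (hPX hcP) h₁ hac fun h => hD₁P (h ▸ hcP)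
      · exact two_le_degIn hD₂ (hPX hcP) h₂ hac fun h => hD₂P (h ▸ hcP)
  have ha := key p hp hpP
  have hb := key p.reverse hp.reverse (by rw [← hpP]; ext; simp)
  rcases hend with h | h | h
  · omega
  · omega
  · omega

/-- A connected set containing both contacts of a binary path with two different neighbours
contains the whole path. -/
lemma ConnIn.subset_of_contacts {X P K : Set N} (hK : ConnIn T K) (hT : T.IsAcyclic)
    (hP : IsBinaryPath T X P) {C₁ C₂ D₁ D₂ : N} (hC₁ : C₁ ∈ P) (hC₂ : C₂ ∈ P) (hD₁ : D₁ ∈ X)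
    (hD₂ : D₂ ∈ X) (hD₁P : D₁ ∉ P) (hD₂P : D₂ ∉ P) (h₁ : T.Adj C₁ D₁) (h₂ : T.Adj C₂ D₂)
    (hne : D₁ ≠ D₂) (hK₁ : C₁ ∈ K) (hK₂ : C₂ ∈ K) : P ⊆ K := by
  obtain ⟨⟨a, b, p, hp, hpP⟩, hPX, hdeg⟩ := hP
  intro E hE
  have hE' : E ∈ p.support := by rw [← hpP] at hE; exact hE
  rcases contacts_eq_ends hp hpP hPX hdeg hC₁ hC₂ hD₁ hD₂ hD₁P hD₂P h₁ h₂ hne with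
    ⟨rfl, rfl⟩ | ⟨rfl, rfl⟩
  · exact hK.mem_of_isPath hT hp hK₁ hK₂ E hE'
  · exact hK.mem_of_isPath hT hp hK₂ hK₁ E hE'

/-- Different maximal binary paths are disjoint. -/
lemma eq_of_maximal_isBinaryPath {X P Q : Set N} (hP : Maximal (IsBinaryPath T X) P)
    (hQ : Maximal (IsBinaryPath T X) Q) {C : N} (hCP : C ∈ P) (hCQ : C ∈ Q) : P = Q := by
  have hQP : Q ⊆ P := by
    intro D hD
    by_contra hDP
    obtain ⟨E, hE, F, hF, hEP, hFP, hEF⟩ := hQ.1.1.connIn.exists_adj hCQ hCP hD hDP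
    have := three_le_degIn_of_adj hP hEP (hQ.1.2.1 hF) hFP hEF
    have := hQ.1.2.2 F hF
    omega
  exact (hQ.2 hP.1 hQP).antisymm hQP

end Paths

/-! ### Pruning preserves the representation of the graph -/

section Pruning

open SimpleGraph

variable {V : Type*} {G : SimpleGraph V}

lemma exists_walk_length_le {u v : V} (q : G.Walk u v) {a b : V} (ha : a ∈ q.support)
    (hb : b ∈ q.support) : ∃ r : G.Walk a b, r.length ≤ q.length := by
  classical
  have hb' := hb
  rw [← q.take_spec ha, Walk.mem_support_append_iff] at hb'
  rcases hb' with h | h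
  · refine ⟨((q.takeUntil a ha).dropUntil b h).reverse, ?_⟩
    rw [Walk.length_reverse]
    exact (Walk.length_dropUntil_le_length _ _).trans (Walk.length_takeUntil_le_length _ _)
  · exact ⟨(q.dropUntil a ha).takeUntil b h,
      (Walk.length_takeUntil_le_length _ _).trans (Walk.length_dropUntil_le_length _ _)⟩

lemma MaxClique.exists_walk_length_le_one (C : MaxClique G) {x y : V} (hx : x ∈ C.1)
    (hy : y ∈ C.1) : ∃ p : G.Walk x y, p.length ≤ 1 := by
  by_cases hxy : x = y
  · subst hxy; exact ⟨.nil, by simp⟩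
  · exact ⟨.cons (C.2.1 hx hy hxy) .nil, by simp⟩

/-- If a walk meets all cliques of a path, the diameter of the path is at most two more than the
length of the walk. -/
lemma pathDiam_le_of_walk {P : Set (MaxClique G)} {u v : V} (q : G.Walk u v)
    (h : ∀ C ∈ P, ∃ w ∈ q.support, w ∈ C.1) : pathDiam P ≤ q.length + 2 := by
  refine csSup_le' ?_
  rintro d ⟨C, hC, D, hD, x, hx, y, hy, rfl⟩
  obtain ⟨a, ha, haC⟩ := h C hC
  obtain ⟨b, hb, hbD⟩ := h D hD
  obtain ⟨p₁, h₁⟩ := C.exists_walk_length_le_one hx haC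
  obtain ⟨p₂, h₂⟩ := exists_walk_length_le q ha hb
  obtain ⟨p₃, h₃⟩ := D.exists_walk_length_le_one hbD hy
  have := dist_le (p₁.append (p₂.append p₃))
  simp only [Walk.length_append] at this
  omega

lemma IsCliqueForest.connIn {T : SimpleGraph (MaxClique G)} (hT : IsCliqueForest G T) (v : V) :
    ConnIn T {C | v ∈ C.1} := by
  intro C hC D hD
  obtain ⟨p⟩ := (hT.isTree_node v).connected.preconnected ⟨C, hC⟩ ⟨D, hD⟩
  let f : T.induce {C : MaxClique G | v ∈ C.1} →g T := ⟨Subtype.val, fun {a b} h => h⟩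
  refine ⟨p.map f, fun E hE => ?_⟩
  rw [Walk.support_map, List.mem_map] at hE
  obtain ⟨F, -, rfl⟩ := hE
  exact F.2

/-- The properties of the forest `T[X]` and the remaining nodes `U` that are preserved by pruning:
`T[X]` represents the graph `G[U]` in the same way as a clique forest. -/
structure IsPruned (T : SimpleGraph (MaxClique G)) (X : Set (MaxClique G)) (U : Set V) : Prop where
  mem_iff : ∀ v, v ∈ U ↔ ∃ C ∈ X, v ∈ C.1
  conn : ∀ v, ConnIn T {C | C ∈ X ∧ v ∈ C.1}
  common : ∀ u ∈ U, ∀ w ∈ U, G.Adj u w → ∃ C ∈ X, u ∈ C.1 ∧ w ∈ C.1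

variable [Finite V] {T : SimpleGraph (MaxClique G)} {X : Set (MaxClique G)} {U : Set V} {k : ℝ}

/-- A connected set of removed cliques is part of a single removed path. -/
lemma ConnIn.exists_subset_prunedPath {K : Set (MaxClique G)} (hK : ConnIn T K) (hne : K.Nonempty)
    (hsub : K ⊆ ⋃ P ∈ prunedPaths T k X, P) : ∃ P ∈ prunedPaths T k X, K ⊆ P := by
  obtain ⟨C, hC⟩ := hne
  obtain ⟨P, hP, hCP⟩ := Set.mem_iUnion₂.1 (hsub hC)
  refine ⟨P, hP, fun D hD => ?_⟩
  by_contra hDP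
  obtain ⟨E, hE, F, hF, hEP, hFP, hEF⟩ := hK.exists_adj hC hCP hD hDP
  obtain ⟨Q, hQ, hFQ⟩ := Set.mem_iUnion₂.1 (hsub hF)
  have := three_le_degIn_of_adj hP.1 hEP (hQ.1.1.2.1 hFQ) hFP hEF
  have := hQ.1.1.2.2 F hFQ
  omega

/-- A removed path with two different neighbours has large diameter, so that a walk of length at
most one cannot meet all its cliques. -/
lemma exists_disjoint_of_contacts (hk : 2 ≤ k) {P : Set (MaxClique G)}
    (hP : P ∈ prunedPaths T k X) {C₁ C₂ D₁ D₂ : MaxClique G} (hC₁ : C₁ ∈ P)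
    (hC₂ : C₂ ∈ P) (hD₁ : D₁ ∈ X) (hD₂ : D₂ ∈ X) (hD₁P : D₁ ∉ P) (hD₂P : D₂ ∉ P)
    (h₁ : T.Adj C₁ D₁) (h₂ : T.Adj C₂ D₂) (hne : D₁ ≠ D₂) {u v : V} (q : G.Walk u v)
    (hq : q.length ≤ 1) : ∃ C ∈ P, ∀ w ∈ q.support, w ∉ C.1 := by
  by_contra! hcon
  have h3 := pathDiam_le_of_walk q hcon
  rcases hP.2 with h | ⟨-, h⟩
  · exact not_isPendantPath hC₁ hC₂ hD₁ hD₂ hD₁P hD₂P h₁ h₂ hne h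
  · have : (pathDiam P : ℝ) ≤ 3 := by exact_mod_cast (by omega : pathDiam P ≤ 3)
    linarith

lemma IsPruned.univ (hT : IsCliqueForest G T) : IsPruned T Set.univ Set.univ where
  mem_iff v := by
    obtain ⟨C, hC⟩ := exists_maxClique (G := G) (A := {v}) (by simp)
    exact ⟨fun _ => ⟨C, trivial, hC rfl⟩, fun _ => trivial⟩
  conn v := by simpa using hT.connIn v
  common u _ w _ huw := by
    obtain ⟨C, hC⟩ := exists_maxClique (G := G) (A := {u, w}) (by
      rw [isClique_pair]; exact fun _ => huw)
    exact ⟨C, trivial, hC (by simp), hC (by simp)⟩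

/-- One pruning iteration preserves `IsPruned`. -/
theorem IsPruned.step (hT : T.IsAcyclic) (hk : 2 ≤ k) (h : IsPruned T X U) :
    IsPruned T (X \ ⋃ P ∈ prunedPaths T k X, P)
      (U \ ⋃ P ∈ prunedPaths T k X, nodesInside T X U P) := by
  classical
  set Rm := ⋃ P ∈ prunedPaths T k X, P with hRm
  have hinside : ∀ v ∈ U, ∀ P ∈ prunedPaths T k X, {C | C ∈ X ∧ v ∈ C.1} ⊆ P →
      v ∈ ⋃ P ∈ prunedPaths T k X, nodesInside T X U P := by
    intro v hv P hP hsub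
    refine Set.mem_iUnion₂.2 ⟨P, hP, hv, ?_, hsub⟩
    obtain ⟨C, hC⟩ := (h.mem_iff v).1 hv
    exact (h.conn v).isPathSet hT hP.1.1.1 hsub ⟨C, hC⟩
  have hin : ∀ {P}, P ∈ prunedPaths T k X → ∀ {C}, C ∈ P → C ∈ Rm := fun hP _ hC =>
    Set.mem_iUnion₂.2 ⟨_, hP, hC⟩
  refine ⟨fun v => ⟨?_, ?_⟩, fun v => ?_, ?_⟩
  · rintro ⟨hvU, hv⟩
    by_contra! hcon
    obtain ⟨C, hC⟩ := (h.mem_iff v).1 hvU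
    obtain ⟨P, hP, hsub⟩ := (h.conn v).exists_subset_prunedPath (k := k) ⟨C, hC⟩ (by
      intro D hD
      by_contra hDR
      exact hcon D ⟨hD.1, hDR⟩ hD.2)
    exact hv (hinside v hvU P hP hsub)
  · rintro ⟨C, ⟨hCX, hCR⟩, hvC⟩
    refine ⟨(h.mem_iff v).2 ⟨C, hCX, hvC⟩, fun hv => ?_⟩
    obtain ⟨P, hP, -, -, hsub⟩ := Set.mem_iUnion₂.1 hv
    exact hCR (hin hP (hsub ⟨hCX, hvC⟩))
  · -- a path between two remaining cliques containing `v` cannot cross a removed path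
    rintro C ⟨⟨hCX, hCR⟩, hvC⟩ D ⟨⟨hDX, hDR⟩, hvD⟩
    obtain ⟨q', hq'⟩ := h.conn v C ⟨hCX, hvC⟩ D ⟨hDX, hvD⟩
    set q := q'.bypass with hqdef
    have hqp : q.IsPath := q'.bypass_isPath
    have hq : ∀ E ∈ q.support, E ∈ {C | C ∈ X ∧ v ∈ C.1} := fun E hE =>
      hq' E (q'.support_bypass_subset_support hE)
    refine ⟨q, fun E hE => ⟨⟨(hq E hE).1, fun hER => ?_⟩, (hq E hE).2⟩⟩
    obtain ⟨P, hP, hEP⟩ := Set.mem_iUnion₂.1 hER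
    obtain ⟨D₁, hD₁, C₁, hC₁, hD₁P, hC₁P, h₁⟩ := exists_adj_of_walk (q.takeUntil E hE)
      (P := Pᶜ) (fun hc => hCR (hin hP hc)) (by simpa using hEP)
    obtain ⟨C₂, hC₂, D₂, hD₂, hC₂P, hD₂P, h₂⟩ := exists_adj_of_walk (q.dropUntil E hE)
      (P := P) hEP (fun hc => hDR (hin hP hc))
    have hsub1 := q.support_takeUntil_subset_support hE
    have hsub2 := q.support_dropUntil_subset_support hE
    have hne : D₁ ≠ D₂ := by
      rintro rfl
      have hnd := hqp.support_nodup
      rw [← q.take_spec hE, Walk.support_append, List.nodup_append] at hnd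
      rcases (Walk.mem_support_iff _).1 hD₂ with h0 | h0
      · exact hD₂P (h0 ▸ hEP)
      · exact hnd.2.2 _ hD₁ _ h0 rfl
    have hC₁P' : C₁ ∈ P := by simpa using hC₁P
    have hsub := (h.conn v).subset_of_contacts hT hP.1.1 hC₁P' hC₂P (hq _ (hsub1 hD₁)).1
      (hq _ (hsub2 hD₂)).1 hD₁P hD₂P h₁.symm h₂ hne (hq _ (hsub1 hC₁)) (hq _ (hsub2 hC₂))
    obtain ⟨F, hF, hvF⟩ := exists_disjoint_of_contacts hk hP hC₁P' hC₂P
      (hq _ (hsub1 hD₁)).1 (hq _ (hsub2 hD₂)).1 hD₁P hD₂P h₁.symm h₂ hne (.nil : G.Walk v v)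
      (by simp)
    exact hvF v (by simp) (hsub hF).2
  · -- if all common cliques of `u` and `w` were removed, both nodes would extend beyond the same
    -- removed path in different directions and together meet all its cliques
    rintro u ⟨huU, hu⟩ w ⟨hwU, hw⟩ huw
    by_contra! hcon
    obtain ⟨C, hCX, huC, hwC⟩ := h.common u huU w hwU huw
    have hK := (h.conn u).inter (h.conn w) hT
    obtain ⟨P, hP, hsub⟩ := hK.exists_subset_prunedPath (k := k) ⟨C, ⟨hCX, huC⟩, hCX, hwC⟩ (by
      rintro D ⟨⟨hDX, huD⟩, -, hwD⟩
      by_contra hDR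
      exact hcon D ⟨hDX, hDR⟩ huD hwD)
    have hCP := hsub ⟨⟨hCX, huC⟩, hCX, hwC⟩
    have hexit : ∀ x ∈ U, x ∉ ⋃ P ∈ prunedPaths T k X, nodesInside T X U P → x ∈ C.1 →
        ∃ E F, E ∈ P ∧ F ∉ P ∧ T.Adj E F ∧ (E ∈ X ∧ x ∈ E.1) ∧ F ∈ X ∧ x ∈ F.1 := by
      intro x hxU hx hxC
      obtain ⟨D, hD, hDP⟩ : ∃ D ∈ {C | C ∈ X ∧ x ∈ C.1}, D ∉ P := by
        by_contra! hc
        exact hx (hinside x hxU P hP hc)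
      obtain ⟨E, hE, F, hF, h1, h2, h3⟩ := (h.conn x).exists_adj ⟨hCX, hxC⟩ hCP hD hDP
      exact ⟨E, F, h1, h2, h3, hE, hF⟩
    obtain ⟨E₁, F₁, hE₁P, hF₁P, h₁, hE₁, hF₁⟩ := hexit u huU hu huC
    obtain ⟨E₂, F₂, hE₂P, hF₂P, h₂, hE₂, hF₂⟩ := hexit w hwU hw hwC
    have hne : F₁ ≠ F₂ := by
      rintro rfl
      exact hF₁P (hsub ⟨hF₁, hF₂⟩)
    have hun := (h.conn u).union (h.conn w) (E := C) ⟨hCX, huC⟩ ⟨hCX, hwC⟩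
    have hPun := hun.subset_of_contacts hT hP.1.1 hE₁P hE₂P hF₁.1 hF₂.1 hF₁P hF₂P h₁ h₂ hne
      (Or.inl hE₁) (Or.inr hE₂)
    obtain ⟨F, hF, hdis⟩ := exists_disjoint_of_contacts hk hP hE₁P hE₂P hF₁.1 hF₂.1 hF₁P
      hF₂P h₁ h₂ hne (.cons huw .nil) (by simp)
    rcases hPun hF with h0 | h0
    · exact hdis u (by simp) h0.2
    · exact hdis w (by simp) h0.2

theorem isPruned_pruneState (hT : IsCliqueForest G T) (hk : 2 ≤ k) (i : ℕ) :
    IsPruned T (pruneState T k i).cliques (pruneState T k i).nodes := by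
  induction i with
  | zero => exact IsPruned.univ hT
  | succ i ih => exact ih.step hT.acyclic hk

end Pruning

/-! ### Branching vertices and leaves of a forest -/

section Branching

open SimpleGraph

variable {N : Type*} {T : SimpleGraph N}

lemma sum_degree_add_two_le [Fintype N] [Nonempty N] [DecidableRel T.Adj] (hT : T.IsAcyclic) :
    ∑ C, T.degree C + 2 ≤ 2 * Fintype.card N := by
  classical
  obtain ⟨F, hle, -, hF⟩ := (connected_top (V := N)).exists_isTree_le_of_le_of_isAcyclic le_top hT
  have h1 := hF.card_edgeFinset
  have h2 : T.edgeFinset.card ≤ F.edgeFinset.card := Finset.card_le_card (by simpa using hle)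
  rw [T.sum_degrees_eq_twice_card_edges]
  omega

lemma degIn_eq_degree {Y : Set N} [Fintype Y] [DecidableRel (T.induce Y).Adj] (C : Y) :
    degIn T Y C = (T.induce Y).degree C := by
  classical
  rw [← card_neighborFinset_eq_degree, ← Finset.card_map (Function.Embedding.subtype _),
    ← Set.ncard_coe_finset, degIn]
  congr 1
  ext D
  simp [and_comm]

/-- A forest on a nonempty vertex set has average degree less than two. -/
lemma sum_degIn_add_two_le (hT : T.IsAcyclic) {Y : Finset N} (hY : Y.Nonempty) :
    ∑ C ∈ Y, degIn T Y C + 2 ≤ 2 * Y.card := by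
  classical
  have : Nonempty (Y : Set N) := hY.to_subtype
  have h := sum_degree_add_two_le (hT.induce (Y : Set N))
  have h2 : ∑ C ∈ Y, degIn T Y C = ∑ C : (Y : Set N), degIn T Y C :=
    (Finset.sum_coe_sort Y fun C => degIn T Y C).symm
  rw [h2, Finset.sum_congr rfl fun C _ => degIn_eq_degree C]
  simpa using h

variable [Finite N]

lemma degIn_mono {X Y : Set N} (h : X ⊆ Y) (C : N) : degIn T X C ≤ degIn T Y C :=
  Set.ncard_le_ncard (fun _ hD => ⟨h hD.1, hD.2⟩) (Set.toFinite _)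

/-- The vertices of `T[X]` of degree at least three. -/
def branching (T : SimpleGraph N) (X : Set N) : Set N := {C | C ∈ X ∧ 3 ≤ degIn T X C}

/-- A forest with a vertex of degree at least three has at least two more leaves than it has
vertices of degree at least three. -/
lemma ncard_branching_add_two_le (hT : T.IsAcyclic) {X : Set N} (h : (branching T X).Nonempty) :
    (branching T X).ncard + 2 ≤ {C | C ∈ X ∧ degIn T X C = 1}.ncard := by
  classical
  have := Fintype.ofFinite N
  let Y : Finset N := Finset.univ.filter fun C => C ∈ X ∧ degIn T X C ≠ 0
  have hY : ∀ C, C ∈ Y ↔ C ∈ X ∧ degIn T X C ≠ 0 := fun C => by simp [Y]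
  have hdeg : ∀ C ∈ Y, degIn T Y C = degIn T X C := by
    intro C hC
    have hCX := ((hY C).1 hC).1
    unfold degIn
    congr 1
    ext D
    simp only [Set.mem_ofPred_eq, Finset.mem_coe, hY]
    refine ⟨fun h => ⟨h.1.1, h.2⟩, fun h => ⟨⟨h.1, ?_⟩, h.2⟩⟩
    have := one_le_degIn hCX h.2.symm
    omega
  have hYne : Y.Nonempty := by
    obtain ⟨C, hC⟩ := h
    exact ⟨C, (hY C).2 ⟨hC.1, by have := hC.2; omega⟩⟩
  have h1 : ∑ C ∈ Y, degIn T X C + 2 ≤ 2 * Y.card := by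
    rw [← Finset.sum_congr rfl hdeg]
    exact sum_degIn_add_two_le hT hYne
  have h2 : branching T X = (Y.filter fun C => 3 ≤ degIn T X C : Finset N) := by
    ext C
    simp only [branching, Set.mem_ofPred_eq, Finset.coe_filter, hY]
    exact ⟨fun h => ⟨⟨h.1, by omega⟩, h.2⟩, fun h => ⟨h.1.1, h.2⟩⟩
  have h3 : {C | C ∈ X ∧ degIn T X C = 1} = (Y.filter fun C => degIn T X C = 1 : Finset N) := by
    ext C
    simp only [Set.mem_ofPred_eq, Finset.coe_filter, hY]
    exact ⟨fun h => ⟨⟨h.1, by omega⟩, h.2⟩, fun h => ⟨h.1.1, h.2⟩⟩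
  rw [h2, h3, Set.ncard_coe_finset, Set.ncard_coe_finset, Finset.card_filter, Finset.card_filter]
  have h4 : ∑ C ∈ Y, (2 + if 3 ≤ degIn T X C then 1 else 0) ≤
      ∑ C ∈ Y, (degIn T X C + if degIn T X C = 1 then 1 else 0) := by
    refine Finset.sum_le_sum fun C hC => ?_
    have := ((hY C).1 hC).2
    split_ifs <;> omega
  rw [Finset.sum_add_distrib, Finset.sum_add_distrib, Finset.sum_const, smul_eq_mul] at h4
  omega

/-- All vertices of a binary path that is not pendant have degree two. -/
lemma IsBinaryPath.degIn_eq_two {X P : Set N} (hP : IsBinaryPath T X P)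
    (hpend : ¬ IsPendantPath T X P) : ∀ C ∈ P, degIn T X C = 2 := by
  obtain ⟨⟨a, b, p, hp, hpP⟩, hPX, hdeg⟩ := hP
  have hend : ∀ {a b : N} (p : T.Walk a b), p.IsPath → {C | C ∈ p.support} = P →
      degIn T X a = 2 := by
    intro a b p hp hpP
    have haP : a ∈ P := hpP ▸ p.start_mem_support
    have h2 := hdeg a haP
    have h1 : degIn T X a ≠ 1 := fun h =>
      hpend ⟨⟨⟨a, b, p, hp, hpP⟩, hPX, hdeg⟩, a, b, p, hp, hpP, Or.inl h⟩
    have h0 : degIn T X a ≠ 0 := by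
      intro h
      by_cases hab : a = b
      · subst hab
        refine hpend ⟨⟨⟨a, a, p, hp, hpP⟩, hPX, hdeg⟩, a, a, p, hp, hpP, Or.inr (Or.inr ⟨?_, h⟩)⟩
        rw [← hpP, (Walk.isPath_iff_nil.1 hp).eq_nil]
        ext; simp
      · obtain ⟨c, hc, hac⟩ := exists_adj_start p hab
        have := one_le_degIn (hPX (hpP ▸ hc : c ∈ P)) hac
        omega
    omega
  intro C hC
  rw [← hpP] at hC
  obtain ⟨i, rfl, hi⟩ := Walk.mem_support_iff_exists_getVert.1 hC
  have hm : ∀ j, p.getVert j ∈ P := fun j => hpP ▸ p.getVert_mem_support j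
  rcases Nat.eq_zero_or_pos i with rfl | hi0
  · rw [p.getVert_zero]; exact hend p hp hpP
  rcases hi.eq_or_lt with rfl | hil
  · rw [p.getVert_length]
    exact hend p.reverse hp.reverse (by rw [← hpP]; ext; simp)
  have h1 := p.adj_getVert_succ (i := i) hil
  have h2 := p.adj_getVert_succ (i := i - 1) (by omega)
  rw [Nat.sub_add_cancel hi0] at h2
  refine (hdeg _ (hm i)).antisymm
    (two_le_degIn (hPX (hm (i - 1))) (hPX (hm (i + 1))) h2.symm h1 fun h => ?_)
  have := hp.getVert_injOn (by simp; omega) (by simp; omega) h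
  omega

lemma exists_maximal_isBinaryPath {X : Set N} {C : N} (hC : C ∈ X) (hdeg : degIn T X C ≤ 2) :
    ∃ P, Maximal (IsBinaryPath T X) P ∧ C ∈ P := by
  have h : IsBinaryPath T X {C} := by
    refine ⟨⟨C, C, .nil, by simp, by ext; simp⟩, by simpa using hC, ?_⟩
    rintro _ rfl
    exact hdeg
  obtain ⟨P, hle, hP⟩ := Finite.exists_le_maximal h
  exact ⟨P, hP, hle rfl⟩

/-- If all vertices of a forest have degree at most two, all maximal binary paths are pendant. -/
lemma isPendantPath_of_branching_eq_empty (hT : T.IsAcyclic) {X P : Set N}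
    (hX : branching T X = ∅) (hP : Maximal (IsBinaryPath T X) P) : IsPendantPath T X P := by
  classical
  by_contra hpend
  have h2 := hP.1.degIn_eq_two hpend
  have hdeg : ∀ C ∈ P, degIn T P C = 2 := by
    intro C hC
    rw [← h2 C hC]
    unfold degIn
    congr 1
    ext D
    refine ⟨fun h => ⟨hP.1.2.1 h.1, h.2⟩, fun h => ⟨?_, h.2⟩⟩
    by_contra hD
    exact (Set.eq_empty_iff_forall_notMem.1 hX) D ⟨h.1, three_le_degIn_of_adj hP hC h.1 hD h.2⟩
  have hfin := Set.toFinite P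
  have h := sum_degIn_add_two_le hT (Y := hfin.toFinset) (by simpa using hP.1.1.nonempty)
  rw [hfin.coe_toFinset,
    Finset.sum_congr rfl fun C hC => hdeg C (by simpa using hC), Finset.sum_const,
    smul_eq_mul] at h
  omega

end Branching

/-! ### Pruning halves the number of branching cliques -/

section Rounds

open SimpleGraph

variable {V : Type*} {G : SimpleGraph V} [Finite V] {T : SimpleGraph (MaxClique G)}
  {X : Set (MaxClique G)} {k : ℝ}

/-- A clique that becomes a leaf by pruning was branching before: a remaining clique of degree two
lies on a path that is not removed, and no neighbour of such a path is removed. -/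
lemma mem_branching_of_degIn_diff_eq_one {C : MaxClique G}
    (hC : C ∈ X \ ⋃ P ∈ prunedPaths T k X, P)
    (hdeg : degIn T (X \ ⋃ P ∈ prunedPaths T k X, P) C = 1) : C ∈ branching T X := by
  refine ⟨hC.1, ?_⟩
  by_contra hlt
  obtain ⟨P, hP, hCP⟩ := exists_maximal_isBinaryPath hC.1 (by omega : degIn T X C ≤ 2)
  have hPR : P ∉ prunedPaths T k X := fun h => hC.2 (Set.mem_iUnion₂.2 ⟨P, h, hCP⟩)
  have h2 := hP.1.degIn_eq_two (fun h => hPR ⟨hP, Or.inl h⟩) C hCP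
  have : degIn T (X \ ⋃ P ∈ prunedPaths T k X, P) C = degIn T X C := by
    unfold degIn
    congr 1
    ext D
    refine ⟨fun h => ⟨h.1.1, h.2⟩, fun h => ⟨⟨h.1, fun hD => ?_⟩, h.2⟩⟩
    obtain ⟨Q, hQ, hDQ⟩ := Set.mem_iUnion₂.1 hD
    by_cases hDP : D ∈ P
    · exact hPR (eq_of_maximal_isBinaryPath hP hQ.1 hDP hDQ ▸ hQ)
    · have := three_le_degIn_of_adj hP hCP h.1 hDP h.2
      have := hQ.1.1.2.2 D hDQ
      omega
  omega

/-- A pruning iteration at least halves the number of branching cliques. -/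
lemma two_mul_ncard_branching_le (hT : T.IsAcyclic)
    (h : (branching T (X \ ⋃ P ∈ prunedPaths T k X, P)).Nonempty) :
    2 * (branching T (X \ ⋃ P ∈ prunedPaths T k X, P)).ncard ≤ (branching T X).ncard := by
  set Y := X \ ⋃ P ∈ prunedPaths T k X, P
  have h1 := ncard_branching_add_two_le hT h
  have hdisj : Disjoint (branching T Y) {C | C ∈ Y ∧ degIn T Y C = 1} := by
    rw [Set.disjoint_left]
    rintro C ⟨-, h3⟩ ⟨-, h1⟩
    omega
  have h2 := Set.ncard_union_eq hdisj (Set.toFinite _) (Set.toFinite _)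
  have h3 : branching T Y ∪ {C | C ∈ Y ∧ degIn T Y C = 1} ⊆ branching T X := by
    rintro C (hC | hC)
    · exact ⟨hC.1.1, hC.2.trans (degIn_mono Set.sdiff_subset C)⟩
    · exact mem_branching_of_degIn_diff_eq_one hC.1 hC.2
  have h4 := Set.ncard_le_ncard h3 (Set.toFinite _)
  omega

end Rounds

/-! ### The layers partition the nodes -/

section Layers

variable {V : Type*} {G : SimpleGraph V} {T : SimpleGraph (MaxClique G)} {k : ℝ}

lemma nodes_anti : Antitone fun i => (pruneState T k i).nodes :=
  antitone_nat_of_succ_le fun _ => Set.sdiff_subset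

lemma layer_subset_nodes (i : ℕ) : layer T k i ⊆ (pruneState T k i).nodes := by
  intro v hv
  obtain ⟨P, -, hv⟩ := Set.mem_iUnion₂.1 hv
  exact hv.1

lemma layer_subset_nodes_succ {i l : ℕ} (h : i < l) :
    layer T k l ⊆ (pruneState T k (i + 1)).nodes :=
  (layer_subset_nodes l).trans (nodes_anti h)

lemma eq_of_mem_layer {i j : ℕ} {v : V} (hi : v ∈ layer T k i) (hj : v ∈ layer T k j) : i = j := by
  rcases lt_trichotomy i j with h | h | h
  · exact absurd hi (layer_subset_nodes_succ h hj).2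
  · exact h
  · exact absurd hj (layer_subset_nodes_succ h hi).2

variable [Fintype V]

lemma two_pow_mul_ncard_branching_lt (hG : IsChordal G) (hT : T.IsAcyclic) (i : ℕ)
    (h : (branching T (pruneState T k i).cliques).Nonempty) :
    2 ^ (i + 1) * (branching T (pruneState T k i).cliques).ncard < Fintype.card V := by
  induction i with
  | zero =>
    have h0 : (pruneState T k 0).cliques = Set.univ := rfl
    rw [h0] at h ⊢
    have h1 := ncard_branching_add_two_le hT h
    have hdisj : Disjoint (branching T Set.univ) {C | C ∈ Set.univ ∧ degIn T Set.univ C = 1} := by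
      rw [Set.disjoint_left]
      rintro C ⟨-, h3⟩ ⟨-, h1⟩
      omega
    have h2 := Set.ncard_union_eq hdisj (Set.toFinite _) (Set.toFinite _)
    have h3 := Set.ncard_le_card (branching T Set.univ ∪
      {C | C ∈ Set.univ ∧ degIn T Set.univ C = 1})
    have h4 := hG.card_maxClique_le
    omega
  | succ i ih =>
    have h1 := two_mul_ncard_branching_le (X := (pruneState T k i).cliques) (k := k) hT h
    have hpos := (Set.ncard_pos (Set.toFinite _)).2 h
    have hne : (branching T (pruneState T k i).cliques).Nonempty := by
      rw [← Set.ncard_pos (Set.toFinite _)]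
      exact lt_of_lt_of_le (Nat.mul_pos two_pos hpos) h1
    calc _ = 2 ^ (i + 1) * (2 * (branching T (pruneState T k (i + 1)).cliques).ncard) := by ring
      _ ≤ 2 ^ (i + 1) * (branching T (pruneState T k i).cliques).ncard :=
        Nat.mul_le_mul_left _ h1
      _ < _ := ih hne

lemma cliques_numIter_eq_empty (hG : IsChordal G) (hT : T.IsAcyclic)
    (hn : 2 ≤ Fintype.card V) : (pruneState T k (numIter V)).cliques = ∅ := by
  have hL : 0 < numIter V := Nat.clog_pos one_lt_two hn
  obtain ⟨m, hm⟩ := Nat.exists_eq_succ_of_ne_zero hL.ne'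
  have hbr : branching T (pruneState T k m).cliques = ∅ := by
    by_contra hne
    have hne := Set.nonempty_iff_ne_empty.2 hne
    have h1 := two_pow_mul_ncard_branching_lt hG hT m hne
    have h2 : Fintype.card V ≤ 2 ^ (m + 1) := by
      have := Nat.le_pow_clog one_lt_two (Fintype.card V)
      rw [numIter] at hm
      rwa [hm] at this
    have := (Set.ncard_pos (Set.toFinite _)).2 hne
    nlinarith
  rw [hm]
  refine Set.sdiff_eq_empty.2 fun C hC => ?_
  have hdeg : degIn T (pruneState T k m).cliques C ≤ 2 := by
    by_contra h
    exact Set.eq_empty_iff_forall_notMem.1 hbr C ⟨hC, by omega⟩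
  obtain ⟨P, hP, hCP⟩ := exists_maximal_isBinaryPath hC hdeg
  exact Set.mem_iUnion₂.2
    ⟨P, ⟨hP, Or.inl (isPendantPath_of_branching_eq_empty hT hbr hP)⟩, hCP⟩

/-- The layers partition the nodes. -/
theorem existsUnique_layer (hG : IsChordal G) (hT : IsCliqueForest G T) (hk : 2 ≤ k)
    (hn : 2 ≤ Fintype.card V) (v : V) : ∃! i, i < numIter V ∧ v ∈ layer T k i := by
  have hv : v ∉ (pruneState T k (numIter V)).nodes := by
    rw [(isPruned_pruneState hT hk _).mem_iff, cliques_numIter_eq_empty hG hT.acyclic hn]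
    simp
  have key : ∀ m, v ∉ (pruneState T k m).nodes → ∃ i < m, v ∈ layer T k i := by
    intro m
    induction m with
    | zero => exact fun h => absurd (Set.mem_univ v) h
    | succ m ih =>
      intro h
      by_cases hm : v ∈ (pruneState T k m).nodes
      · by_contra! hcon
        exact h ⟨hm, hcon m (Nat.lt_succ_self m)⟩
      · obtain ⟨i, hi, hvi⟩ := ih hm
        exact ⟨i, hi.trans (Nat.lt_succ_self m), hvi⟩
  obtain ⟨i, hi, hvi⟩ := key _ hv
  exact ⟨i, ⟨hi, hvi⟩, fun j hj => eq_of_mem_layer hj.2 hvi⟩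

end Layers

/-! ### Interval representations along paths of cliques -/

section IntervalRepresentation

open SimpleGraph

lemma ConnIn.getVert_mem {N : Type*} {T : SimpleGraph N} {K : Set N} (hK : ConnIn T K)
    (hT : T.IsAcyclic) {a b : N} {p : T.Walk a b} (hp : p.IsPath) {i m j : ℕ} (him : i ≤ m)
    (hmj : m ≤ j) (hi : p.getVert i ∈ K) (hj : p.getVert j ∈ K) : p.getVert m ∈ K := by
  have hend : (p.drop i).getVert (j - i) = p.getVert j := by
    rw [Walk.drop_getVert, Nat.add_sub_cancel' (him.trans hmj)]
  have h := hK.mem_of_isPath hT ((hp.drop i).take (j - i)) hi (hend ▸ hj) _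
    (((p.drop i).take (j - i)).getVert_mem_support (m - i))
  rwa [Walk.take_getVert, Walk.drop_getVert, min_eq_right (by omega),
    Nat.add_sub_cancel' him] at h

variable {V : Type*} {G : SimpleGraph V} {T : SimpleGraph (MaxClique G)}

/-- Along a path of a clique forest, the positions of the cliques containing a given node form an
interval. -/
lemma IsCliqueForest.exists_interval (hT : IsCliqueForest G T) {a b : MaxClique G}
    {p : T.Walk a b} (hp : p.IsPath) {v : V} (hv : ∃ C ∈ p.support, v ∈ C.1) :
    ∃ l r : ℕ, l ≤ r ∧ r ≤ p.length ∧
      ∀ i ≤ p.length, v ∈ (p.getVert i).1 ↔ l ≤ i ∧ i ≤ r := by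
  classical
  let I : Finset ℕ := (Finset.range (p.length + 1)).filter fun i => v ∈ (p.getVert i).1
  have hI : ∀ i, i ∈ I ↔ i ≤ p.length ∧ v ∈ (p.getVert i).1 := fun i => by simp [I]
  have hIne : I.Nonempty := by
    obtain ⟨C, hC, hvC⟩ := hv
    obtain ⟨i, rfl, hi⟩ := Walk.mem_support_iff_exists_getVert.1 hC
    exact ⟨i, (hI i).2 ⟨hi, hvC⟩⟩
  have hi := (hI _).1 (I.min'_mem hIne)
  have hj := (hI _).1 (I.max'_mem hIne)
  refine ⟨I.min' hIne, I.max' hIne, I.min'_le _ (I.max'_mem hIne), hj.1, fun i hil => ⟨fun h =>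
    ⟨I.min'_le _ ((hI i).2 ⟨hil, h⟩), I.le_max' _ ((hI i).2 ⟨hil, h⟩)⟩, fun h => ?_⟩⟩
  exact (hT.connIn v).getVert_mem hT.acyclic hp h.1 h.2 hi.2 hj.2

/-- The nodes meeting a path of a clique forest induce an interval graph, if adjacent ones share a
clique of the path. -/
lemma IsCliqueForest.exists_isIntervalOn (hT : IsCliqueForest G T) {a b : MaxClique G}
    {p : T.Walk a b} (hp : p.IsPath) {S : Set V} (hS : ∀ v ∈ S, ∃ C ∈ p.support, v ∈ C.1)
    (hadj : ∀ u ∈ S, ∀ v ∈ S, G.Adj u v → ∃ C ∈ p.support, u ∈ C.1 ∧ v ∈ C.1) :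
    ∃ l r : V → ℤ, IsIntervalOn G S l r ∧ (∀ u ∈ S, u ∈ a.1 → ∀ v ∈ S, l u ≤ l v) ∧
      ∀ u ∈ S, u ∈ b.1 → ∀ v ∈ S, r v ≤ r u := by
  classical
  choose! l r hlr hr hmem using fun v hv => hT.exists_interval hp (hS v hv)
  refine ⟨fun v => l v, fun v => r v, ⟨fun v hv => ?_, fun u hu v hv huv h1 h2 => ?_,
    fun u hu v hv huv => ?_⟩, fun u hu hua v hv => ?_, fun u hu hub v hv => ?_⟩
  · exact_mod_cast hlr v hv
  · have h1' : l u ≤ r v := by exact_mod_cast h1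
    have h2' : l v ≤ r u := by exact_mod_cast h2
    have h3 := hlr u hu
    have h4 := hlr v hv
    have h5 := hr u hu
    have h6 := hr v hv
    exact (p.getVert (max (l u) (l v))).2.1 ((hmem u hu _ (by omega)).2 (by omega))
      ((hmem v hv _ (by omega)).2 (by omega)) huv
  · obtain ⟨C, hC, huC, hvC⟩ := hadj u hu v hv huv
    obtain ⟨i, rfl, hi⟩ := Walk.mem_support_iff_exists_getVert.1 hC
    have h1 := ((hmem u hu i hi).1 huC).1
    have h2 := ((hmem v hv i hi).1 hvC).2
    exact_mod_cast h1.trans h2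
  · have h0 := ((hmem u hu 0 (Nat.zero_le _)).1 (by rwa [p.getVert_zero])).1
    exact Int.ofNat_le.2 (h0.trans (Nat.zero_le _))
  · have h0 := ((hmem u hu p.length le_rfl).1 (by rwa [p.getVert_length])).2
    exact Int.ofNat_le.2 ((hr v hv).trans h0)

variable [Finite V]

/-- A walk of `G` between nodes of the end cliques of a path of a clique forest meets all cliques
of the path. -/
lemma IsCliqueForest.exists_mem_of_walk (hT : IsCliqueForest G T) {a b : MaxClique G}
    {p : T.Walk a b} (hp : p.IsPath) {u v : V} (q : G.Walk u v) (hu : u ∈ a.1) (hv : v ∈ b.1) :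
    ∀ C ∈ p.support, ∃ w ∈ q.support, w ∈ C.1 := by
  have key : ∀ {u v : V} (q : G.Walk u v),
      ConnIn T {C : MaxClique G | ∃ w ∈ q.support, w ∈ C.1} := by
    intro u v q
    induction q with
    | nil => simpa using hT.connIn _
    | @cons u v w huv q ih =>
      obtain ⟨C, hC⟩ := exists_maxClique (G := G) (A := {u, v}) (by
        rw [isClique_pair]; exact fun _ => huv)
      have h := (hT.connIn u).union ih (E := C) (hC (by simp))
        ⟨v, q.start_mem_support, hC (by simp)⟩
      convert h using 1
      ext D
      simp
  exact (key q).mem_of_isPath hT.acyclic hp ⟨u, q.start_mem_support, hu⟩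
    ⟨v, q.end_mem_support, hv⟩

end IntervalRepresentation

/-! ### Correcting the colours inside a path -/

section PathRecoloring

open SimpleGraph

variable {V : Type*} {G : SimpleGraph V} [Finite V] {T : SimpleGraph (MaxClique G)}
  {X P : Set (MaxClique G)} {U : Set V} {k : ℝ}

/-- The nodes of `U` that are contained in a clique of the removed path `P` but are not removed
with it lie in an end clique of `P`. If both ends are needed, then `P` has large diameter. -/
lemma IsPruned.exists_ends (h : IsPruned T X U) (hT : T.IsAcyclic)
    (hP : P ∈ prunedPaths T k X) {W' : Set V} (hW'U : W' ⊆ U)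
    (hW' : ∀ u ∈ W', u ∉ nodesInside T X U P ∧ ∃ C ∈ P, u ∈ C.1) :
    ∃ (a b : MaxClique G) (p : T.Walk a b), p.IsPath ∧ {C | C ∈ p.support} = P ∧
      ((∀ u ∈ W', u ∈ a.1) ∨
        (3 * k ≤ pathDiam P ∧ ∀ u ∈ W', u ∈ a.1 ∨ u ∈ b.1)) := by
  have hcontact : ∀ u ∈ W', ∃ E ∈ P, ∃ F ∈ X, F ∉ P ∧ T.Adj E F ∧ u ∈ E.1 := by
    intro u hu
    obtain ⟨hin, C, hCP, huC⟩ := hW' u hu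
    have hCX := hP.1.1.2.1 hCP
    obtain ⟨D, hD, hDP⟩ : ∃ D ∈ {C | C ∈ X ∧ u ∈ C.1}, D ∉ P := by
      by_contra! hc
      exact hin ⟨hW'U hu, (h.conn u).isPathSet hT hP.1.1.1 hc ⟨C, hCX, huC⟩, hc⟩
    obtain ⟨E, hE, F, hF, h1, h2, h3⟩ := (h.conn u).exists_adj ⟨hCX, huC⟩ hCP hD hDP
    exact ⟨E, h1, F, hF.1, h2, h3, hE.2⟩
  obtain ⟨a, b, p, hp, hpP⟩ := hP.1.1.1
  have hends : ∀ {C D}, C ∈ P → D ∈ X → D ∉ P → T.Adj C D → C = a ∨ C = b :=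
    eq_or_eq_of_adj hp hpP hP.1.1.2.1 hP.1.1.2.2
  by_cases htwo : ∃ C₁ ∈ P, ∃ C₂ ∈ P, ∃ D₁ ∈ X, ∃ D₂ ∈ X, D₁ ∉ P ∧ D₂ ∉ P ∧ T.Adj C₁ D₁ ∧
      T.Adj C₂ D₂ ∧ D₁ ≠ D₂
  · obtain ⟨C₁, hC₁, C₂, hC₂, D₁, hD₁, D₂, hD₂, hD₁P, hD₂P, h₁, h₂, hne⟩ := htwo
    refine ⟨a, b, p, hp, hpP, Or.inr ⟨?_, fun u hu => ?_⟩⟩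
    · rcases hP.2 with hpend | hint
      · exact absurd hpend (not_isPendantPath hC₁ hC₂ hD₁ hD₂ hD₁P hD₂P h₁ h₂ hne)
      · exact hint.2
    · obtain ⟨E, hE, F, hF, hFP, hEF, huE⟩ := hcontact u hu
      rcases hends hE hF hFP hEF with rfl | rfl
      exacts [Or.inl huE, Or.inr huE]
  · push Not at htwo
    rcases W'.eq_empty_or_nonempty with rfl | ⟨u₀, hu₀⟩
    · exact ⟨a, b, p, hp, hpP, Or.inl (by simp)⟩
    obtain ⟨E₀, hE₀, F₀, hF₀, hF₀P, hEF₀, -⟩ := hcontact u₀ hu₀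
    have hall : ∀ u ∈ W', u ∈ E₀.1 := by
      intro u hu
      obtain ⟨E, hE, F, hF, hFP, hEF, huE⟩ := hcontact u hu
      obtain rfl := htwo E₀ hE₀ E hE F₀ hF₀ F hF hF₀P hFP hEF₀ hEF
      by_cases hEE : E₀ = E
      · exact hEE ▸ huE
      · -- otherwise `E₀`, `F₀`, `E` and the part of `P` from `E` to `E₀` would form a cycle
        have hpath : (Walk.cons hEF₀ (.cons hEF.symm .nil)).IsPath := by
          simp [hEF₀.ne, hEF.symm.ne, hEE]
        exact absurd (hP.1.1.1.connIn.mem_of_isPath hT hpath hE₀ hE F₀ (by simp)) hF₀P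
    rcases hends hE₀ hF₀ hF₀P hEF₀ with rfl | rfl
    · exact ⟨E₀, b, p, hp, hpP, Or.inl hall⟩
    · exact ⟨E₀, a, p.reverse, hp.reverse, by rw [← hpP]; ext; simp, Or.inl hall⟩

/-- Let the nodes `W` of a removed path `P` and a set `W'` of remaining neighbours of `W` be legally
coloured. Changing the colours of nodes of `W` close to `W'` makes the colouring of `W ∪ W'`
legal. -/
theorem IsPruned.exists_recoloring (h : IsPruned T X U) (hT : IsCliqueForest G T) (hk : 2 ≤ k)
    (hP : P ∈ prunedPaths T k X) {W' : Set V} (hW'U : W' ⊆ U)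
    (hW' : ∀ u ∈ W', u ∉ nodesInside T X U P ∧ ∃ w ∈ nodesInside T X U P, G.Adj u w)
    {n s t : ℕ} (hs : 1 ≤ s) (ht : 1 ≤ t) (hn : n ≤ s * t) (htk : (t : ℝ) < k + 1)
    (ψ : V → Fin n) (hψ : ∀ u v, G.Adj u v → ψ u ≠ ψ v) {c : V → ℕ}
    (hcW : LegalOn G (nodesInside T X U P) ((n + s : ℕ) : ℝ) c)
    (hcW' : LegalOn G W' ((n + s : ℕ) : ℝ) c) :
    ∃ c', LegalOn G (nodesInside T X U P ∪ W') ((n + s : ℕ) : ℝ) c' ∧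
      ∀ v, c' v ≠ c v → v ∈ nodesInside T X U P ∧
        ∃ u ∈ W', G.Reachable v u ∧ (G.dist v u : ℝ) ≤ k + 3 := by
  set W := nodesInside T X U P with hWdef
  have hWU : W ⊆ U := fun v hv => hv.1
  have hcommon : ∀ w ∈ W, ∀ u ∈ U, G.Adj w u → ∃ C ∈ P, w ∈ C.1 ∧ u ∈ C.1 := by
    intro w hw u hu hwu
    obtain ⟨C, hC, h1, h2⟩ := h.common w hw.1 u hu hwu
    exact ⟨C, hw.2.2 ⟨hC, h1⟩, h1, h2⟩
  have hWP : ∀ w ∈ W, ∃ C ∈ P, w ∈ C.1 := by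
    intro w hw
    obtain ⟨C, hC, h1⟩ := (h.mem_iff w).1 hw.1
    exact ⟨C, hw.2.2 ⟨hC, h1⟩, h1⟩
  have hW'P : ∀ u ∈ W', ∃ C ∈ P, u ∈ C.1 := by
    intro u hu
    obtain ⟨-, w, hw, huw⟩ := hW' u hu
    obtain ⟨C, hC, -, h2⟩ := hcommon w hw u (hW'U hu) huw.symm
    exact ⟨C, hC, h2⟩
  obtain ⟨a, b, p, hp, hpP, hends⟩ := h.exists_ends hT.acyclic hP hW'U fun u hu =>
    ⟨(hW' u hu).1, hW'P u hu⟩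
  have hmemP : ∀ C, C ∈ p.support ↔ C ∈ P := fun C => by rw [← hpP]; rfl
  have haP : a ∈ P := (hmemP a).1 p.start_mem_support
  have hbP : b ∈ P := (hmemP b).1 p.end_mem_support
  -- short walks do not join the two ends of a path of large diameter
  have hfar : 3 * k ≤ pathDiam P → ∀ u v (q : G.Walk u v), u ∈ a.1 → v ∈ b.1 →
      t + 1 < q.length := by
    intro hd u v q hu hv
    by_contra! hq
    have h1 := pathDiam_le_of_walk (P := P) q fun C hC =>
      hT.exists_mem_of_walk hp q hu hv C ((hmemP C).2 hC)
    have h2 : (pathDiam P : ℝ) ≤ t + 3 := by exact_mod_cast (by omega : pathDiam P ≤ t + 3)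
    linarith
  have hends' : ∀ u ∈ W', u ∈ a.1 ∨ u ∈ b.1 := fun u hu =>
    hends.elim (fun h1 => Or.inl (h1 u hu)) fun h1 => h1.2 u hu
  have hadj' : ∀ u ∈ W', ∀ v ∈ W', G.Adj u v → ∃ C ∈ P, u ∈ C.1 ∧ v ∈ C.1 := by
    intro u hu v hv huv
    rcases hends with h1 | ⟨hd, h1⟩
    · exact ⟨a, haP, h1 u hu, h1 v hv⟩
    · rcases h1 u hu with hua | hub <;> rcases h1 v hv with hva | hvb
      · exact ⟨a, haP, hua, hva⟩
      · have := hfar hd u v (.cons huv .nil) hua hvb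
        simp at this
      · have := hfar hd v u (.cons huv.symm .nil) hva hub
        simp at this
      · exact ⟨b, hbP, hub, hvb⟩
  obtain ⟨l, r, hint, hl, hr⟩ := hT.exists_isIntervalOn hp (S := W ∪ W')
    (by
      rintro v (hv | hv)
      · simpa only [hmemP] using hWP v hv
      · simpa only [hmemP] using hW'P v hv)
    (by
      simp only [hmemP]
      rintro u (hu | hu) v (hv | hv) huv
      · exact hcommon u hu v (hWU hv) huv
      · exact hcommon u hu v (hW'U hv) huv
      · obtain ⟨C, hC, h1, h2⟩ := hcommon v hv u (hW'U hu) huv.symm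
        exact ⟨C, hC, h2, h1⟩
      · exact hadj' u hu v hv huv)
  let A : Set V := {u | u ∈ W' ∧ u ∈ a.1}
  let B : Set V := {u | u ∈ W' ∧ u ∉ a.1}
  have hAB : A ∪ B = W' := by
    ext u
    simp only [A, B, Set.mem_union, Set.mem_ofPred_eq]
    tauto
  have hAW' : A ⊆ W' := fun u hu => hu.1
  have hBW' : B ⊆ W' := fun u hu => hu.1
  have hBb : ∀ u ∈ B, u ∈ b.1 := fun u hu => (hends' u hu.1).resolve_left hu.2
  obtain ⟨c', hc', hch⟩ := hint.exists_recoloring hs ht hn ψ hψ (A := A) (B := B) (c := c)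
    (fun u hu => Or.inr hu.1) (fun u hu => Or.inr hu.1)
    (fun u hu v hv => hl u (Or.inr hu.1) hu.2 v hv)
    (fun u hu v hv => hr u (Or.inr hu.1) (hBb u hu) v hv)
    (by
      intro u hu hreach
      rcases hends with h1 | ⟨hd, -⟩
      · exact hu.2 (h1 u hu.1)
      obtain ⟨x, hx, q, hq⟩ := exists_walk_of_mem_reachWithin hreach
      have := hfar hd x u q hx.2 (hBb u hu)
      omega)
    (hcW'.mono hAW') (hcW'.mono hBW')
    (hcW.mono (by
      rw [hAB]
      rintro v ⟨hv | hv, hv'⟩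
      exacts [hv, absurd hv hv']))
  refine ⟨c', hc', fun v hv => ?_⟩
  obtain ⟨hvS, hvA, hvB, u, hu, q, hq⟩ := hch v hv
  rw [hAB] at hu
  have hvW' : v ∉ W' := fun hc => (hAB ▸ hc : v ∈ A ∪ B).elim hvA hvB
  refine ⟨hvS.resolve_right hvW', u, hu, q.reverse.reachable, ?_⟩
  have h1 := dist_le q.reverse
  rw [Walk.length_reverse] at h1
  have h2 : (G.dist v u : ℝ) ≤ t + 2 := by exact_mod_cast h1.trans hq
  linarith

end PathRecoloring

/-! ### Numbers of colours -/

section Numbers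

open SimpleGraph

variable {V : Type*} {G : SimpleGraph V}

lemma legalOn_floor_iff {S : Set V} {b : ℝ} (hb : 0 ≤ b) {c : V → ℕ} :
    LegalOn G S (⌊b⌋₊ : ℕ) c ↔ LegalOn G S b c := by
  simp only [LegalOn, Nat.cast_le, Nat.le_floor_iff hb]

variable [Fintype V]

lemma colorable_toNat_chromaticNumber (G : SimpleGraph V) :
    G.Colorable G.chromaticNumber.toNat :=
  colorable_chromaticNumber G.colorable_of_fintype

lemma chi_induce_le (S : Set V) : chi (G.induce S) ≤ chi G := by
  have h := ((colorable_toNat_chromaticNumber G).of_hom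
    (Embedding.induce (G := G) S).toHom).chromaticNumber_le
  exact Nat.cast_le.2 (ENat.toNat_le_of_le_natCast h)

lemma chi_le_card : chi G ≤ Fintype.card V := by
  exact Nat.cast_le.2 <| ENat.toNat_le_of_le_natCast G.colorable_of_fintype.chromaticNumber_le

lemma chi_pos [Nonempty V] : 0 < chi G := by
  rw [chi, Nat.cast_pos, Nat.pos_iff_ne_zero]
  intro h
  have h0 := colorable_toNat_chromaticNumber G
  rw [h] at h0
  obtain ⟨v⟩ := ‹Nonempty V›
  exact (h0.some v).elim0

end Numbers

/-! ### The colouring and correction phases -/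

section Run

variable {V : Type*} {G : SimpleGraph V} {T : SimpleGraph (MaxClique G)} {k : ℝ}

lemma pathNodes_subset_layer {i : ℕ} {P : Set (MaxClique G)} (hP : P ∈ layerPaths T k i) :
    pathNodes T k i P ⊆ layer T k i := fun _ hv => Set.mem_iUnion₂.2 ⟨P, hP, hv⟩

variable [Fintype V]

lemma IsPruned.eq_of_adj_of_mem_nodesInside {X : Set (MaxClique G)} {U : Set V}
    (h : IsPruned T X U) {P Q : Set (MaxClique G)} (hP : P ∈ prunedPaths T k X)
    (hQ : Q ∈ prunedPaths T k X) {u v : V} (hu : u ∈ nodesInside T X U P)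
    (hv : v ∈ nodesInside T X U Q) (huv : G.Adj u v) : P = Q := by
  obtain ⟨C, hC, h1, h2⟩ := h.common u hu.1 v hv.1 huv
  exact eq_of_maximal_isBinaryPath hP.1 hQ.1 (hu.2.2 ⟨hC, h1⟩) (hv.2.2 ⟨hC, h2⟩)

lemma IsPruned.eq_of_mem_nodesInside {X : Set (MaxClique G)} {U : Set V}
    (h : IsPruned T X U) {P Q : Set (MaxClique G)} (hP : P ∈ prunedPaths T k X)
    (hQ : Q ∈ prunedPaths T k X) {u : V} (hu : u ∈ nodesInside T X U P)
    (hu' : u ∈ nodesInside T X U Q) : P = Q := by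
  obtain ⟨C, hC, h1⟩ := (h.mem_iff u).1 hu.1
  exact eq_of_maximal_isBinaryPath hP.1 hQ.1 (hu.2.2 ⟨hC, h1⟩) (hu'.2.2 ⟨hC, h1⟩)

lemma eq_of_mem_pathNodes (hT : IsCliqueForest G T) (hk : 2 ≤ k) {i j : ℕ}
    {P Q : Set (MaxClique G)} (hP : P ∈ layerPaths T k i) (hQ : Q ∈ layerPaths T k j) {v : V}
    (hv : v ∈ pathNodes T k i P) (hv' : v ∈ pathNodes T k j Q) : (i, P) = (j, Q) := by
  obtain rfl := eq_of_mem_layer (pathNodes_subset_layer hP hv) (pathNodes_subset_layer hQ hv')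
  rw [(isPruned_pruneState hT hk i).eq_of_mem_nodesInside hP hQ hv hv']

/-- What holds for a colouring after treating the paths in `l₁` in the correction phase: all colours
are in `{1, …, ⌊b⌋}`, the nodes inside each removed path are legally coloured, and there is no
conflict between the nodes inside a treated path and the later layers. -/
structure CorrectedOn (T : SimpleGraph (MaxClique G)) (k b : ℝ)
    (l₁ : List (ℕ × Set (MaxClique G))) (c : V → ℕ) : Prop where
  range : ∀ v, 1 ≤ c v ∧ (c v : ℝ) ≤ b
  path : ∀ i < numIter V, ∀ P ∈ layerPaths T k i, ∀ u ∈ pathNodes T k i P,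
    ∀ v ∈ pathNodes T k i P, G.Adj u v → c u ≠ c v
  later : ∀ s ∈ l₁, ∀ u ∈ pathNodes T k s.1 s.2, ∀ v ∈ boundary T k s.1 s.2, G.Adj u v →
    c u ≠ c v

variable {b : ℝ} {c d : V → ℕ} {l₁ : List (ℕ × Set (MaxClique G))}

lemma CorrectedOn.ne_of_mem_layer (h : CorrectedOn T k b l₁ c) (hT : IsCliqueForest G T)
    (hk : 2 ≤ k) {i : ℕ} (hi : i < numIter V) {u v : V} (hu : u ∈ layer T k i)
    (hv : v ∈ layer T k i) (huv : G.Adj u v) : c u ≠ c v := by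
  obtain ⟨P, hP, hu⟩ := Set.mem_iUnion₂.1 hu
  obtain ⟨Q, hQ, hv⟩ := Set.mem_iUnion₂.1 hv
  obtain rfl := (isPruned_pruneState hT hk i).eq_of_adj_of_mem_nodesInside hP hQ hu hv huv
  exact h.path i hi P hP u hu v hv huv

lemma CorrectedOn.ne_of_lt (h : CorrectedOn T k b l₁ c) {i j : ℕ} (hij : i < j)
    (hj : j < numIter V) (hl : ∀ P ∈ layerPaths T k i, (i, P) ∈ l₁) {u v : V}
    (hu : u ∈ layer T k i) (hv : v ∈ layer T k j) (huv : G.Adj u v) : c u ≠ c v := by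
  obtain ⟨P, hP, hu⟩ := Set.mem_iUnion₂.1 hu
  exact h.later (i, P) (hl P hP) u hu v ⟨⟨j, hij, hj, hv⟩, u, hu, huv.symm⟩ huv

/-- A set of nodes is legally coloured if all removed paths of the layers it meets have been treated,
except for the last layer, which needs no treatment. -/
lemma CorrectedOn.legalOn (h : CorrectedOn T k b l₁ c) (hT : IsCliqueForest G T) (hk : 2 ≤ k)
    {S : Set V} (hS : ∀ v ∈ S, ∃ i < numIter V, v ∈ layer T k i ∧
      (i + 1 < numIter V → ∀ P ∈ layerPaths T k i, (i, P) ∈ l₁)) : LegalOn G S b c := by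
  refine ⟨fun v _ => h.range v, fun u hu v hv huv => ?_⟩
  obtain ⟨i, hi, hui, hli⟩ := hS u hu
  obtain ⟨j, hj, hvj, hlj⟩ := hS v hv
  rcases lt_trichotomy i j with hij | rfl | hij
  · exact h.ne_of_lt hij hj (hli (by omega)) hui hvj huv
  · exact h.ne_of_mem_layer hT hk hi hui hvj huv
  · exact (h.ne_of_lt hij hi (hlj (by omega)) hvj hui huv.symm).symm

lemma IsColoringPhase.correctedOn (h : IsColoringPhase T k c) (hk : 2 ≤ k) (hpart : ∀ v : V, ∃! i, i < numIter V ∧ v ∈ layer T k i) :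
    CorrectedOn T k ((1 + 1 / k) * chi G + 1) [] c where
  range v := by
    obtain ⟨i, ⟨hi, hv⟩, -⟩ := hpart v
    obtain ⟨h1, h2⟩ := (h i hi).1 v hv
    have := mul_le_mul_of_nonneg_left (chi_induce_le (G := G) (layer T k i))
      (by positivity : 0 ≤ 1 + 1 / k)
    exact ⟨h1, by linarith⟩
  path i hi P hP u hu v hv huv :=
    (h i hi).2 u (pathNodes_subset_layer hP hu) v (pathNodes_subset_layer hP hv) huv
  later := by simp

lemma CorrectedOn.step (h : CorrectedOn T k ((1 + 1 / k) * chi G + 1) l₁ c)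
    (hT : IsCliqueForest G T) (hk : 2 ≤ k) {s : ℕ × Set (MaxClique G)}
    (hs : s.2 ∈ layerPaths T k s.1) (hl₁ : ∀ s' ∈ l₁, s'.2 ∈ layerPaths T k s'.1 ∧ s.1 ≤ s'.1)
    (hstep : CorrectionStep T k s c d) :
    CorrectedOn T k ((1 + 1 / k) * chi G + 1) (l₁ ++ [s]) d := by
  obtain ⟨hch, hleg⟩ := hstep
  have hd : ∀ v ∉ pathNodes T k s.1 s.2, d v = c v := fun v hv => by
    by_contra hc
    exact hv (hch v hc).1
  refine ⟨fun v => ?_, fun i hi P hP u hu v hv huv => ?_, fun s' hs' u hu v hv huv => ?_⟩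
  · by_cases hv : v ∈ pathNodes T k s.1 s.2
    · exact hleg.1 v (Or.inl hv)
    · rw [hd v hv]; exact h.range v
  · by_cases hmem : u ∈ pathNodes T k s.1 s.2 ∨ v ∈ pathNodes T k s.1 s.2
    · have heq : (i, P) = s := hmem.elim (eq_of_mem_pathNodes hT hk hP hs hu)
        (eq_of_mem_pathNodes hT hk hP hs hv)
      subst heq
      exact hleg.2 u (Or.inl hu) v (Or.inl hv) huv
    · rw [hd u fun hc => hmem (Or.inl hc), hd v fun hc => hmem (Or.inr hc)]
      exact h.path i hi P hP u hu v hv huv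
  · rcases List.mem_append.1 hs' with hs' | hs'
    · by_cases hus : u ∈ pathNodes T k s.1 s.2
      · obtain rfl : s' = s := eq_of_mem_pathNodes hT hk (hl₁ s' hs').1 hs hu hus
        exact hleg.2 u (Or.inl hu) v (Or.inr hv) huv
      · have hvs : v ∉ pathNodes T k s.1 s.2 := by
          intro hvs
          obtain ⟨⟨j, hj, -, hvj⟩, -⟩ := hv
          have := eq_of_mem_layer hvj (pathNodes_subset_layer hs hvs)
          have := (hl₁ s' hs').2
          omega
        rw [hd u hus, hd v hvs]
        exact h.later s' hs' u hu v hv huv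
    · obtain rfl := List.mem_singleton.1 hs'
      exact hleg.2 u (Or.inl hu) v (Or.inr hv) huv

lemma CorrectedOn.run (hT : IsCliqueForest G T) (hk : 2 ≤ k)
    (l₂ l₁ : List (ℕ × Set (MaxClique G)))
    (hl : ∀ s ∈ l₁ ++ l₂, s.2 ∈ layerPaths T k s.1)
    (hsort : (l₁ ++ l₂).Pairwise fun s t => t.1 ≤ s.1) {c d : V → ℕ}
    (h : CorrectedOn T k ((1 + 1 / k) * chi G + 1) l₁ c) (hrun : CorrectionRun T k l₂ c d) :
    CorrectedOn T k ((1 + 1 / k) * chi G + 1) (l₁ ++ l₂) d := by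
  induction l₂ generalizing l₁ c with
  | nil =>
    obtain rfl : d = c := hrun
    simpa using h
  | cons s l₂ ih =>
    obtain ⟨e, hstep, hrun⟩ := hrun
    have heq : l₁ ++ s :: l₂ = (l₁ ++ [s]) ++ l₂ := by simp
    have h' := h.step hT hk (hl s (by simp)) (fun s' hs' => ⟨hl s' (by simp [hs']),
      (List.pairwise_append.1 hsort).2.2 s' hs' s (by simp)⟩) hstep
    rw [heq] at hl hsort ⊢
    exact ih (l₁ ++ [s]) hl hsort h' hrun

/-- A correction step is possible whenever all paths of later layers have been treated. The number
`⌊(1 + 1 / k) χ(G) + 1⌋` of colours exceeds `χ(G)` by `⌊χ(G) / k⌋ + 1`, which is at least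
`χ(G) / ⌈k⌉`. -/
lemma CorrectedOn.exists_correctionStep (h : CorrectedOn T k ((1 + 1 / k) * chi G + 1) l₁ c)
    (hT : IsCliqueForest G T) (hk : 2 ≤ k) {s : ℕ × Set (MaxClique G)} (hsL : s.1 < numIter V)
    (hs : s.2 ∈ layerPaths T k s.1)
    (hl₁ : ∀ i, s.1 < i → i + 1 < numIter V → ∀ P ∈ layerPaths T k i, (i, P) ∈ l₁) :
    ∃ c', CorrectionStep T k s c c' := by
  obtain ⟨i, P⟩ := s
  have hk0 : 0 < k := by linarith
  let n : ℕ := G.chromaticNumber.toNat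
  have hchi : chi G = n := rfl
  have hb : 0 ≤ (1 + 1 / k) * chi G + 1 := by rw [hchi]; positivity
  have hfloor : ⌊(1 + 1 / k) * chi G + 1⌋₊ = n + (⌊(n : ℝ) / k⌋₊ + 1) := by
    have : (1 + 1 / k) * chi G + 1 = (n : ℝ) / k + (n + 1 : ℕ) := by
      rw [hchi]; push_cast; ring
    rw [this, Nat.floor_add_natCast (by positivity)]
    omega
  have hn : n ≤ (⌊(n : ℝ) / k⌋₊ + 1) * ⌈k⌉₊ := by
    have h1 := (Nat.lt_floor_add_one ((n : ℝ) / k)).le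
    have h2 := Nat.le_ceil k
    have h3 : (n : ℝ) ≤ (⌊(n : ℝ) / k⌋₊ + 1) * ⌈k⌉₊ := by
      calc (n : ℝ) = (n : ℝ) / k * k := by field_simp
        _ ≤ _ := mul_le_mul h1 h2 hk0.le (by positivity)
    exact_mod_cast h3
  obtain ⟨ψ⟩ := colorable_toNat_chromaticNumber G
  have hW : LegalOn G (pathNodes T k i P) ((1 + 1 / k) * chi G + 1) c :=
    ⟨fun v _ => h.range v, h.path i hsL P hs⟩
  have hW' : LegalOn G (boundary T k i P) ((1 + 1 / k) * chi G + 1) c := by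
    refine h.legalOn hT hk fun v hv => ?_
    obtain ⟨⟨j, hij, hj, hvj⟩, -⟩ := hv
    exact ⟨j, hj, hvj, hl₁ j hij⟩
  rw [← legalOn_floor_iff hb, hfloor] at hW hW'
  obtain ⟨c', hc', hch⟩ := (isPruned_pruneState hT hk i).exists_recoloring hT hk hs
    (W' := boundary T k i P)
    (fun v hv => by
      obtain ⟨⟨j, hij, -, hvj⟩, -⟩ := hv
      exact (layer_subset_nodes_succ hij hvj).1)
    (fun v hv => by
      obtain ⟨⟨j, hij, -, hvj⟩, hw⟩ := hv
      exact ⟨fun hc => (layer_subset_nodes_succ hij hvj).2 (pathNodes_subset_layer hs hc), hw⟩)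
    (Nat.le_add_left 1 _) (Nat.ceil_pos.2 hk0) hn (Nat.ceil_lt_add_one hk0.le) ψ
    (fun u v huv => ψ.valid huv) hW hW'
  refine ⟨c', hch, ?_⟩
  rw [← legalOn_floor_iff hb, hfloor]
  exact hc'

theorem exists_isColoringPhase (hk : 2 ≤ k)
    (hpart : ∀ v : V, ∃! i, i < numIter V ∧ v ∈ layer T k i) :
    ∃ c₀ : V → ℕ, IsColoringPhase T k c₀ := by
  classical
  have hlayer : ∀ i, ∃ c : V → ℕ,
      LegalOn G (layer T k i) ((1 + 1 / k) * chi (G.induce (layer T k i)) + 1) c := by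
    intro i
    obtain ⟨φ⟩ := colorable_toNat_chromaticNumber (G.induce (layer T k i))
    refine ⟨fun v => if h : v ∈ layer T k i then φ ⟨v, h⟩ + 1 else 0, fun v hv => ?_,
      fun u hu v hv huv => ?_⟩
    · have h1 : (φ ⟨v, hv⟩ : ℕ) + 1 ≤ (G.induce (layer T k i)).chromaticNumber.toNat :=
        (φ ⟨v, hv⟩).isLt
      have h2 : (((φ ⟨v, hv⟩ : ℕ) + 1 : ℕ) : ℝ) ≤ chi (G.induce (layer T k i)) := Nat.cast_le.2 h1
      have h3 : 0 ≤ 1 / k * chi (G.induce (layer T k i)) := by unfold chi; positivity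
      simp only [hv, dif_pos]
      exact ⟨by omega, by linarith⟩
    · have := φ.valid (v := ⟨u, hu⟩) (w := ⟨v, hv⟩) huv
      simp only [hu, hv, dif_pos]
      intro hc
      exact this (Fin.ext (Nat.succ_injective hc))
  choose c hc using hlayer
  choose idx hidx huniq using hpart
  refine ⟨fun v => c (idx v) v, fun i hi => (hc i).congr fun v hv => ?_⟩
  rw [← huniq v i ⟨hi, hv⟩]

theorem exists_isSchedule (T : SimpleGraph (MaxClique G)) (k : ℝ) :
    ∃ l : List (ℕ × Set (MaxClique G)), IsSchedule T k l := by
  classical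
  have hfin : {s : ℕ × Set (MaxClique G) |
      s.1 + 1 < numIter V ∧ s.2 ∈ layerPaths T k s.1}.Finite :=
    ((Set.finite_Iio (numIter V)).prod Set.finite_univ).subset fun s hs =>
      ⟨(Nat.lt_succ_self s.1).trans hs.1, trivial⟩
  let l := hfin.toFinset.toList.mergeSort fun s t => decide (t.1 ≤ s.1)
  have hperm := List.mergeSort_perm hfin.toFinset.toList fun s t => decide (t.1 ≤ s.1)
  refine ⟨l, hperm.nodup_iff.2 (Finset.nodup_toList _), fun s => ?_, ?_⟩
  · rw [hperm.mem_iff]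
    simp
  · have := List.pairwise_mergeSort (le := fun s t : ℕ × Set (MaxClique G) => decide (t.1 ≤ s.1))
      (fun a b c h1 h2 => by simp only [decide_eq_true_eq] at *; omega)
      (fun a b => by simp only [Bool.or_eq_true, decide_eq_true_eq]; omega) hfin.toFinset.toList
    simpa using this

end Run

end ChordalColoring

theorem theorem4p9 {V : Type*} [Fintype V] [Nonempty V] (G : SimpleGraph V) (hG : IsChordal G)
    (ε k : ℝ) (hε : 2 / chi G < ε) (hε1 : ε ≤ 1) (hk : k = 2 / ε) :
    -- the input of the algorithm exists
    (∃ T : SimpleGraph (MaxClique G), IsCliqueForest G T) ∧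
    (∀ T : SimpleGraph (MaxClique G), IsCliqueForest G T →
      -- every node is assigned to exactly one layer
      (∀ v : V, ∃! i, i < numIter V ∧ v ∈ layer T k i) ∧
      -- the colouring phase can be carried out, and there is an order for the correction phase
      (∃ c₀ : V → ℕ, IsColoringPhase T k c₀) ∧
      (∃ l : List (ℕ × Set (MaxClique G)), IsSchedule T k l) ∧
      ∀ c₀ : V → ℕ, IsColoringPhase T k c₀ →
        ∀ l : List (ℕ × Set (MaxClique G)), IsSchedule T k l →
          -- the correction phase never gets stuck, whatever choices have been made before
          (∀ l₁ s l₂, l = l₁ ++ s :: l₂ → ∀ c, CorrectionRun T k l₁ c₀ c →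
            ∃ c', CorrectionStep T k s c c') ∧
          -- every output is a legal colouring of the graph with few colours
          (∀ c, CorrectionRun T k l c₀ c →
            LegalOn G Set.univ ((1 + 1 / k) * chi G + 1) c)) ∧
    (1 + 1 / k) * chi G + 1 ≤ (1 + ε) * chi G := by
  have hchi : 0 < chi G := chi_pos
  have hε0 : 0 < ε := (div_pos two_pos hchi).trans hε
  have hεχ : 2 < ε * chi G := by rwa [div_lt_iff₀ hchi] at hε
  have hk2 : 2 ≤ k := by rw [hk, le_div_iff₀ hε0]; linarith
  have hn : 2 ≤ Fintype.card V := by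
    have h1 : (2 : ℝ) < Fintype.card V := by
      have := chi_le_card (G := G)
      nlinarith
    exact_mod_cast h1.le
  refine ⟨hG.exists_isCliqueForest, fun T hT => ?_, ?_⟩
  · have hpart := existsUnique_layer hG hT hk2 hn
    refine ⟨hpart, exists_isColoringPhase hk2 hpart, exists_isSchedule T k,
      fun c₀ hc₀ l ⟨_, hmem, hsort⟩ => ⟨?_, fun c hrun => ?_⟩⟩
    · rintro l₁ s l₂ rfl c hrun
      have hs := (hmem s).1 (by simp)
      have h := CorrectedOn.run hT hk2 l₁ [] (fun s' hs' => ((hmem s').1 (by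
          rw [List.nil_append] at hs'; simp [hs'])).2)
        (by simpa using (List.pairwise_append.1 hsort).1) (hc₀.correctedOn hk2 hpart) hrun
      refine h.exists_correctionStep hT hk2 (by omega) hs.2 fun i hsi hi P hP => ?_
      have hmemP := (hmem (i, P)).2 ⟨hi, hP⟩
      rcases List.mem_append.1 hmemP with h1 | h1
      · simpa using h1
      rcases List.mem_cons.1 h1 with h1 | h1
      · subst h1; exact absurd hsi (lt_irrefl _)
      · have := (List.pairwise_cons.1 (List.pairwise_append.1 hsort).2.1).1 _ h1
        exact absurd hsi (not_lt.2 this)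
    · have h := CorrectedOn.run hT hk2 l [] (fun s hs => ((hmem s).1 (by simpa using hs)).2)
        (by simpa using hsort) (hc₀.correctedOn hk2 hpart) hrun
      refine h.legalOn hT hk2 fun v _ => ?_
      obtain ⟨i, ⟨hi, hv⟩, -⟩ := hpart v
      exact ⟨i, hi, hv, fun hi1 P hP => by simpa using (hmem (i, P)).2 ⟨hi1, hP⟩⟩
  · have h1 : 1 / k = ε / 2 := by rw [hk]; field_simp
    rw [h1]
    linarith
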